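/- Let $\mathfrak g$ be a finite-dimensional simple complex Lie algebra with Cartan subalgebra $\mathfrak h$, simple roots $\alpha_i$, simple coroots $h_i\in\mathfrak h$ and fundamental weights $\omega_i$ ($i\in I$), and let $\lambda=\sum_i r_i\omega_i$ with $r_i\in\mathbb Z_{\ge 0}$. Let $A$ be a finitely generated commutative associative unital $\mathbb C$-algebra, and give $\mathfrak g\otimes A$ the bracket $[x\otimes a,y\otimes b]=[x,y]\otimes ab$. Let $V(\lambda)$ be the simple $\mathfrak g$-module of highest weight $\lambda$ with highest weight vector $v_\lambda$ and put $P=U(\mathfrak g\otimes A)\otimes_{U(\mathfrak g)}V(\lambda)$. The global Weyl module is $$W_A(\lambda)=P\Big/\sum_{\mu\not\le\lambda}U(\mathfrak g\otimes A)P_\mu ,$$ where $P_\mu$ is the $\mu$-weight space and $\mu\le\lambda$ means that $\lambda-\mu$ is a non-negative integral combination of simple roots. Let $w_\lambda$ be the image of $1\otimes v_\lambda$ and $$\mathbf A_\lambda=U(\mathfrak h\otimes A)/\{u: u w_\lambda=0\}.$$ Let $r_\lambda=\sum_i r_i$, let $S_\lambda=\prod_i S_{r_i}$ permute the factors of $A^{\otimes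 r_\lambda}$ block by block, and let $\mathbb A_\lambda=(A^{\otimes r_\lambda})^{S_\lambda}$. For $a\in A$ let $\mathrm{sym}^i_\lambda(a)\in\mathbb A_\lambda$ be the sum, over the $r_i$ positions of the $i$-th block, of the pure tensor with $a$ at that position and $1$ elsewhere. Write $\max B$ for the set of maximal ideals of a commutative ring $B$ and $\mathrm{ev}_S:A\to A/S=\mathbb C$ for $S\in\max A$. (i) Sending a tuple $(S_{i,k})_{i\in I,\,1\le k\le r_i}$ of maximal ideals of $A$ to the kernel $\mathbb M_S$ of the restriction of $\bigotimes\mathrm{ev}_{S_{i,k}}$ to $\mathbb A_\lambda$ identifies $\max\mathbb A_\lambda$ with the set of $S_\lambda$-orbits in $(\max A)^{r_\lambda}$. There is a canonical bijection $\max\mathbb A_\lambda\to\max\mathbf A_\lambda$: it is the unique bijection $e$ such that, for every tuple $S$, every $i\in I$ and every $a\in A$, the class of $h_i\otimes a$ is congruent to $\sum_{k=1}^{r_i}\mathrm{ev}_{S_{i,k}}(a)$ modulo the maximal ideal $e(\mathbb M_S)$. (ii) If the Jacobson radical of $A$ is zero, there is an isomorphism of $\mathbb C$-algebras $\tau_\lambda:\mathbf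 A_\lambda\to\mathbb A_\lambda$ that maps the class of $h_i\otimes a$ to $\mathrm{sym}^i_\lambda(a)$ for all $i\in I$ and $a\in A$. -/

import Mathlib

open scoped TensorProduct

noncomputable section

namespace GlobalWeyl

/-! ### Enveloping algebras and the current algebra `A ⊗ g` -/

section Enveloping

attribute [local instance] LieRing.ofAssociativeRing

/-- The universal enveloping algebra `U(L)` of a complex Lie algebra. -/
abbrev U (L : Type*) [LieRing L] [LieAlgebra ℂ L] : Type _ := UniversalEnvelopingAlgebra ℂ L

/-- The algebra homomorphism `U(L) → U(L')` induced by a Lie algebra homomorphism. -/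
def mapU {L L' : Type*} [LieRing L] [LieAlgebra ℂ L] [LieRing L'] [LieAlgebra ℂ L']
    (f : L →ₗ⁅ℂ⁆ L') : U L →ₐ[ℂ] U L' :=
  UniversalEnvelopingAlgebra.lift ℂ ((UniversalEnvelopingAlgebra.ι ℂ).comp f)

/-- The inclusion `x ↦ 1 ⊗ x` of `g` into the current Lie algebra `A ⊗ g`, whose bracket is
`[a ⊗ x, b ⊗ y] = a b ⊗ [x, y]`. -/
def constIncl (A g : Type*) [CommRing A] [Algebra ℂ A] [LieRing g] [LieAlgebra ℂ g] :
    g →ₗ⁅ℂ⁆ A ⊗[ℂ] g :=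
  { TensorProduct.mk ℂ A g 1 with
    map_lie' := fun {x y} => by
      simp [LieAlgebra.ExtendScalars.bracket_tmul] }

/-- The inclusion `A ⊗ H → A ⊗ g` for a Lie subalgebra `H` of `g`. -/
def subIncl (A : Type*) {g : Type*} [CommRing A] [Algebra ℂ A] [LieRing g] [LieAlgebra ℂ g]
    (H : LieSubalgebra ℂ g) : A ⊗[ℂ] H →ₗ⁅ℂ⁆ A ⊗[ℂ] g :=
  LieAlgebra.ExtendScalars.map (AlgHom.id ℂ A) H.incl

theorem adjoin_range_ι (L : Type*) [LieRing L] [LieAlgebra ℂ L] :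
    Algebra.adjoin ℂ (Set.range (UniversalEnvelopingAlgebra.ι ℂ : L → U L)) = ⊤ := by
  set S : Subalgebra ℂ (U L) :=
    Algebra.adjoin ℂ (Set.range (UniversalEnvelopingAlgebra.ι ℂ : L → U L)) with hS
  have hmem : ∀ x : L, UniversalEnvelopingAlgebra.ι ℂ x ∈ S := fun x =>
    Algebra.subset_adjoin ⟨x, rfl⟩
  let f : L →ₗ⁅ℂ⁆ S :=
    { toFun := fun x => ⟨UniversalEnvelopingAlgebra.ι ℂ x, hmem x⟩
      map_add' := fun x y => Subtype.ext (by simp)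
      map_smul' := fun c x => Subtype.ext (by simp)
      map_lie' := fun {x y} => Subtype.ext (by
        exact LieHom.map_lie (UniversalEnvelopingAlgebra.ι ℂ) x y) }
  have h : S.val.comp (UniversalEnvelopingAlgebra.lift ℂ f) = AlgHom.id ℂ (U L) := by
    apply UniversalEnvelopingAlgebra.hom_ext
    ext x
    have := UniversalEnvelopingAlgebra.lift_ι_apply ℂ f x
    exact congrArg S.val this
  refine eq_top_iff.2 fun u _ => ?_
  have hu : S.val (UniversalEnvelopingAlgebra.lift ℂ f u) = u := DFunLike.congr_fun h u
  rw [← hu]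
  exact Subtype.property _

theorem U_mul_comm (L : Type*) [LieRing L] [LieAlgebra ℂ L] (hL : ∀ x y : L, ⁅x, y⁆ = 0)
    (u v : U L) : u * v = v * u := by
  have key : ∀ x y : L, UniversalEnvelopingAlgebra.ι ℂ x * UniversalEnvelopingAlgebra.ι ℂ y =
      UniversalEnvelopingAlgebra.ι ℂ y * UniversalEnvelopingAlgebra.ι ℂ x := by
    intro x y
    have h := LieHom.map_lie (UniversalEnvelopingAlgebra.ι ℂ) x y
    rw [hL, map_zero, LieRing.of_associative_ring_bracket] at h
    exact (sub_eq_zero.1 h.symm)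
  have hu : u ∈ Algebra.adjoin ℂ (Set.range (UniversalEnvelopingAlgebra.ι ℂ : L → U L)) := by
    rw [adjoin_range_ι]; trivial
  have hv : v ∈ Algebra.adjoin ℂ (Set.range (UniversalEnvelopingAlgebra.ι ℂ : L → U L)) := by
    rw [adjoin_range_ι]; trivial
  refine Algebra.adjoin_induction₂ (p := fun a b _ _ => a * b = b * a) ?_ ?_ ?_ ?_ ?_ ?_ ?_ ?_ hu hv
  · rintro _ _ ⟨x, rfl⟩ ⟨y, rfl⟩
    exact key x y
  · intro c d
    exact Algebra.commutes c _
  · intro c x _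
    exact Algebra.commutes c x
  · intro c x _
    exact (Algebra.commutes c x).symm
  · intro x y z _ _ _ h1 h2
    rw [add_mul, mul_add, h1, h2]
  · intro x y z _ _ _ h1 h2
    rw [add_mul, mul_add, h1, h2]
  · intro x y z _ _ _ h1 h2
    rw [mul_assoc, h2, ← mul_assoc, h1, mul_assoc]
  · intro x y z _ _ _ h1 h2
    rw [← mul_assoc, h1, mul_assoc, h2, mul_assoc]

end Enveloping

section Cartan

variable {g : Type*} [LieRing g] [LieAlgebra ℂ g] [FiniteDimensional ℂ g]
  [LieAlgebra.IsSimple ℂ g] (H : LieSubalgebra ℂ g) [H.IsCartanSubalgebra]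

/-- `U(A ⊗ H)` is commutative, because the Cartan subalgebra `H` is abelian. -/
instance instCommRingUCartan (A : Type*) [CommRing A] [Algebra ℂ A] : CommRing (U (A ⊗[ℂ] H)) :=
  { toRing := inferInstanceAs (Ring (UniversalEnvelopingAlgebra ℂ (A ⊗[ℂ] H)))
    mul_comm := U_mul_comm _ fun x y => by
      induction x with
      | zero => simp
      | add x₁ x₂ h₁ h₂ => rw [add_lie, h₁, h₂, add_zero]
      | tmul a h =>
        induction y with
        | zero => simp
        | add y₁ y₂ h₁ h₂ => rw [lie_add, h₁, h₂, add_zero]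
        | tmul a' h' =>
          rw [LieAlgebra.ExtendScalars.bracket_tmul, trivial_lie_zero, TensorProduct.tmul_zero] }

variable {H} (b : (LieAlgebra.IsKilling.rootSystem H).Base)

/-! ### Weights -/

/-- The simple root `α_i`. -/
def simpleRoot (i : b.support) : Module.Dual ℂ H := (LieAlgebra.IsKilling.rootSystem H).root i

/-- The simple coroot `h_i`. -/
def simpleCoroot (i : b.support) : H := (LieAlgebra.IsKilling.rootSystem H).coroot i

/-- The cone `Q⁺` spanned by the simple roots over the non-negative integers. -/
def Qplus : AddSubmonoid (Module.Dual ℂ H) := AddSubmonoid.closure (Set.range (simpleRoot b))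

open Classical in
/-- The fundamental weight `ω_i`; the `ω_i` are the basis of `H*` dual to the coroots `h_i`. -/
def fundamentalWeight (i : b.support) : Module.Dual ℂ H := b.toCoweightBasis.dualBasis i

/-- The dominant integral weight `λ = ∑ r_i ω_i`. -/
def domWeight (r : b.support → ℕ) : Module.Dual ℂ H := ∑ i, r i • fundamentalWeight b i

/-! ### The modules `V(λ)`, `P_A(V)`, `V^ν` and `W_A(λ)` -/

/-- The left ideal of `U(g)` generated by the defining relations of `V(λ)`, `λ = ∑ r_i ω_i`:
`x` for `x` in a positive root space, `h - λ(h)` for `h ∈ H`, and `x ^ (r_i + 1)` for `x` in the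
one-dimensional root space of `-α_i`. -/
def simpleRel (r : b.support → ℕ) : Submodule (U g) (U g) :=
  Submodule.span (U g)
    ({u | ∃ α : H.root, (LieAlgebra.IsKilling.rootSystem H).root α ∈ Qplus b ∧
        ∃ x ∈ LieAlgebra.rootSpace H α.1, u = UniversalEnvelopingAlgebra.ι ℂ x} ∪
     {u | ∃ h : H, u = UniversalEnvelopingAlgebra.ι ℂ (h : g) -
        algebraMap ℂ (U g) (domWeight b r h)} ∪
     {u | ∃ i : b.support, ∃ x ∈ LieAlgebra.rootSpace H (-(simpleRoot b i : H → ℂ)),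
        u = UniversalEnvelopingAlgebra.ι ℂ x ^ (r i + 1)})

/-- The simple `g`-module `V(λ)`, by generators and relations. -/
abbrev SimpleModule (r : b.support → ℕ) : Type _ := U g ⧸ simpleRel b r

/-- The relations `u y ⊗ v = u ⊗ y v` (`y ∈ U(g)`) in `U(A ⊗ g) ⊗_ℂ V`. -/
def inducedRel (g : Type*) [LieRing g] [LieAlgebra ℂ g] (A : Type*) [CommRing A] [Algebra ℂ A]
    (V : Type*) [AddCommGroup V] [Module ℂ V] [Module (U g) V] :
    Submodule (U (A ⊗[ℂ] g)) (U (A ⊗[ℂ] g) ⊗[ℂ] V) :=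
  Submodule.span (U (A ⊗[ℂ] g))
    {t | ∃ (u : U (A ⊗[ℂ] g)) (y : U g) (v : V),
      t = (u * mapU (constIncl A g) y) ⊗ₜ[ℂ] v - u ⊗ₜ[ℂ] (y • v)}

/-- `P_A(V) = U(A ⊗ g) ⊗_{U(g)} V`. -/
abbrev InducedModule (g : Type*) [LieRing g] [LieAlgebra ℂ g] (A : Type*) [CommRing A]
    [Algebra ℂ A] (V : Type*) [AddCommGroup V] [Module ℂ V] [Module (U g) V] : Type _ :=
  (U (A ⊗[ℂ] g) ⊗[ℂ] V) ⧸ inducedRel g A V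

/-- For an `A ⊗ g`-module `M`, the submodule `∑_{μ ≰ ν} U(A ⊗ g) M_μ`, where `M_μ` is the weight
space of weight `μ` and `μ ≤ ν` means `ν - μ ∈ Q⁺`. -/
def truncation (A : Type*) [CommRing A] [Algebra ℂ A] (ν : Module.Dual ℂ H)
    (M : Type*) [AddCommGroup M] [Module ℂ M] [Module (U (A ⊗[ℂ] g)) M] :
    Submodule (U (A ⊗[ℂ] g)) M :=
  Submodule.span (U (A ⊗[ℂ] g))
    {m | ∃ μ : Module.Dual ℂ H, ν - μ ∉ Qplus b ∧
      ∀ h : H, UniversalEnvelopingAlgebra.ι ℂ (constIncl A g h) • m = μ h • m}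

/-- The global Weyl module `W_A(λ) = P_A(V(λ))^λ`, where `M^λ = M / ∑_{μ ≰ λ} U(A ⊗ g) M_μ`. -/
abbrev WeylModule (r : b.support → ℕ) (A : Type*) [CommRing A] [Algebra ℂ A] : Type _ :=
  InducedModule g A (SimpleModule b r) ⧸
    truncation b A (domWeight b r) (InducedModule g A (SimpleModule b r))

/-- The generator `w_λ` of `W_A(λ)`, the image of `1 ⊗ v_λ`. -/
def weylGen (r : b.support → ℕ) (A : Type*) [CommRing A] [Algebra ℂ A] : WeylModule b r A :=
  Submodule.Quotient.mk (Submodule.Quotient.mk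
    ((1 : U (A ⊗[ℂ] g)) ⊗ₜ[ℂ] (Submodule.Quotient.mk 1 : SimpleModule b r)))

/-- The ideal `{u ∈ U(A ⊗ H) : u w_λ = 0}`. -/
def annIdeal (r : b.support → ℕ) (A : Type*) [CommRing A] [Algebra ℂ A] :
    Ideal (U (A ⊗[ℂ] H)) where
  carrier := {u | mapU (subIncl A H) u • weylGen b r A = 0}
  add_mem' := fun {u v} hu hv => by
    change _ = _ at hu hv ⊢
    rw [map_add, add_smul, hu, hv, add_zero]
  zero_mem' := by simp
  smul_mem' := fun c u hu => by
    change _ = _ at hu ⊢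
    rw [smul_eq_mul, map_mul, mul_smul, hu, smul_zero]

/-- The commutative algebra `𝐀_λ`, the quotient of `U(A ⊗ H)` by the annihilator of `w_λ`. -/
abbrev BoldA (r : b.support → ℕ) (A : Type*) [CommRing A] [Algebra ℂ A] : Type _ :=
  U (A ⊗[ℂ] H) ⧸ annIdeal b r A

/-- The class in `𝐀_λ` of `a ⊗ h`, for `a ∈ A` and `h ∈ H`. -/
def boldClass (r : b.support → ℕ) {A : Type*} [CommRing A] [Algebra ℂ A] (a : A) (h : H) :
    BoldA b r A :=
  Ideal.Quotient.mk (annIdeal b r A) (UniversalEnvelopingAlgebra.ι ℂ (a ⊗ₜ[ℂ] h))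

end Cartan

/-! ### The invariant ring `(A^{⊗ r_λ})^{S_λ}` -/

section Invariants

variable {I : Type*} [Fintype I] (r : I → ℕ) (A : Type*) [CommRing A] [Algebra ℂ A]

/-- The set of `r_λ = ∑ r_i` tensor positions: `r_i` positions for each `i`. -/
abbrev Pos : Type _ := (i : I) × Fin (r i)

/-- The Young subgroup `S_λ = ∏ S_{r_i}`. -/
abbrev YoungGroup : Type _ := (i : I) → Equiv.Perm (Fin (r i))

/-- The permutation of the positions given by an element of `S_λ`. -/
abbrev posPerm (σ : YoungGroup r) : Equiv.Perm (Pos r) := Equiv.sigmaCongrRight σ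

/-- The tensor power `A^{⊗ r_λ}`. -/
abbrev TensorPow : Type _ := PiTensorProduct ℂ (fun _ : Pos r => A)

/-- The automorphism of `A^{⊗ r_λ}` permuting the factors by `σ ∈ S_λ`. -/
def permAlgHom (σ : YoungGroup r) : TensorPow r A →ₐ[ℂ] TensorPow r A :=
  AlgHom.ofLinearMap (PiTensorProduct.reindex ℂ (fun _ : Pos r => A) (posPerm r σ)).toLinearMap
    (by
      rw [PiTensorProduct.one_def]
      exact PiTensorProduct.reindex_tprod _ _)
    (by
      rw [LinearMap.map_mul_iff]
      ext x y
      simp only [LinearMap.compMultilinearMap_apply, LinearMap.compr₂_apply,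
        LinearMap.compl₂_apply, LinearMap.comp_apply, LinearMap.mul_apply',
        PiTensorProduct.tprod_mul_tprod, LinearEquiv.coe_coe, PiTensorProduct.reindex_tprod]
      rfl)

/-- The algebra of invariants `𝔸_λ = (A^{⊗ r_λ})^{S_λ}`. -/
def InvAlg : Subalgebra ℂ (TensorPow r A) where
  carrier := {x | ∀ σ : YoungGroup r, permAlgHom r A σ x = x}
  mul_mem' := fun {x y} hx hy σ => by rw [map_mul, hx σ, hy σ]
  add_mem' := fun {x y} hx hy σ => by rw [map_add, hx σ, hy σ]
  algebraMap_mem' := fun c σ => AlgHom.commutes _ c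

variable {A}

open Classical in
/-- `sym^i_λ(a)`: the sum over the positions `p` of the `i`-th block of the pure tensor with `a`
at the position `p` and `1` elsewhere. -/
def symElt (i : I) (a : A) : TensorPow r A :=
  ∑ k : Fin (r i), PiTensorProduct.tprod ℂ (Function.update (fun _ : Pos r => (1 : A)) ⟨i, k⟩ a)

/-- Evaluation `A → A/S = ℂ` at a maximal ideal `S` of a finitely generated algebra `A`. -/
def evMax [Algebra.FiniteType ℂ A] (S : MaximalSpectrum A) : A →ₐ[ℂ] ℂ :=
  letI := Ideal.Quotient.field S.asIdeal
  haveI : Algebra.FiniteType ℂ (A ⧸ S.asIdeal) :=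
    Algebra.FiniteType.of_surjective (Ideal.Quotient.mkₐ ℂ S.asIdeal)
      Ideal.Quotient.mk_surjective
  haveI : Module.Finite ℂ (A ⧸ S.asIdeal) :=
    finite_of_finite_type_of_isJacobsonRing ℂ (A ⧸ S.asIdeal)
  (AlgEquiv.ofBijective (Algebra.ofId ℂ (A ⧸ S.asIdeal))
    (IsAlgClosed.algebraMap_bijective_of_isIntegral (k := ℂ)
      (K := A ⧸ S.asIdeal))).symm.toAlgHom.comp (Ideal.Quotient.mkₐ ℂ S.asIdeal)

/-- The multilinear map `(a_p) ↦ ∏ ev_{S_p}(a_p)` given by a tuple `S` of maximal ideals. -/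
def evMulti [Algebra.FiniteType ℂ A] (S : Pos r → MaximalSpectrum A) :
    MultilinearMap ℂ (fun _ : Pos r => A) ℂ :=
  (MultilinearMap.mkPiAlgebra ℂ (Pos r) ℂ).compLinearMap fun p => (evMax (S p)).toLinearMap

theorem evMulti_apply [Algebra.FiniteType ℂ A] (S : Pos r → MaximalSpectrum A) (x : Pos r → A) :
    evMulti r S x = ∏ p, evMax (S p) (x p) := by
  simp [evMulti]

theorem evMulti_one [Algebra.FiniteType ℂ A] (S : Pos r → MaximalSpectrum A) :
    evMulti r S 1 = 1 := by
  simp [evMulti_apply]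

theorem evMulti_mul [Algebra.FiniteType ℂ A] (S : Pos r → MaximalSpectrum A) (x y : Pos r → A) :
    evMulti r S (x * y) = evMulti r S x * evMulti r S y := by
  simp [evMulti_apply, Finset.prod_mul_distrib]

/-- The character `⊗ a_p ↦ ∏ ev_{S_p}(a_p)` of `A^{⊗ r_λ}` given by a tuple `S` of maximal ideals
of `A`. -/
def evTuple [Algebra.FiniteType ℂ A] (S : Pos r → MaximalSpectrum A) : TensorPow r A →ₐ[ℂ] ℂ :=
  PiTensorProduct.liftAlgHom (evMulti r S) (evMulti_one r S) (evMulti_mul r S)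

/-- The maximal ideal of `𝔸_λ` attached to a tuple `S ∈ max(A)^{r_λ}`: the kernel of the
restriction to `𝔸_λ` of the character given by `S`. -/
def orbitPoint [Algebra.FiniteType ℂ A] (S : Pos r → MaximalSpectrum A) :
    MaximalSpectrum (InvAlg r A) where
  asIdeal := RingHom.ker ((evTuple r S).comp (InvAlg r A).val)
  isMaximal := RingHom.ker_isMaximal_of_surjective _ fun c =>
    ⟨algebraMap ℂ (InvAlg r A) c, by simp⟩

end Invariants

end GlobalWeyl

end

/-! ### Chevalley relations and the triangular decomposition -/

open scoped TensorProduct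

noncomputable section

namespace GlobalWeyl

attribute [local instance] LieRing.ofAssociativeRing

/-! Let σ = `symHom` be the homomorphism from U(A ⊗ h) to the tensor power of A that sends a ⊗ h_i
to sym^i_λ(a). Its image is the ring of invariants, because in characteristic zero a symmetrised
pure tensor is a polynomial in the sym^i_λ(a) (`invAlg_eq_adjoin`). Everything rests on two bounds
for the annihilator of w_λ: it contains ker σ, and it is contained in ker(ev_S ∘ σ) for every tuple
S. The first bound gives a surjection q from the invariants onto 𝐀_λ. The second puts ker q inside
every maximal ideal of the invariants, since by integrality and the Nullstellensatz each of these
comes from a tuple S. Hence contraction along q is a bijection of maximal spectra. If A has zero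
Jacobson radical, the characters ev_S separate the points of the tensor power, so q is injective and
τ_λ is its inverse.

Upper bound (`evTuple_symHom_eq_zero`): it suffices to map W_A(λ) to a module in which w_λ goes to a
nonzero vector on which A ⊗ h acts through ev_S ∘ σ. Evaluation at S maps A ⊗ g to a product of
copies of g, one for each position, and a highest weight module with weight ω_i at every position of
block i pulls back to such a module. It is obtained as a space of functions on words in the simple
roots. The raising and lowering operators there satisfy the Chevalley relations only; the triangular
decomposition yields a subspace, containing the highest weight vector, on which the Lie algebra
itself acts (`WordModule.exists_highestWeight`).

Lower bound (`mem_annIdeal_of_symHom_eq_zero`): fix i, put n = r_i, and let x, y, h be the currents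
of the sl₂ of α_i. The vectors x(1)^n y(a_1) ⋯ y(a_n) w_λ lie in U(A ⊗ h) w_λ, and h(c) acts on them
as multiplication by ∑ 1 ⊗ ⋯ ⊗ c ⊗ ⋯ ⊗ 1 acts on a_1 ⊗ ⋯ ⊗ a_n (`CurrentSl2.h_smul_x_pow_yProd`).
Multiplying over all i gives a linear map P from the tensor power to 𝐀_λ with u P(t) = P(σ(u) t) and
P(1) a nonzero scalar. If σ(u) = 0, then u P(1) = 0, so u vanishes in 𝐀_λ. -/

/-- Elements `e j`, `f j` and an abelian family `τ h` satisfying the Chevalley relations. -/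
structure ChevalleyRel {J T X : Type*} [AddCommGroup T] [Module ℂ T] [LieRing X] [LieAlgebra ℂ X]
    (α : J → Module.Dual ℂ T) (c : J → T) (e f : J → X) (τ : T →ₗ[ℂ] X) : Prop where
  lie_h_h : ∀ s t, ⁅τ s, τ t⁆ = 0
  lie_h_e : ∀ t j, ⁅τ t, e j⁆ = α j t • e j
  lie_h_f : ∀ t j, ⁅τ t, f j⁆ = -(α j t • f j)
  lie_e_f : ∀ j, ⁅e j, f j⁆ = τ (c j)
  lie_e_f_ne : ∀ i j, i ≠ j → ⁅e i, f j⁆ = 0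

namespace ChevalleyRel

open LieSubalgebra

variable {J T X : Type*} [AddCommGroup T] [Module ℂ T] [LieRing X] [LieAlgebra ℂ X]
  {α : J → Module.Dual ℂ T} {c : J → T} {e f : J → X} {τ : T →ₗ[ℂ] X}

/-- The relations are symmetric under exchanging e and f and negating roots and coroots, so each
statement about the e's also serves for the f's. -/
theorem swap (R : ChevalleyRel α c e f τ) : ChevalleyRel (-α) (-c) f e τ where
  lie_h_h := R.lie_h_h
  lie_h_e t j := by simp [R.lie_h_f]
  lie_h_f t j := by simp [R.lie_h_e]
  lie_e_f j := by rw [← lie_skew, R.lie_e_f]; simp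
  lie_e_f_ne i j h := by rw [← lie_skew, R.lie_e_f_ne _ _ h.symm, neg_zero]

theorem lie_h_mem (R : ChevalleyRel α c e f τ) (t : T) {x : X}
    (hx : x ∈ lieSpan ℂ X (Set.range e)) : ⁅τ t, x⁆ ∈ lieSpan ℂ X (Set.range e) := by
  induction hx using lieSpan_induction with
  | mem u hu =>
    obtain ⟨j, rfl⟩ := hu
    rw [R.lie_h_e]
    exact LieSubalgebra.smul_mem _ _ (subset_lieSpan ⟨j, rfl⟩)
  | zero => simp
  | add u v _ _ hu hv => rw [lie_add]; exact add_mem hu hv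
  | smul k u _ hu => rw [lie_smul]; exact LieSubalgebra.smul_mem _ _ hu
  | lie u v hu hv hu' hv' =>
    rw [leibniz_lie]
    exact add_mem (LieSubalgebra.lie_mem _ hu' hv) (LieSubalgebra.lie_mem _ hu hv')

/-- The sum of the span of the `f j`, the torus and the span of the `e j`. -/
def triangular (e f : J → X) (τ : T →ₗ[ℂ] X) : Submodule ℂ X :=
  (lieSpan ℂ X (Set.range f)).toSubmodule ⊔ LinearMap.range τ ⊔
    (lieSpan ℂ X (Set.range e)).toSubmodule

theorem triangular_swap (e f : J → X) (τ : T →ₗ[ℂ] X) : triangular f e τ = triangular e f τ := by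
  unfold triangular
  rw [sup_comm, sup_comm _ (LinearMap.range τ), ← sup_assoc]

theorem span_e_le : (lieSpan ℂ X (Set.range e)).toSubmodule ≤ triangular e f τ := le_sup_right

theorem span_f_le : (lieSpan ℂ X (Set.range f)).toSubmodule ≤ triangular e f τ :=
  le_sup_left.trans le_sup_left

theorem range_le : LinearMap.range τ ≤ triangular e f τ := le_sup_right.trans le_sup_left

/-- A torus term arises only when e_i meets f_i itself. On a longer bracket the Leibniz rule
brackets this term with an element of the span of the f's, which the torus preserves. -/
theorem lie_e_mem (R : ChevalleyRel α c e f τ) (i : J) {x : X}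
    (hx : x ∈ lieSpan ℂ X (Set.range f)) :
    ⁅e i, x⁆ ∈ (lieSpan ℂ X (Set.range f)).toSubmodule ⊔ LinearMap.range τ := by
  induction hx using lieSpan_induction with
  | mem u hu =>
    obtain ⟨j, rfl⟩ := hu
    by_cases h : i = j
    · subst h
      rw [R.lie_e_f]
      exact Submodule.mem_sup_right ⟨_, rfl⟩
    · rw [R.lie_e_f_ne _ _ h]; exact zero_mem _
  | zero => rw [lie_zero]; exact zero_mem _
  | add u v _ _ hu hv => rw [lie_add]; exact add_mem hu hv
  | smul k u _ hu => rw [lie_smul]; exact Submodule.smul_mem _ _ hu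
  | lie u v hu hv hu' hv' =>
    obtain ⟨a, ha, _, ⟨s, rfl⟩, hs⟩ := Submodule.mem_sup.1 hu'
    obtain ⟨a', ha', _, ⟨s', rfl⟩, hs'⟩ := Submodule.mem_sup.1 hv'
    rw [leibniz_lie, ← hs, ← hs', add_lie, lie_add]
    refine Submodule.mem_sup_left (add_mem (add_mem ?_ ?_) (add_mem ?_ ?_))
    · exact LieSubalgebra.lie_mem _ ha hv
    · exact R.swap.lie_h_mem s hv
    · exact LieSubalgebra.lie_mem _ hu ha'
    · have := R.swap.lie_h_mem s' hu
      rw [← lie_skew]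
      exact neg_mem this

theorem lie_e_triangular (R : ChevalleyRel α c e f τ) (i : J) {x : X}
    (hx : x ∈ triangular e f τ) : ⁅e i, x⁆ ∈ triangular e f τ := by
  obtain ⟨y, hy, z, hz, rfl⟩ := Submodule.mem_sup.1 hx
  obtain ⟨a, ha, _, ⟨s, rfl⟩, rfl⟩ := Submodule.mem_sup.1 hy
  rw [lie_add, lie_add]
  refine add_mem (add_mem ?_ ?_) ?_
  · exact Submodule.mem_sup_left (R.lie_e_mem i ha)
  · apply span_e_le
    rw [← lie_skew, R.lie_h_e]
    exact neg_mem (LieSubalgebra.smul_mem _ _ (subset_lieSpan ⟨i, rfl⟩))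
  · exact span_e_le (LieSubalgebra.lie_mem _ (subset_lieSpan ⟨i, rfl⟩) hz)

theorem lie_h_triangular (R : ChevalleyRel α c e f τ) (t : T) {x : X}
    (hx : x ∈ triangular e f τ) : ⁅τ t, x⁆ ∈ triangular e f τ := by
  obtain ⟨y, hy, z, hz, rfl⟩ := Submodule.mem_sup.1 hx
  obtain ⟨a, ha, _, ⟨s, rfl⟩, rfl⟩ := Submodule.mem_sup.1 hy
  rw [lie_add, lie_add, R.lie_h_h, add_zero]
  exact add_mem (span_f_le (R.swap.lie_h_mem t ha)) (span_e_le (R.lie_h_mem t hz))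

/-- The triangular decomposition. -/
theorem lieSpan_le_triangular (R : ChevalleyRel α c e f τ) {x : X}
    (hx : x ∈ lieSpan ℂ X (Set.range e ∪ Set.range f ∪ Set.range τ)) : x ∈ triangular e f τ := by
  -- The triangular sum is not visibly closed under brackets. It is enough that the generators,
  -- hence all that they generate, map it to itself.
  have stab : ∀ y ∈ lieSpan ℂ X (Set.range e ∪ Set.range f ∪ Set.range τ),
      ∀ z ∈ triangular e f τ, ⁅y, z⁆ ∈ triangular e f τ := by
    intro y hy
    induction hy using lieSpan_induction with
    | mem u hu =>
      intro z hz
      rcases hu with (⟨j, rfl⟩ | ⟨j, rfl⟩) | ⟨t, rfl⟩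
      · exact R.lie_e_triangular j hz
      · rw [← triangular_swap] at hz ⊢
        exact R.swap.lie_e_triangular j hz
      · exact R.lie_h_triangular t hz
    | zero => intro z _; rw [zero_lie]; exact zero_mem _
    | add u v _ _ hu hv => intro z hz; rw [add_lie]; exact add_mem (hu z hz) (hv z hz)
    | smul k u _ hu => intro z hz; rw [smul_lie]; exact Submodule.smul_mem _ _ (hu z hz)
    | lie u v _ _ hu hv =>
      intro z hz
      rw [lie_lie]
      exact sub_mem (hu _ (hv _ hz)) (hv _ (hu _ hz))
  induction hx using lieSpan_induction with
  | mem u hu =>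
    rcases hu with (⟨j, rfl⟩ | ⟨j, rfl⟩) | ⟨t, rfl⟩
    · exact span_e_le (subset_lieSpan ⟨j, rfl⟩)
    · exact span_f_le (subset_lieSpan ⟨j, rfl⟩)
    · exact range_le ⟨t, rfl⟩
  | zero => exact zero_mem _
  | add u v _ _ hu hv => exact add_mem hu hv
  | smul k u _ hu => exact Submodule.smul_mem _ _ hu
  | lie u v hu _ _ hv => exact stab u hu v hv

/-- The span of the eigenspaces of `ad s` for the eigenvalues `ε, 2 ε, 3 ε, …`. -/
def eigenCone (s : X) (ε : ℂ) : LieSubalgebra ℂ X where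
  toSubmodule := ⨆ k : ℕ, Module.End.eigenspace (LieAlgebra.ad ℂ X s) (((k : ℂ) + 1) * ε)
  lie_mem' := by
    intro x y hx hy
    simp only [AddSubsemigroup.mem_carrier, AddSubmonoid.mem_toSubsemigroup,
      Submodule.mem_toAddSubmonoid] at hx hy ⊢
    induction hx using Submodule.iSup_induction' with
    | zero => rw [zero_lie]; exact zero_mem _
    | add u v _ _ hu hv => rw [add_lie]; exact add_mem hu hv
    | mem k u hu =>
      induction hy using Submodule.iSup_induction' with
      | zero => rw [lie_zero]; exact zero_mem _
      | add u v _ _ hu hv => rw [lie_add]; exact add_mem hu hv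
      | mem l v hv =>
        refine Submodule.mem_iSup_of_mem (k + l + 1) ?_
        rw [Module.End.mem_eigenspace_iff, LieAlgebra.ad_apply] at hu hv ⊢
        rw [leibniz_lie, hu, hv, smul_lie, lie_smul, ← add_smul]
        congr 1
        push_cast
        ring

theorem span_e_le_eigenCone (R : ChevalleyRel α c e f τ) {s : T} {ε : ℂ} (hs : ∀ j, α j s = ε) :
    lieSpan ℂ X (Set.range e) ≤ eigenCone (τ s) ε := by
  rw [lieSpan_le]
  rintro _ ⟨j, rfl⟩
  refine Submodule.mem_iSup_of_mem (p := fun k : ℕ =>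
    Module.End.eigenspace (LieAlgebra.ad ℂ X (τ s)) (((k : ℂ) + 1) * ε)) 0 ?_
  rw [Module.End.mem_eigenspace_iff, LieAlgebra.ad_apply, R.lie_h_e, hs]
  simp

theorem eigenCone_le (s : X) {ε : ℂ} (hε : ε ≠ 0) :
    (eigenCone s ε).toSubmodule ≤
      ⨆ (μ : ℂ) (_ : μ ≠ 0), Module.End.eigenspace (LieAlgebra.ad ℂ X s) μ := by
  refine iSup_le fun k => le_iSup₂_of_le (((k : ℂ) + 1) * ε) ?_ le_rfl
  exact mul_ne_zero (by exact_mod_cast k.succ_ne_zero) hε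

/-- Under ad τ(s) the three summands have eigenvalues in -1, -2, …, then 0, then 1, 2, …;
eigenspaces for distinct eigenvalues are independent. -/
theorem torus_part_eq_zero (R : ChevalleyRel α c e f τ) {s : T} (hs : ∀ j, α j s = 1) {a b : X}
    {t : T} (ha : a ∈ lieSpan ℂ X (Set.range f)) (hb : b ∈ lieSpan ℂ X (Set.range e))
    (h : a + τ t + b = 0) : τ t = 0 := by
  have hb' := eigenCone_le _ one_ne_zero (R.span_e_le_eigenCone hs hb)
  have ha' := eigenCone_le (τ s) (neg_ne_zero.2 one_ne_zero)
    (R.swap.span_e_le_eigenCone (ε := -1) (by simp [hs]) ha)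
  have hind := (Module.End.eigenspaces_iSupIndep (LieAlgebra.ad ℂ X (τ s))) 0
  refine Submodule.disjoint_def.1 hind _ ?_ ?_
  · rw [Module.End.mem_eigenspace_iff, LieAlgebra.ad_apply, R.lie_h_h, zero_smul]
  · have : τ t = -(a + b) := by rw [eq_neg_iff_add_eq_zero, ← h]; abel
    rw [this]
    exact neg_mem (add_mem ha' hb')

end ChevalleyRel

/-! ### Chevalley operators on functions on words -/

namespace WordModule

variable {J T : Type*} [AddCommGroup T] [Module ℂ T]
  (α : J → Module.Dual ℂ T) (c : J → T) (lam : Module.Dual ℂ T)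

/-- The weight `λ - ∑ α_j` of a word. -/
def wt (w : List J) : Module.Dual ℂ T := lam - (w.map α).sum

/-- The raising operator: the right shift on functions on words. -/
def opE (i : J) : Module.End ℂ (List J → ℂ) where
  toFun φ := fun w => φ (i :: w)
  map_add' _ _ := rfl
  map_smul' _ _ := rfl

/-- The torus acts on functions on words by the weights. -/
def opH : T →ₗ[ℂ] Module.End ℂ (List J → ℂ) where
  toFun t :=
    { toFun := fun φ w => wt α lam w t * φ w
      map_add' := fun _ _ => funext fun _ => mul_add _ _ _
      map_smul' := fun _ _ => funext fun _ => by simp; ring }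
  map_add' s t := by ext φ w; simp [add_mul]
  map_smul' s t := by ext φ w; simp [mul_assoc]

open Classical in
/-- The values of the lowering operator. -/
def lowerFun (j : J) : (List J → ℂ) → List J → ℂ
  | _, [] => 0
  | φ, i :: w => lowerFun j (fun u => φ (i :: u)) w + if i = j then wt α lam w (c j) * φ w else 0

/-- The lowering operator. -/
def opF (j : J) : Module.End ℂ (List J → ℂ) where
  toFun := lowerFun α c lam j
  map_add' φ ψ := by
    funext w
    induction w generalizing φ ψ with
    | nil => simp [lowerFun]
    | cons i w ih =>
      have := ih (fun u => φ (i :: u)) (fun u => ψ (i :: u))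
      simp only [lowerFun, Pi.add_apply] at this ⊢
      have h2 : (fun u => φ (i :: u)) + (fun u => ψ (i :: u)) =
        fun u => φ (i :: u) + ψ (i :: u) := rfl
      rw [← h2, this]
      split_ifs <;> ring
  map_smul' k φ := by
    funext w
    induction w generalizing φ with
    | nil => simp [lowerFun]
    | cons i w ih =>
      have := ih (fun u => φ (i :: u))
      simp only [lowerFun, Pi.smul_apply, RingHom.id_apply, smul_eq_mul] at this ⊢
      have h2 : k • (fun u => φ (i :: u)) = fun u => k * φ (i :: u) := rfl
      rw [← h2, this]
      split_ifs <;> ring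

@[simp] theorem opE_apply (i : J) (φ : List J → ℂ) (w : List J) : opE i φ w = φ (i :: w) := rfl

@[simp] theorem opH_apply (t : T) (φ : List J → ℂ) (w : List J) :
    opH α lam t φ w = wt α lam w t * φ w := rfl

@[simp] theorem opF_nil (j : J) (φ : List J → ℂ) : opF α c lam j φ [] = 0 := rfl

-- This recursion is the relation [E_i, F_j] = δ_ij h_j read at the word w, so that relation holds
-- by construction. The remaining freedom, the value at the empty word, is set to zero; no Serre
-- relation is imposed.
open Classical in
theorem opF_cons (j i : J) (φ : List J → ℂ) (w : List J) :
    opF α c lam j φ (i :: w) =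
      opF α c lam j (opE i φ) w + if i = j then opH α lam (c j) φ w else 0 := rfl

theorem wt_cons (i : J) (w : List J) (t : T) :
    wt α lam (i :: w) t = wt α lam w t - α i t := by
  simp [wt]; ring

/-- The relation between torus and lowering operators is not built into the definition. It
propagates along the word because prepending i lowers the weight by α_i. -/
theorem opF_opH (j : J) (t : T) (φ : List J → ℂ) (w : List J) :
    opF α c lam j (opH α lam t φ) w = (wt α lam w t + α j t) * opF α c lam j φ w := by
  induction w generalizing φ with
  | nil => simp
  | cons i w ih =>
    have h1 : opE i (opH α lam t φ) = opH α lam t (opE i φ) - α i t • opE i φ := by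
      ext u; simp [wt_cons]; ring
    rw [opF_cons, opF_cons, h1, map_sub, map_smul, Pi.sub_apply, ih, wt_cons]
    split_ifs with h
    · subst h; simp; ring
    · simp; ring

theorem chevalleyRel :
    ChevalleyRel α c (opE : J → Module.End ℂ (List J → ℂ)) (opF α c lam) (opH α lam) where
  lie_h_h s t := by
    ext φ w
    simp [LieRing.of_associative_ring_bracket]; ring
  lie_h_e t j := by
    ext φ w
    simp [LieRing.of_associative_ring_bracket, wt_cons]; ring
  lie_h_f t j := by
    ext φ w
    simp [LieRing.of_associative_ring_bracket, opF_opH]; ring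
  lie_e_f j := by
    ext φ w
    simp [LieRing.of_associative_ring_bracket, opF_cons]
  lie_e_f_ne i j h := by
    ext φ w
    simp [LieRing.of_associative_ring_bracket, opF_cons, h]

end WordModule
end GlobalWeyl
end

/-! ### Highest weight modules from the graph of the Chevalley generators -/

open scoped TensorProduct

noncomputable section

namespace GlobalWeyl

attribute [local instance] LieRing.ofAssociativeRing

theorem ChevalleyRel.prod {J T X Y : Type*} [AddCommGroup T] [Module ℂ T] [LieRing X]
    [LieAlgebra ℂ X] [LieRing Y] [LieAlgebra ℂ Y] {α : J → Module.Dual ℂ T} {c : J → T}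
    {e f : J → X} {τ : T →ₗ[ℂ] X} {e' f' : J → Y} {τ' : T →ₗ[ℂ] Y}
    (R : ChevalleyRel α c e f τ) (R' : ChevalleyRel α c e' f' τ') :
    ChevalleyRel α c (fun j => (e j, e' j)) (fun j => (f j, f' j)) (τ.prod τ') where
  lie_h_h s t := Prod.ext (R.lie_h_h s t) (R'.lie_h_h s t)
  lie_h_e t j := Prod.ext (R.lie_h_e t j) (R'.lie_h_e t j)
  lie_h_f t j := Prod.ext (R.lie_h_f t j) (R'.lie_h_f t j)
  lie_e_f j := Prod.ext (R.lie_e_f j) (R'.lie_e_f j)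
  lie_e_f_ne i j h := Prod.ext (R.lie_e_f_ne i j h) (R'.lie_e_f_ne i j h)

namespace WordModule

open LieSubalgebra

variable {J T G : Type*} [AddCommGroup T] [Module ℂ T] [LieRing G] [LieAlgebra ℂ G]
  {α : J → Module.Dual ℂ T} {c : J → T} {e f : J → G} {τ : T →ₗ[ℂ] G} (lam : Module.Dual ℂ T)

variable (α c e f τ) in
/-- The Lie subalgebra of `G × End` generated by the pairs of Chevalley generators. -/
def graph : LieSubalgebra ℂ (G × Module.End ℂ (List J → ℂ)) :=
  lieSpan ℂ _ (Set.range (fun j => (e j, (opE j : Module.End ℂ (List J → ℂ)))) ∪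
    Set.range (fun j => (f j, opF α c lam j)) ∪ Set.range (τ.prod (opH α lam)))

theorem e_mem_graph (j : J) : (e j, opE j) ∈ graph α c e f τ lam :=
  subset_lieSpan (Or.inl (Or.inl ⟨j, rfl⟩))

theorem f_mem_graph (j : J) : (f j, opF α c lam j) ∈ graph α c e f τ lam :=
  subset_lieSpan (Or.inl (Or.inr ⟨j, rfl⟩))

theorem h_mem_graph (t : T) : (τ t, opH α lam t) ∈ graph α c e f τ lam :=
  subset_lieSpan (Or.inr ⟨t, rfl⟩)

open Classical in
/-- The highest weight vector: the indicator function of the empty word. -/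
def vac : List J → ℂ := Pi.single [] 1

@[simp] theorem vac_nil : (vac : List J → ℂ) [] = 1 := by simp [vac]

@[simp] theorem vac_cons (i : J) (w : List J) : vac (i :: w) = 0 := by simp [vac]

@[simp] theorem opE_vac (i : J) : opE i (vac : List J → ℂ) = 0 := by
  ext w; simp

@[simp] theorem opH_vac (t : T) : opH α lam t (vac : List J → ℂ) = lam t • vac := by
  ext w
  cases w <;> simp [wt]

theorem span_e_vac {x : G × Module.End ℂ (List J → ℂ)}
    (hx : x ∈ lieSpan ℂ _ (Set.range fun j => (e j, (opE j : Module.End ℂ (List J → ℂ))))) :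
    x.2 vac = 0 := by
  induction hx using lieSpan_induction with
  | mem u hu => obtain ⟨j, rfl⟩ := hu; exact opE_vac j
  | zero => rfl
  | add u v _ _ hu hv => simp [hu, hv]
  | smul k u _ hu => simp [hu]
  | lie u v _ _ hu hv =>
    change ⁅u.2, v.2⁆ vac = 0
    simp [LieRing.of_associative_ring_bracket, hu, hv]

theorem span_f_nil {x : G × Module.End ℂ (List J → ℂ)}
    (hx : x ∈ lieSpan ℂ _ (Set.range fun j => (f j, opF α c lam j))) (φ : List J → ℂ) :
    x.2 φ [] = 0 := by
  induction hx using lieSpan_induction generalizing φ with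
  | mem u hu => obtain ⟨j, rfl⟩ := hu; exact opF_nil α c lam j φ
  | zero => rfl
  | add u v _ _ hu hv => simp [hu, hv]
  | smul k u _ hu => simp [hu]
  | lie u v _ _ hu hv =>
    change ⁅u.2, v.2⁆ φ [] = 0
    simp [LieRing.of_associative_ring_bracket, hu, hv]

/-- By the triangular decomposition a vertical element (0, z) has z = F + h + E. The torus part
vanishes by the grading, E kills `vac`, and elements generated by the lowering operators always take
the value 0 at the empty word. So z `vac` vanishes at the empty word, and the other words follow by
bracketing with raising operators. -/
theorem vertical_vac (R : ChevalleyRel α c e f τ) {s : T} (hs : ∀ j, α j s = 1)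
    (hτ : Function.Injective τ) {z : Module.End ℂ (List J → ℂ)}
    (hz : ((0 : G), z) ∈ graph α c e f τ lam) : z vac = 0 := by
  have hnil : ∀ z : Module.End ℂ (List J → ℂ), ((0 : G), z) ∈ graph α c e f τ lam →
      z vac [] = 0 := by
    intro z hz
    have h := (R.prod (chevalleyRel α c lam)).lieSpan_le_triangular hz
    obtain ⟨y, hy, b, hb, hyb⟩ := Submodule.mem_sup.1 h
    obtain ⟨a, ha, _, ⟨t, rfl⟩, rfl⟩ := Submodule.mem_sup.1 hy
    have ht := R.torus_part_eq_zero (a := a.1) (b := b.1) (t := t) hs ?_ ?_ ?_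
    · have ht0 : t = 0 := hτ (by rw [ht, map_zero])
      have h2 : z = a.2 + opH α lam t + b.2 := (congrArg Prod.snd hyb).symm
      rw [h2, ht0, map_zero]
      simp [span_f_nil lam ha, span_e_vac hb]
    · have := (LieSubalgebra.mem_map (LieHom.fst ℂ G (Module.End ℂ (List J → ℂ))) _ _).2 ⟨_, ha, rfl⟩
      rw [LieSubalgebra.map_lieSpan, ← Set.range_comp] at this
      exact this
    · have := (LieSubalgebra.mem_map (LieHom.fst ℂ G (Module.End ℂ (List J → ℂ))) _ _).2 ⟨_, hb, rfl⟩
      rw [LieSubalgebra.map_lieSpan, ← Set.range_comp] at this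
      exact this
    · exact congrArg Prod.fst hyb
  funext w
  induction w generalizing z with
  | nil => exact hnil z hz
  | cons i w ih =>
    -- The bracket [E_i, z] is again vertical, and since E_i kills `vac` its value on `vac` at w is
    -- the value of z `vac` at i :: w.
    have h := LieSubalgebra.lie_mem _ (e_mem_graph lam i) hz
    have h0 : ⁅(e i, (opE i : Module.End ℂ (List J → ℂ))), ((0 : G), z)⁆ = (0, ⁅opE i, z⁆) :=
      Prod.ext (lie_zero _) rfl
    rw [h0] at h
    simpa [LieRing.of_associative_ring_bracket] using ih h

variable (α c e f τ) in
/-- The functions killed by the kernel of the projection of the graph to `G`. -/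
def carrier : Submodule ℂ (List J → ℂ) where
  carrier := {φ | ∀ z : Module.End ℂ (List J → ℂ), ((0 : G), z) ∈ graph α c e f τ lam → z φ = 0}
  add_mem' hφ hψ z hz := by rw [map_add, hφ z hz, hψ z hz, add_zero]
  zero_mem' z _ := map_zero z
  smul_mem' k φ hφ z hz := by rw [map_smul, hφ z hz, smul_zero]

-- Vertical elements form an ideal of the graph, so the space they annihilate is stable. On it an
-- operator depends only on its first component, which turns the graph into a representation of G.
variable {lam} in
theorem graph_carrier {d : G × Module.End ℂ (List J → ℂ)} (hd : d ∈ graph α c e f τ lam)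
    {φ : List J → ℂ} (hφ : φ ∈ carrier α c e f τ lam) : d.2 φ ∈ carrier α c e f τ lam := by
  intro z hz
  have h := LieSubalgebra.lie_mem _ hz hd
  have h0 : ⁅((0 : G), z), d⁆ = (0, ⁅z, d.2⁆) := Prod.ext (zero_lie _) rfl
  rw [h0] at h
  have h1 := hφ _ h
  simpa [LieRing.of_associative_ring_bracket, hφ z hz] using h1

variable {lam} in
theorem graph_unique {x : G} {z z' : Module.End ℂ (List J → ℂ)}
    (h : (x, z) ∈ graph α c e f τ lam) (h' : (x, z') ∈ graph α c e f τ lam)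
    {φ : List J → ℂ} (hφ : φ ∈ carrier α c e f τ lam) : z φ = z' φ := by
  have h0 : (x, z) - (x, z') = ((0 : G), z - z') := Prod.ext (sub_self _) rfl
  have := hφ _ (h0 ▸ sub_mem h h')
  exact sub_eq_zero.1 this

theorem exists_lift (hspan : lieSpan ℂ G (Set.range e ∪ Set.range f ∪ Set.range τ) = ⊤) (x : G) :
    ∃ z, (x, z) ∈ graph α c e f τ lam := by
  have hx : x ∈ lieSpan ℂ G (Set.range e ∪ Set.range f ∪ Set.range τ) := hspan ▸ trivial
  have : x ∈ (graph α c e f τ lam).map (LieHom.fst ℂ G (Module.End ℂ (List J → ℂ))) := by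
    refine (lieSpan_le (K := (graph α c e f τ lam).map _)).2 ?_ hx
    rintro _ ((⟨j, rfl⟩ | ⟨j, rfl⟩) | ⟨t, rfl⟩)
    · exact ⟨_, e_mem_graph lam j, rfl⟩
    · exact ⟨_, f_mem_graph lam j, rfl⟩
    · exact ⟨_, h_mem_graph lam t, rfl⟩
  obtain ⟨d, hd, rfl⟩ := this
  exact ⟨d.2, hd⟩

/-- A chosen operator lifting an element of `G`. -/
def lift (hspan : lieSpan ℂ G (Set.range e ∪ Set.range f ∪ Set.range τ) = ⊤) (x : G) :
    Module.End ℂ (List J → ℂ) :=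
  (exists_lift (α := α) (c := c) lam hspan x).choose

theorem lift_mem (hspan : lieSpan ℂ G (Set.range e ∪ Set.range f ∪ Set.range τ) = ⊤) (x : G) :
    (x, lift (α := α) (c := c) lam hspan x) ∈ graph α c e f τ lam :=
  (exists_lift (α := α) (c := c) lam hspan x).choose_spec

theorem lift_apply (hspan : lieSpan ℂ G (Set.range e ∪ Set.range f ∪ Set.range τ) = ⊤) {x : G}
    {z : Module.End ℂ (List J → ℂ)} (h : (x, z) ∈ graph α c e f τ lam) {φ : List J → ℂ}
    (hφ : φ ∈ carrier α c e f τ lam) : lift (α := α) (c := c) lam hspan x φ = z φ :=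
  graph_unique (lift_mem lam hspan x) h hφ

/-- The representation of `G` on the space of functions on words. -/
def rep (hspan : lieSpan ℂ G (Set.range e ∪ Set.range f ∪ Set.range τ) = ⊤) :
    G →ₗ⁅ℂ⁆ Module.End ℂ (carrier α c e f τ lam) where
  toFun x := (lift (α := α) (c := c) lam hspan x).restrict
    fun _ hφ => graph_carrier (lift_mem lam hspan x) hφ
  map_add' x y := by
    ext φ : 2
    exact lift_apply lam hspan (add_mem (lift_mem lam hspan x) (lift_mem lam hspan y)) φ.2
  map_smul' k x := by
    ext φ : 2
    exact lift_apply lam hspan (LieSubalgebra.smul_mem _ k (lift_mem lam hspan x)) φ.2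
  map_lie' {x y} := by
    ext φ : 2
    exact lift_apply lam hspan
      (LieSubalgebra.lie_mem _ (lift_mem lam hspan x) (lift_mem lam hspan y)) φ.2

theorem rep_apply (hspan : lieSpan ℂ G (Set.range e ∪ Set.range f ∪ Set.range τ) = ⊤) {x : G}
    {z : Module.End ℂ (List J → ℂ)} (h : (x, z) ∈ graph α c e f τ lam)
    (φ : carrier α c e f τ lam) : (rep lam hspan x φ : List J → ℂ) = z φ :=
  lift_apply lam hspan h φ.2

open Classical in
theorem opE_opF_pow_vac (i j : J) (m : ℕ) (hα : α j (c j) = 2) :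
    opE i ((opF α c lam j ^ (m + 1)) (vac : List J → ℂ)) =
      if i = j then (((m : ℂ) + 1) * (lam (c j) - m)) • (opF α c lam j ^ m) vac else 0 := by
  have hH : ∀ m : ℕ, opH α lam (c j) ((opF α c lam j ^ m) vac) =
      (lam (c j) - 2 * m) • (opF α c lam j ^ m) vac := by
    intro m
    induction m with
    | zero => simp
    | succ m ih =>
      have h := (chevalleyRel α c lam).lie_h_f (c j) j
      rw [LieRing.of_associative_ring_bracket, hα, sub_eq_iff_eq_add] at h
      have h' := LinearMap.congr_fun h ((opF α c lam j ^ m) vac)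
      simp only [Module.End.mul_apply, LinearMap.add_apply, LinearMap.neg_apply,
        LinearMap.smul_apply, ih, map_smul] at h'
      rw [pow_succ', Module.End.mul_apply, h', ← neg_smul, ← add_smul]
      congr 1; push_cast; ring
  have hE : opE i * opF α c lam j = opF α c lam j * opE i +
      if i = j then opH α lam (c j) else 0 := by
    split_ifs with h
    · subst h
      have := (chevalleyRel α c lam).lie_e_f i
      rw [LieRing.of_associative_ring_bracket, sub_eq_iff_eq_add'] at this
      exact this
    · have := (chevalleyRel α c lam).lie_e_f_ne i j h
      rw [LieRing.of_associative_ring_bracket, sub_eq_iff_eq_add'] at this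
      exact this
  have hE' : ∀ φ, opE i (opF α c lam j φ) = opF α c lam j (opE i φ) +
      (if i = j then opH α lam (c j) else 0) φ := fun φ => LinearMap.congr_fun hE φ
  induction m with
  | zero => split_ifs <;> simp_all
  | succ m ih =>
    rw [pow_succ', Module.End.mul_apply, hE', ih]
    split_ifs with h
    · rw [hH, map_smul, ← Module.End.mul_apply, ← pow_succ', ← add_smul]
      congr 1; push_cast; ring
    · simp

/-- A function on words is zero if its value at the empty word is zero and every E_i kills it. For
E_j the sl₂ coefficient (m + 1)(n - m) vanishes exactly at m = n. -/
theorem opF_pow_vac (j : J) (n : ℕ) (hα : α j (c j) = 2) (hn : lam (c j) = n) :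
    (opF α c lam j ^ (n + 1)) (vac : List J → ℂ) = 0 := by
  funext w
  cases w with
  | nil => rw [pow_succ', Module.End.mul_apply]; rfl
  | cons i w =>
    have := congrFun (opE_opF_pow_vac lam i j n hα) w
    rw [opE_apply] at this
    rw [this, hn]
    split_ifs <;> simp

/-- Existence of an integrable highest weight module. -/
theorem exists_highestWeight (R : ChevalleyRel α c e f τ) {s : T} (hs : ∀ j, α j s = 1)
    (hτ : Function.Injective τ)
    (hspan : lieSpan ℂ G (Set.range e ∪ Set.range f ∪ Set.range τ) = ⊤) (hα : ∀ j, α j (c j) = 2)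
    (n : J → ℕ) (hn : ∀ j, lam (c j) = n j) :
    ∃ (V : Submodule ℂ (List J → ℂ)) (ρ : G →ₗ⁅ℂ⁆ Module.End ℂ V) (v : V), v ≠ 0 ∧
      (∀ j, ρ (e j) v = 0) ∧ (∀ t, ρ (τ t) v = lam t • v) ∧
      (∀ j, (ρ (f j) ^ (n j + 1)) v = 0) ∧
      ∀ φ : V, φ ≠ 0 → ∃ w : List J, ∀ (t : T) (k : ℂ), ρ (τ t) φ = k • φ →
        k = lam t - (w.map fun j => α j t).sum := by
  have hv : (vac : List J → ℂ) ∈ carrier α c e f τ lam := fun z hz => vertical_vac lam R hs hτ hz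
  refine ⟨carrier α c e f τ lam, rep lam hspan, ⟨vac, hv⟩, ?_, ?_, ?_, ?_, ?_⟩
  · intro h
    simpa using congrFun (congrArg Subtype.val h) []
  · intro j
    refine Subtype.ext ?_
    rw [rep_apply lam hspan (e_mem_graph lam j)]
    exact opE_vac j
  · intro t
    refine Subtype.ext ?_
    rw [rep_apply lam hspan (h_mem_graph lam t)]
    exact opH_vac lam t
  · intro j
    refine Subtype.ext ?_
    have : ∀ m : ℕ, (((rep lam hspan (f j)) ^ m) ⟨vac, hv⟩ : List J → ℂ) =
        (opF α c lam j ^ m) vac := by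
      intro m
      induction m with
      | zero => rfl
      | succ m ih =>
        rw [pow_succ', Module.End.mul_apply, rep_apply lam hspan (f_mem_graph lam j), ih,
          pow_succ', Module.End.mul_apply]
    rw [this, opF_pow_vac lam j _ (hα j) (hn j)]
    rfl
  · intro φ hφ
    -- The torus acts diagonally on words, so any word in the support of φ already determines the
    -- eigenvalue.
    obtain ⟨w, hw⟩ : ∃ w, (φ : List J → ℂ) w ≠ 0 := by
      by_contra! h
      exact hφ (Subtype.ext (funext h))
    refine ⟨w, fun t k hk => ?_⟩
    have h := congrFun (congrArg Subtype.val hk) w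
    rw [rep_apply lam hspan (h_mem_graph lam t), opH_apply] at h
    have h2 := mul_right_cancel₀ hw h
    rw [← h2]
    simp [wt, LinearMap.sub_apply]
    rw [← LinearMap.applyₗ_apply_apply (R := ℂ), map_list_sum, List.map_map]
    rfl

end WordModule
end GlobalWeyl
end

/-! ### Chevalley generators of the simple Lie algebra -/

open scoped TensorProduct

noncomputable section

namespace GlobalWeyl

open LieAlgebra LieAlgebra.IsKilling LieModule LieSubalgebra

variable {g : Type*} [LieRing g] [LieAlgebra ℂ g] [FiniteDimensional ℂ g]
  [LieAlgebra.IsSimple ℂ g] {H : LieSubalgebra ℂ g} [H.IsCartanSubalgebra]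

theorem rootSpace_le_of_mem {γ : Weight ℂ H g} (hγ : γ.IsNonZero) (K : LieSubalgebra ℂ g) {x : g}
    (hx : x ∈ rootSpace H γ) (hx0 : x ≠ 0) (hxK : x ∈ K) {y : g} (hy : y ∈ rootSpace H γ) :
    y ∈ K := by
  obtain ⟨k, hk⟩ := (finrank_eq_one_iff_of_nonzero' (⟨x, hx⟩ : rootSpace H γ)
    (by simpa using hx0)).1 (finrank_rootSpace_eq_one γ hγ) ⟨y, hy⟩
  have : k • x = y := congrArg Subtype.val hk
  rw [← this]
  exact K.smul_mem k hxK

/-- This is [g_α, g_β] = g_{α+β} for roots α and α + β. Starting from a vector z at the top of the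
α-string through β, f^{p+1} z has weight β and f^p z has weight α + β. The element e carries the
first to a nonzero multiple of the second, and the root space is a line. -/
theorem rootSpace_add_le {α β γ : Weight ℂ H g} (hα : α.IsNonZero) (hγ : γ.IsNonZero)
    (h : (γ : H → ℂ) = α + β) (K : LieSubalgebra ℂ g) (hαK : ∀ x ∈ rootSpace H α, x ∈ K)
    (hβK : ∀ x ∈ rootSpace H β, x ∈ K) {y : g} (hy : y ∈ rootSpace H γ) : y ∈ K := by
  obtain ⟨h', e, f, ht, he, hf⟩ := exists_isSl2Triple_of_weight_isNonZero hα
  obtain rfl := ht.h_eq_coroot hα he hf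
  -- The weight α + β occurs, so β is not the top of its own α-string.
  have htop : 1 ≤ (chainTopCoeff α β : ℤ) := by
    refine ((rootSpace_zsmul_add_ne_bot_iff α β hα 1).1 ?_).1
    rw [one_smul, ← h]
    exact γ.genWeightSpace_ne_bot
  obtain ⟨p, hp⟩ : ∃ p, chainTopCoeff α β = p + 1 := ⟨chainTopCoeff α β - 1, by omega⟩
  have hle := chainTopCoeff_le_chainLength α β
  obtain ⟨z, hz, hz0⟩ := (chainTop α β).exists_ne_zero
  have prim : ht.HasPrimitiveVectorWith z (chainLength α β : ℂ) :=
    have := lie_mem_genWeightSpace_of_mem_genWeightSpace he hz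
    ⟨hz0, (chainLength_smul _ _ hz).symm, by rwa [genWeightSpace_add_chainTop _ _ hα] at this⟩
  have hmem : ∀ n : ℕ, (toEnd ℂ g g f ^ n) z ∈ rootSpace H (n • (-α) + chainTop α β) :=
    fun n => toEnd_pow_apply_mem hf hz n
  have hlie := prim.lie_e_pow_succ_toEnd_f p
  have hne : ((p : ℂ) + 1) * ((chainLength α β : ℂ) - p) ≠ 0 := by
    refine mul_ne_zero (by exact_mod_cast p.succ_ne_zero) (sub_ne_zero.2 ?_)
    exact_mod_cast (by omega : chainLength α β ≠ p)
  have hx : (toEnd ℂ g g f ^ (p + 1)) z ∈ K := by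
    apply hβK
    have := hmem (p + 1)
    have e1 : (p + 1) • (-α : H → ℂ) + chainTop α β = β := by
      rw [← hp, coe_chainTop]; ext t; simp
    rwa [e1] at this
  · refine rootSpace_le_of_mem hγ K (x := (toEnd ℂ g g f ^ p) z) ?_
      (prim.pow_toEnd_f_ne_zero_of_eq_nat rfl (by omega)) ?_ hy
    · have := hmem p
      have e1 : p • (-α : H → ℂ) + chainTop α β = γ := by
        rw [coe_chainTop, h, hp]; ext t; simp; ring
      rwa [e1] at this
    · have h1 : ⁅e, (toEnd ℂ g g f ^ (p + 1)) z⁆ ∈ K := K.lie_mem (hαK _ he) hx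
      rw [hlie] at h1
      have := K.smul_mem (((p : ℂ) + 1) * ((chainLength α β : ℂ) - p))⁻¹ h1
      rwa [smul_smul, inv_mul_cancel₀ hne, one_smul] at this

variable (b : (rootSystem H).Base)

/-- Every root is reached from simple roots by negation and by adding simple roots. Treating the
root spaces of k and -k together makes the negation step a mere exchange. -/
theorem lieSpan_chevalley {e f : b.support → g}
    (he : ∀ i, e i ∈ rootSpace H (simpleRoot b i)) (he0 : ∀ i, e i ≠ 0)
    (hf : ∀ i, f i ∈ rootSpace H (-(simpleRoot b i : H → ℂ))) (hf0 : ∀ i, f i ≠ 0) :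
    lieSpan ℂ g (Set.range e ∪ Set.range f ∪ Set.range H.toSubmodule.subtype) = ⊤ := by
  set K := lieSpan ℂ g (Set.range e ∪ Set.range f ∪ Set.range H.toSubmodule.subtype) with hK
  have heK : ∀ i, e i ∈ K := fun i => subset_lieSpan (Or.inl (Or.inl ⟨i, rfl⟩))
  have hfK : ∀ i, f i ∈ K := fun i => subset_lieSpan (Or.inl (Or.inr ⟨i, rfl⟩))
  have hHK : ∀ x ∈ H, x ∈ K := fun x hx => subset_lieSpan (Or.inr ⟨⟨x, hx⟩, rfl⟩)
  have key : ∀ k : H.root, (∀ x ∈ rootSpace H k.1, x ∈ K) ∧ ∀ x ∈ rootSpace H (-k.1), x ∈ K := by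
    intro k
    have hbase : ∀ k ∈ b.support,
        (∀ x ∈ rootSpace H k.1, x ∈ K) ∧ ∀ x ∈ rootSpace H (-k.1), x ∈ K := by
      intro k hk
      refine ⟨fun x hx => rootSpace_le_of_mem (LieSubalgebra.isNonZero_coe_root k) K (he ⟨k, hk⟩) (he0 _) (heK _) hx,
        fun x hx => ?_⟩
      exact rootSpace_le_of_mem (LieSubalgebra.isNonZero_coe_root k).neg K (x := f ⟨k, hk⟩)
        (hf ⟨k, hk⟩) (hf0 _) (hfK _) hx
    refine b.induction_add k ?_ hbase ?_
    · intro i hi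
      have : ((rootSystem H).reflectionPerm i i).1 = -i.1 := by
        have h1 : (rootSystem H).root ((rootSystem H).reflectionPerm i i) =
          -(rootSystem H).root i := by
            rw [RootPairing.root_reflectionPerm, RootPairing.reflection_apply_self]
        rw [rootSystem_root_apply, rootSystem_root_apply] at h1
        refine DFunLike.ext _ _ fun t => ?_
        exact LinearMap.congr_fun h1 t
      rw [this, Weight.coe_neg, neg_neg]
      exact hi.symm
    · intro i j k hk hi hj
      have h1 : (k.1 : H → ℂ) = j.1 + i.1 := by
        ext t
        have := LinearMap.congr_fun hk t
        simp only [rootSystem_root_apply] at this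
        rw [Pi.add_apply, add_comm]
        exact this
      refine ⟨fun x hx => rootSpace_add_le (LieSubalgebra.isNonZero_coe_root j) (LieSubalgebra.isNonZero_coe_root k) h1 K
        (hbase j hj).1 hi.1 hx, fun x hx => ?_⟩
      refine rootSpace_add_le (α := -j.1) (β := -i.1) (γ := -k.1) (LieSubalgebra.isNonZero_coe_root j).neg
        (LieSubalgebra.isNonZero_coe_root k).neg ?_ K (hbase j hj).2 hi.2 hx
      rw [Weight.coe_neg, Weight.coe_neg, Weight.coe_neg, h1, neg_add]
  rw [eq_top_iff]
  have htop : (⨆ χ : Weight ℂ H g, (rootSpace H χ).toSubmodule) = ⊤ := by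
    have := iSup_genWeightSpace_eq_top' ℂ H g
    rw [← LieSubmodule.toSubmodule_inj] at this
    simpa using this
  intro x _
  have hx : x ∈ ⨆ χ : Weight ℂ H g, (rootSpace H χ).toSubmodule := htop ▸ trivial
  refine (iSup_le fun χ y hy => ?_ : _ ≤ K.toSubmodule) hx
  by_cases hχ : χ.IsZero
  · apply hHK
    have : y ∈ rootSpace H (0 : H → ℂ) := by rw [← hχ.eq]; exact hy
    rw [LieAlgebra.rootSpace_zero_eq] at this
    simpa using this
  · exact (key ⟨χ, by simpa using hχ⟩).1 y hy

theorem lie_of_mem_rootSpace {χ : H → ℂ} {x : g} (hx : x ∈ rootSpace H χ) (t : H) :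
    ⁅(t : g), x⁆ = χ t • x := lie_eq_smul_of_mem_rootSpace hx t

/-- Chevalley generators of `g`. -/
theorem exists_chevalley : ∃ e f : b.support → g,
    (∀ i, e i ∈ rootSpace H (simpleRoot b i)) ∧
    (∀ i, f i ∈ rootSpace H (-(simpleRoot b i : H → ℂ))) ∧
    ChevalleyRel (simpleRoot b) (simpleCoroot b) e f H.toSubmodule.subtype ∧
    lieSpan ℂ g (Set.range e ∪ Set.range f ∪ Set.range H.toSubmodule.subtype) = ⊤ := by
  have h1 : ∀ i : b.support, ∃ e f : g, IsSl2Triple (simpleCoroot b i : g) e f ∧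
      e ∈ rootSpace H (simpleRoot b i) ∧ f ∈ rootSpace H (-(simpleRoot b i : H → ℂ)) := by
    intro i
    obtain ⟨h', e, f, ht, he, hf⟩ := exists_isSl2Triple_of_weight_isNonZero (LieSubalgebra.isNonZero_coe_root i.1)
    obtain rfl := ht.h_eq_coroot (LieSubalgebra.isNonZero_coe_root i.1) he hf
    exact ⟨e, f, ht, he, hf⟩
  choose e f ht he hf using h1
  refine ⟨e, f, he, hf, ⟨?_, ?_, ?_, ?_, ?_⟩,
    lieSpan_chevalley b he (fun i => (ht i).e_ne_zero) hf (fun i => (ht i).f_ne_zero)⟩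
  · intro s t
    exact congrArg Subtype.val (trivial_lie_zero H H s t)
  · intro t j
    exact lie_of_mem_rootSpace (he j) t
  · intro t j
    rw [Submodule.subtype_apply, lie_of_mem_rootSpace (hf j) t]
    simp
  · intro j
    exact (ht j).lie_e_f
  · intro i j hij
    have hmem : ⁅e i, f j⁆ ∈ rootSpace H ((simpleRoot b i : H → ℂ) + -(simpleRoot b j : H → ℂ)) :=
      lie_mem_genWeightSpace_of_mem_genWeightSpace (he i) (hf j)
    -- A nonzero bracket would make α_i - α_j a root, which is impossible for distinct simple roots.
    by_contra hne
    have hbot : rootSpace H ((simpleRoot b i : H → ℂ) + -(simpleRoot b j : H → ℂ)) ≠ ⊥ := by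
      intro h0
      rw [h0] at hmem
      exact hne (by simpa using hmem)
    let χ : Weight ℂ H g := ⟨_, hbot⟩
    have hχ : χ.toLinear = (rootSystem H).root i - (rootSystem H).root j := by
      ext t
      exact (sub_eq_add_neg _ _).symm
    have hχ0 : χ.IsNonZero := by
      intro h0
      have : (rootSystem H).root i - (rootSystem H).root j = 0 := by
        rw [← hχ]
        ext t
        exact congrFun h0.eq t
      exact hij (Subtype.ext ((rootSystem H).root.injective (sub_eq_zero.1 this)))
    refine b.sub_notMem_range_root i.2 j.2 ⟨⟨χ, by simpa using hχ0⟩, ?_⟩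
    exact hχ

/-- The simple roots form a basis of the dual of H, so some s measures height. It separates the
triangular summands and shows that Q⁺ is a pointed cone. -/
theorem exists_grading : ∃ s : H, ∀ j, simpleRoot b j s = 1 := by
  let φ : Module.Dual ℂ (Module.Dual ℂ H) := b.toWeightBasis.constr ℂ fun _ => (1 : ℂ)
  refine ⟨(Module.evalEquiv ℂ H).symm φ, fun j => ?_⟩
  have h1 := Module.apply_evalEquiv_symm_apply ℂ H (simpleRoot b j) φ
  rw [h1]
  have := b.toWeightBasis.constr_basis ℂ (fun _ => (1 : ℂ)) j
  rwa [b.toWeightBasis_apply] at this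

open Classical in
theorem fundamentalWeight_coroot (i j : b.support) :
    fundamentalWeight b i (simpleCoroot b j) = if j = i then 1 else 0 := by
  have h := b.toCoweightBasis.dualBasis_apply_self i j
  rw [b.toCoweightBasis_apply] at h
  convert h using 2 <;> rfl

theorem domWeight_coroot (r : b.support → ℕ) (j : b.support) :
    domWeight b r (simpleCoroot b j) = r j := by
  classical
  simp [domWeight, LinearMap.sum_apply, fundamentalWeight_coroot]

theorem simpleRoot_coroot_self (j : b.support) : simpleRoot b j (simpleCoroot b j) = 2 :=
  root_apply_coroot (LieSubalgebra.isNonZero_coe_root j.1)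

theorem span_coroot : Submodule.span ℂ (Set.range (simpleCoroot b)) = ⊤ := by
  have h : ⇑b.toCoweightBasis = simpleCoroot b := funext fun i => b.toCoweightBasis_apply i
  rw [← h]
  exact b.toCoweightBasis.span_eq

end GlobalWeyl
end

/-! ### Powers of a Lie algebra -/

open scoped TensorProduct

noncomputable section

namespace GlobalWeyl

section PiLie

variable (P : Type*) (X : Type*) [LieRing X]

/-- The componentwise Lie bracket on functions with values in a Lie ring. -/
@[reducible] def piLieRing : LieRing (P → X) where
  bracket x y := fun p => ⁅x p, y p⁆
  add_lie x y z := funext fun p => add_lie (x p) (y p) (z p)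
  lie_add x y z := funext fun p => lie_add (x p) (y p) (z p)
  lie_self x := funext fun p => lie_self (x p)
  leibniz_lie x y z := funext fun p => leibniz_lie (x p) (y p) (z p)

attribute [local instance] piLieRing

theorem pi_lie_apply {P X : Type*} [LieRing X] (x y : P → X) (p : P) : ⁅x, y⁆ p = ⁅x p, y p⁆ := rfl

theorem pi_lie_single {P X : Type*} [LieRing X] [DecidableEq P] (x : P → X) (p : P) (y : X) :
    (⁅x, (Pi.single p y : P → X)⁆ : P → X) = Pi.single p ⁅x p, y⁆ := by
  funext q
  rw [pi_lie_apply]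
  by_cases h : q = p
  · subst h; simp
  · simp [h]

variable [LieAlgebra ℂ X]

/-- The componentwise Lie algebra structure. -/
@[reducible] def piLieAlgebra : LieAlgebra ℂ (P → X) where
  lie_smul k x y := funext fun p => lie_smul k (x p) (y p)

attribute [local instance] piLieAlgebra

variable {P X}

variable [DecidableEq P]

variable {J T : Type*} [AddCommGroup T] [Module ℂ T] {α : J → Module.Dual ℂ T} {c : J → T}
  {e f : J → X} {τ : T →ₗ[ℂ] X}

/-- One copy of each generator is placed at each position. Copies at different positions commute, so
only brackets within one position matter. -/
theorem ChevalleyRel.pi (R : ChevalleyRel α c e f τ) :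
    ChevalleyRel (J := J × P) (T := P → T) (X := P → X)
      (fun j => α j.1 ∘ₗ LinearMap.proj j.2) (fun j => Pi.single j.2 (c j.1))
      (fun j => Pi.single j.2 (e j.1)) (fun j => Pi.single j.2 (f j.1)) (τ.compLeft P) where
  lie_h_h s t := funext fun p => R.lie_h_h (s p) (t p)
  lie_h_e t j := by
    rw [pi_lie_single, ← Pi.single_smul]
    exact congrArg _ (R.lie_h_e (t j.2) j.1)
  lie_h_f t j := by
    rw [pi_lie_single, ← Pi.single_smul, ← Pi.single_neg]
    exact congrArg _ (R.lie_h_f (t j.2) j.1)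
  lie_e_f j := by
    rw [pi_lie_single, Pi.single_eq_same, R.lie_e_f]
    funext q
    by_cases h : q = j.2
    · subst h; simp
    · simp [h]
  lie_e_f_ne i j h := by
    rw [pi_lie_single]
    by_cases hp : j.2 = i.2
    · rw [hp, Pi.single_eq_same, R.lie_e_f_ne, Pi.single_zero]
      exact fun h1 => h (Prod.ext h1 hp.symm)
    · rw [Pi.single_eq_of_ne hp, zero_lie, Pi.single_zero]

open LieSubalgebra in
theorem lieSpan_pi [Fintype P] (h : lieSpan ℂ X (Set.range e ∪ Set.range f ∪ Set.range τ) = ⊤) :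
    lieSpan ℂ (P → X) (Set.range (fun j : J × P => (Pi.single j.2 (e j.1) : P → X)) ∪
      Set.range (fun j : J × P => (Pi.single j.2 (f j.1) : P → X)) ∪
      Set.range (τ.compLeft P)) = ⊤ := by
  set K := lieSpan ℂ (P → X) (Set.range (fun j : J × P => (Pi.single j.2 (e j.1) : P → X)) ∪
      Set.range (fun j : J × P => (Pi.single j.2 (f j.1) : P → X)) ∪
      Set.range (τ.compLeft P))
  have key : ∀ (p : P) (x : X), (Pi.single p x : P → X) ∈ K := by
    intro p x
    have hx : x ∈ lieSpan ℂ X (Set.range e ∪ Set.range f ∪ Set.range τ) := h ▸ trivial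
    induction hx using lieSpan_induction with
    | mem u hu =>
      rcases hu with (⟨j, rfl⟩ | ⟨j, rfl⟩) | ⟨t, rfl⟩
      · exact subset_lieSpan (Or.inl (Or.inl ⟨(j, p), rfl⟩))
      · exact subset_lieSpan (Or.inl (Or.inr ⟨(j, p), rfl⟩))
      · refine subset_lieSpan (Or.inr ⟨Pi.single p t, ?_⟩)
        funext q
        by_cases h : q = p
        · subst h; simp
        · simp [h]
    | zero => rw [Pi.single_zero]; exact zero_mem _
    | add u v _ _ hu hv => rw [Pi.single_add]; exact add_mem hu hv
    | smul k u _ hu => rw [Pi.single_smul]; exact LieSubalgebra.smul_mem _ k hu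
    | lie u v _ _ hu hv =>
      have : (Pi.single p ⁅u, v⁆ : P → X) = ⁅(Pi.single p u : P → X), Pi.single p v⁆ := by
        rw [pi_lie_single, Pi.single_eq_same]
      rw [this]
      exact LieSubalgebra.lie_mem _ hu hv
  rw [eq_top_iff]
  intro x _
  rw [← Finset.univ_sum_single x]
  exact sum_mem fun p _ => key p _

end PiLie

/-! ### Locally nilpotent sums and sl₂ strings -/

section NilpotentSum

variable {V : Type*} [AddCommGroup V] [Module ℂ V]

theorem add_pow_apply_eq_zero {x y : Module.End ℂ V} (h : Commute x y) {v : V} {m n : ℕ}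
    (hx : (x ^ m) v = 0) (hy : (y ^ n) v = 0) : ((x + y) ^ (m + n)) v = 0 := by
  have hge : ∀ {z : Module.End ℂ V} {a b : ℕ}, (z ^ a) v = 0 → a ≤ b → (z ^ b) v = 0 := by
    intro z a b hz hab
    obtain ⟨d, rfl⟩ := Nat.exists_eq_add_of_le' hab
    rw [pow_add, Module.End.mul_apply, hz, map_zero]
  rw [h.add_pow, LinearMap.sum_apply]
  refine Finset.sum_eq_zero fun k _ => ?_
  rw [← Nat.cast_comm, Module.End.mul_apply]
  by_cases hk : m ≤ k
  · rw [(h.pow_pow _ _).eq, Module.End.mul_apply, hge hx hk, map_zero, map_zero]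
  · rw [Module.End.mul_apply, hge hy (by omega), map_zero, map_zero]

theorem exists_sum_pow_apply_eq_zero {P : Type*} (s : Finset P) (x : P → Module.End ℂ V)
    (h : ∀ p q, Commute (x p) (x q)) {v : V} (hx : ∀ p, ∃ m, (x p ^ m) v = 0) :
    ∃ m, ((∑ p ∈ s, x p) ^ m) v = 0 := by
  classical
  induction s using Finset.induction_on with
  | empty => exact ⟨1, by simp⟩
  | insert p s hp ih =>
    obtain ⟨m, hm⟩ := hx p
    obtain ⟨n, hn⟩ := ih
    rw [Finset.sum_insert hp]
    exact ⟨m + n, add_pow_apply_eq_zero (Commute.sum_right _ _ _ fun q _ => h p q) hm hn⟩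

end NilpotentSum

section Sl2

variable {R V : Type*} [Ring R] [AddCommGroup V] [Module R V]

theorem smul_pow_succ_smul_of_sl2 {x y h : R} {v : V} {n : ℕ} (hxy : x * y - y * x = h)
    (hhy : h * y - y * h = -(2 • y)) (hx : x • v = 0) (hh : h • v = n • v) (m : ℕ) :
    x • y ^ (m + 1) • v = (((m : ℤ) + 1) * (n - m)) • y ^ m • v := by
  have hh' : ∀ m : ℕ, h • y ^ m • v = ((n : ℤ) - 2 * m) • y ^ m • v := by
    intro m
    induction m with
    | zero => simpa using hh
    | succ m ih =>
      have : h * y = y * h + -(2 • y) := by rw [← hhy]; abel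
      rw [pow_succ', mul_smul, ← mul_smul h, this, add_smul, mul_smul, ih, neg_smul,
        smul_assoc (2 : ℕ), smul_algebra_smul_comm, ← mul_smul y, ← pow_succ',
        ← natCast_zsmul _ 2, ← neg_smul, ← add_smul]
      congr 1
      push_cast; ring
  have hxy' : x * y = y * x + h := by rw [← hxy]; abel
  induction m with
  | zero => simp [← mul_smul, hxy', add_smul, hh]; rw [mul_smul, hx, smul_zero]
  | succ m ih =>
    rw [pow_succ', mul_smul, ← mul_smul x, hxy', add_smul, mul_smul, ih, hh',
      smul_algebra_smul_comm, ← mul_smul y, ← pow_succ', ← add_smul]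
    congr 1
    push_cast; ring

variable [Module ℂ V]

theorem mul_sub_smul_eq_zero_iff {m n : ℕ} (hmn : m ≠ n) {v : V} :
    (((m : ℤ) + 1) * ((n : ℤ) - m)) • v = 0 ↔ v = 0 := by
  have hne : ((m : ℤ) + 1) * ((n : ℤ) - m) ≠ 0 := by
    refine mul_ne_zero (by positivity) fun h => hmn ?_
    exact_mod_cast (sub_eq_zero.1 h).symm
  rw [← Int.cast_smul_eq_zsmul ℂ, smul_eq_zero, Int.cast_eq_zero]
  simp [hne]

/-- In an `sl₂`-module, a nilpotent `y` kills a highest weight vector of weight `n` after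
`n + 1` steps. -/
theorem pow_smul_eq_zero_of_sl2 {x y h : R} {v : V} {n : ℕ} (hxy : x * y - y * x = h)
    (hhy : h * y - y * h = -(2 • y)) (hx : x • v = 0) (hh : h • v = n • v)
    (hN : ∃ N, y ^ N • v = 0) : y ^ (n + 1) • v = 0 := by
  obtain ⟨N, hN⟩ := hN
  have desc : ∀ k : ℕ, y ^ (n + 1 + k) • v = 0 → y ^ (n + 1) • v = 0 := by
    intro k
    induction k with
    | zero => exact id
    | succ k ih =>
      intro hk
      apply ih
      have h1 := smul_pow_succ_smul_of_sl2 hxy hhy hx hh (n + 1 + k)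
      rw [show n + 1 + k + 1 = n + 1 + (k + 1) from rfl, hk, smul_zero] at h1
      exact (mul_sub_smul_eq_zero_iff (by omega)).1 h1.symm
  refine desc N ?_
  rw [pow_add, mul_smul, hN, smul_zero]

/-- The scalar is the product of the factors (m + 1)(n - m) for m < n, none of which is zero. -/
theorem exists_pow_smul_pow_smul_of_sl2 {x y h : R} {v : V} {n : ℕ} (hxy : x * y - y * x = h)
    (hhy : h * y - y * h = -(2 • y)) (hx : x • v = 0) (hh : h • v = n • v) :
    ∃ k : ℂ, k ≠ 0 ∧ x ^ n • y ^ n • v = k • v := by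
  have key : ∀ m ≤ n, ∃ k : ℤ, k ≠ 0 ∧ x ^ m • y ^ m • v = k • v := by
    intro m
    induction m with
    | zero => exact fun _ => ⟨1, one_ne_zero, by simp⟩
    | succ m ih =>
      intro hm
      obtain ⟨k, hk, hkv⟩ := ih (by omega)
      refine ⟨(((m : ℤ) + 1) * (n - m)) * k, mul_ne_zero (mul_ne_zero (by positivity) ?_) hk, ?_⟩
      · rw [sub_ne_zero]
        exact_mod_cast (by omega : n ≠ m)
      · rw [pow_succ x, mul_smul, smul_pow_succ_smul_of_sl2 hxy hhy hx hh, smul_algebra_smul_comm,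
          hkv, smul_smul]
  obtain ⟨k, hk, hkv⟩ := key n le_rfl
  exact ⟨k, by exact_mod_cast hk, by rw [hkv, Int.cast_smul_eq_zsmul]⟩

end Sl2

end GlobalWeyl
end

/-! ### The universal property of the Weyl module and the map σ -/

open scoped TensorProduct

noncomputable section

namespace GlobalWeyl

section Single

variable {I : Type*} (r : I → ℕ) {A : Type*} [CommRing A] [Algebra ℂ A]

open Classical in
/-- The inclusion `A → A^{⊗ r_λ}` at the position `p`. -/
def single (p : Pos r) : A →ₐ[ℂ] TensorPow r A :=
  PiTensorProduct.singleAlgHom (R := ℂ) (A := fun _ : Pos r => A) p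

theorem symElt_eq (i : I) (a : A) :
    symElt r i a = ∑ k : Fin (r i), single r (⟨i, k⟩ : Pos r) a := rfl

end Single

section Abelian

variable {g : Type*} [LieRing g] [LieAlgebra ℂ g] [FiniteDimensional ℂ g]
  [LieAlgebra.IsSimple ℂ g] {H : LieSubalgebra ℂ g} [H.IsCartanSubalgebra]
  {A : Type*} [CommRing A] [Algebra ℂ A]

theorem cur_cartan_abelian (x y : A ⊗[ℂ] H) :
    (LieRing.toBracket (L := A ⊗[ℂ] H)).bracket x y = 0 := by
  induction x with
  | zero => exact zero_lie y
  | add x₁ x₂ h₁ h₂ => exact (add_lie x₁ x₂ y).trans (by rw [h₁, h₂, add_zero])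
  | tmul a h =>
    induction y with
    | zero => exact lie_zero (a ⊗ₜ[ℂ] h)
    | add y₁ y₂ h₁ h₂ => exact (lie_add (a ⊗ₜ[ℂ] h) y₁ y₂).trans (by rw [h₁, h₂, add_zero])
    | tmul a' h' =>
      refine (LieAlgebra.ExtendScalars.bracket_tmul ..).trans ?_
      rw [trivial_lie_zero, TensorProduct.tmul_zero]

end Abelian

attribute [local instance] LieRing.ofAssociativeRing

variable {g : Type*} [LieRing g] [LieAlgebra ℂ g] [FiniteDimensional ℂ g]
  [LieAlgebra.IsSimple ℂ g] {H : LieSubalgebra ℂ g} [H.IsCartanSubalgebra]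
  (b : (LieAlgebra.IsKilling.rootSystem H).Base) (r : b.support → ℕ)
  {A : Type*} [CommRing A] [Algebra ℂ A]

/-- The universal property of the global Weyl module. -/
theorem exists_weyl_lift {V : Type*} [AddCommGroup V] [Module ℂ V]
    (φ : U (A ⊗[ℂ] g) →ₐ[ℂ] Module.End ℂ V) (v : V)
    (h1 : ∀ α : H.root, (LieAlgebra.IsKilling.rootSystem H).root α ∈ Qplus b →
      ∀ x ∈ LieAlgebra.rootSpace H α.1,
        φ (UniversalEnvelopingAlgebra.ι ℂ (constIncl A g x)) v = 0)
    (h2 : ∀ h : H, φ (UniversalEnvelopingAlgebra.ι ℂ (constIncl A g h)) v = domWeight b r h • v)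
    (h3 : ∀ i, ∀ x ∈ LieAlgebra.rootSpace H (-(simpleRoot b i : H → ℂ)),
      (φ (UniversalEnvelopingAlgebra.ι ℂ (constIncl A g x)) ^ (r i + 1)) v = 0)
    (h4 : ∀ μ : Module.Dual ℂ H, domWeight b r - μ ∉ Qplus b → ∀ m : V,
      (∀ h : H, φ (UniversalEnvelopingAlgebra.ι ℂ (constIncl A g h)) m = μ h • m) → m = 0) :
    ∃ F : WeylModule b r A →+ V, F (weylGen b r A) = v ∧ ∀ u m, F (u • m) = φ u (F m) := by
  let _ : Module (U (A ⊗[ℂ] g)) V := Module.compHom V φ.toRingHom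
  let _ : Module (U g) V := Module.compHom V (φ.comp (mapU (constIncl A g))).toRingHom
  have hU : ∀ (u : U (A ⊗[ℂ] g)) (m : V), u • m = φ u m := fun _ _ => rfl
  have hg : ∀ (u : U g) (m : V), u • m = φ (mapU (constIncl A g) u) m := fun _ _ => rfl
  have hι : ∀ x : g, mapU (constIncl A g) (UniversalEnvelopingAlgebra.ι ℂ x) =
      UniversalEnvelopingAlgebra.ι ℂ (constIncl A g x) := fun x =>
    UniversalEnvelopingAlgebra.lift_ι_apply ℂ _ x
  let f1 : SimpleModule b r →ₗ[U g] V := (simpleRel b r).liftQ (LinearMap.toSpanSingleton (U g) V v)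
    (by
      rw [simpleRel, Submodule.span_le]
      rintro u ((⟨α, hα, x, hx, rfl⟩ | ⟨h, rfl⟩) | ⟨i, x, hx, rfl⟩)
      · change (UniversalEnvelopingAlgebra.ι ℂ x : U g) • v = 0
        rw [hg, hι, h1 α hα x hx]
      · change (UniversalEnvelopingAlgebra.ι ℂ (h : g) -
          algebraMap ℂ (U g) (domWeight b r h) : U g) • v = 0
        rw [hg, map_sub, map_sub, hι, LinearMap.sub_apply, h2, AlgHom.commutes, AlgHom.commutes,
          Module.algebraMap_end_apply, sub_self]
      · change (UniversalEnvelopingAlgebra.ι ℂ x ^ (r i + 1) : U g) • v = 0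
        rw [hg, map_pow, map_pow, hι, h3 i x hx])
  have f1_gen : f1 (Submodule.Quotient.mk 1) = v := by
    change (1 : U g) • v = v
    rw [one_smul]
  have f1_smul : ∀ (k : ℂ) m, f1 (k • m) = k • f1 m := by
    intro k m
    have e1 : k • m = (algebraMap ℂ (U g) k) • m := (algebraMap_smul (U g) k m).symm
    rw [e1, map_smul, hg, AlgHom.commutes, AlgHom.commutes, Module.algebraMap_end_apply]
  let f1' : SimpleModule b r →ₗ[ℂ] V :=
    { toFun := f1, map_add' := map_add f1, map_smul' := f1_smul }
  let f2 : (U (A ⊗[ℂ] g) ⊗[ℂ] SimpleModule b r) →ₗ[ℂ] V :=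
    TensorProduct.lift ((LinearMap.lcomp ℂ V f1') ∘ₗ φ.toLinearMap)
  have f2_tmul : ∀ u m, f2 (u ⊗ₜ m) = φ u (f1 m) := fun _ _ => rfl
  have f2_smul : ∀ (u : U (A ⊗[ℂ] g)) t, f2 (u • t) = u • f2 t := by
    intro u t
    induction t with
    | zero => simp
    | add x y hx hy => rw [smul_add, map_add, hx, hy, map_add, smul_add]
    | tmul u' m =>
      rw [TensorProduct.smul_tmul', f2_tmul, f2_tmul, smul_eq_mul, map_mul]
      rfl
  let f2' : (U (A ⊗[ℂ] g) ⊗[ℂ] SimpleModule b r) →ₗ[U (A ⊗[ℂ] g)] V :=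
    { toFun := f2, map_add' := map_add f2, map_smul' := f2_smul }
  let f3 : InducedModule g A (SimpleModule b r) →ₗ[U (A ⊗[ℂ] g)] V :=
    (inducedRel g A (SimpleModule b r)).liftQ f2' (by
      rw [inducedRel, Submodule.span_le]
      rintro _ ⟨u, y, m, rfl⟩
      change f2 _ = 0
      rw [map_sub, f2_tmul, f2_tmul, map_smul, hg, map_mul, Module.End.mul_apply, sub_self])
  let f4 : WeylModule b r A →ₗ[U (A ⊗[ℂ] g)] V :=
    (truncation b A (domWeight b r) (InducedModule g A (SimpleModule b r))).liftQ f3 (by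
      rw [truncation, Submodule.span_le]
      rintro m ⟨μ, hμ, hm⟩
      refine h4 μ hμ _ fun h => ?_
      rw [← hU, ← map_smul, hm]
      have e1 : μ h • m = (algebraMap ℂ (U (A ⊗[ℂ] g)) (μ h)) • m :=
        (algebraMap_smul (U (A ⊗[ℂ] g)) (μ h) m).symm
      rw [e1, map_smul, hU, AlgHom.commutes, Module.algebraMap_end_apply])
  refine ⟨f4.toAddMonoidHom, ?_, fun u m => map_smul f4 u m⟩
  have h5 : f4 (weylGen b r A) =
      f2 ((1 : U (A ⊗[ℂ] g)) ⊗ₜ (Submodule.Quotient.mk 1 : SimpleModule b r)) := rfl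
  refine h5.trans ?_
  rw [f2_tmul, f1_gen, map_one, Module.End.one_apply]

section Symmetric

/-- The linear map `a ⊗ h ↦ ∑_p ω_{i(p)}(h) (1 ⊗ ⋯ ⊗ a ⊗ ⋯ ⊗ 1)`. -/
def symLin : A ⊗[ℂ] H →ₗ[ℂ] TensorPow r A :=
  ∑ p : Pos r, (TensorProduct.rid ℂ _).toLinearMap ∘ₗ
    TensorProduct.map (single r p).toLinearMap (fundamentalWeight b p.1)

theorem symLin_tmul (a : A) (h : H) : symLin b r (a ⊗ₜ[ℂ] h) =
    ∑ p : Pos r, fundamentalWeight b p.1 h • single r p a := by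
  simp [symLin, LinearMap.sum_apply]

/-- The algebra homomorphism `U(A ⊗ H) → A^{⊗ r_λ}` sending `a ⊗ h_i` to `sym^i_λ(a)`. -/
def symHom : U (A ⊗[ℂ] H) →ₐ[ℂ] TensorPow r A :=
  UniversalEnvelopingAlgebra.lift ℂ
    { symLin b r with
      map_lie' := fun {x y} => by
        rw [cur_cartan_abelian, LieRing.of_associative_ring_bracket, mul_comm, sub_self]
        exact map_zero (symLin (A := A) b r) }

theorem symHom_ι (x : A ⊗[ℂ] H) :
    symHom b r (UniversalEnvelopingAlgebra.ι ℂ x) = symLin b r x :=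
  UniversalEnvelopingAlgebra.lift_ι_apply ℂ _ x

theorem symHom_coroot (a : A) (i : b.support) :
    symHom b r (UniversalEnvelopingAlgebra.ι ℂ (a ⊗ₜ[ℂ] simpleCoroot b i)) = symElt r i a := by
  classical
  rw [symHom_ι, symLin_tmul, symElt_eq, Fintype.sum_sigma, Finset.sum_eq_single i]
  · refine Finset.sum_congr rfl fun k _ => ?_
    rw [fundamentalWeight_coroot, if_pos rfl, one_smul]
  · intro j _ hj
    refine Finset.sum_eq_zero fun k _ => ?_
    rw [fundamentalWeight_coroot, if_neg hj.symm, zero_smul]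
  · simp

end Symmetric

end GlobalWeyl
end

/-! ### Evaluation modules and the upper bound for the annihilator -/

open scoped TensorProduct

noncomputable section

namespace GlobalWeyl

section EvSingle

variable {I : Type*} [Fintype I] (r : I → ℕ) {A : Type*} [CommRing A] [Algebra ℂ A]
  [Algebra.FiniteType ℂ A]

theorem evTuple_tprod (S : Pos r → MaximalSpectrum A) (x : Pos r → A) :
    evTuple r S (PiTensorProduct.tprod ℂ x) = ∏ p, evMax (S p) (x p) := by
  rw [← evMulti_apply]
  exact PiTensorProduct.lift.tprod x

theorem evTuple_single (S : Pos r → MaximalSpectrum A) (p : Pos r) (a : A) :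
    evTuple r S (single r p a) = evMax (S p) a := by
  classical
  have h : single r p a = PiTensorProduct.tprod ℂ (Function.update (fun _ : Pos r => (1 : A)) p a) :=
    by unfold single; congr
  rw [h, evTuple_tprod, Finset.prod_eq_single p]
  · simp
  · intro q _ hq
    rw [Function.update_of_ne hq, map_one]
  · simp

end EvSingle

open LieAlgebra

section RootVector

variable {g : Type*} [LieRing g] [LieAlgebra ℂ g] [FiniteDimensional ℂ g]
  [LieAlgebra.IsSimple ℂ g] {H : LieSubalgebra ℂ g} [H.IsCartanSubalgebra]
  (b : (LieAlgebra.IsKilling.rootSystem H).Base)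

theorem exists_smul_of_mem_rootSpace {γ : LieModule.Weight ℂ H g} (hγ : γ.IsNonZero) {x y : g}
    (hx : x ∈ rootSpace H γ) (hx0 : x ≠ 0) (hy : y ∈ rootSpace H γ) : ∃ k : ℂ, y = k • x := by
  obtain ⟨k, hk⟩ := (finrank_eq_one_iff_of_nonzero' (⟨x, hx⟩ : rootSpace H γ)
    (by simpa using hx0)).1 (IsKilling.finrank_rootSpace_eq_one γ hγ) ⟨y, hy⟩
  exact ⟨k, (congrArg Subtype.val hk).symm⟩

theorem exists_smul_of_mem_rootSpace_neg {f : b.support → g}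
    (hf : ∀ i, f i ∈ rootSpace H (-(simpleRoot b i : H → ℂ))) (hf0 : ∀ i, f i ≠ 0)
    (i : b.support) {x : g} (hx : x ∈ rootSpace H (-(simpleRoot b i : H → ℂ))) :
    ∃ k : ℂ, x = k • f i :=
  exists_smul_of_mem_rootSpace (γ := -i.1.1) (LieSubalgebra.isNonZero_coe_root i.1).neg
    (hf i) (hf0 i) hx

end RootVector

attribute [local instance] piLieRing piLieAlgebra

section EvPoints

variable {g : Type*} [LieRing g] [LieAlgebra ℂ g] {A : Type*} [CommRing A] [Algebra ℂ A]
  {P : Type*}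

/-- The evaluation homomorphism `A ⊗ g → g^P` at a family of points of `A`. -/
def evPoints (χ : P → A →ₐ[ℂ] ℂ) : A ⊗[ℂ] g →ₗ⁅ℂ⁆ P → g :=
  { LinearMap.pi fun p => (TensorProduct.lid ℂ g).toLinearMap ∘ₗ
      TensorProduct.map (χ p).toLinearMap LinearMap.id with
    map_lie' := fun {x y} => by
      funext p
      rw [pi_lie_apply]
      change ((TensorProduct.lid ℂ g).toLinearMap ∘ₗ TensorProduct.map (χ p).toLinearMap LinearMap.id) _ =
        ⁅((TensorProduct.lid ℂ g).toLinearMap ∘ₗ TensorProduct.map (χ p).toLinearMap LinearMap.id) x,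
          ((TensorProduct.lid ℂ g).toLinearMap ∘ₗ TensorProduct.map (χ p).toLinearMap LinearMap.id) y⁆
      set f : A ⊗[ℂ] g →ₗ[ℂ] g :=
        (TensorProduct.lid ℂ g).toLinearMap ∘ₗ TensorProduct.map (χ p).toLinearMap LinearMap.id with hf
      have hft : ∀ a z, f (a ⊗ₜ z) = χ p a • z := fun a z => by simp [hf]
      induction x with
      | zero =>
        refine (congrArg f (zero_lie (L := A ⊗[ℂ] g) y)).trans ?_
        rw [map_zero, zero_lie (f y)]
      | add x₁ x₂ h₁ h₂ =>
        rw [map_add, add_lie (f x₁), ← h₁, ← h₂, ← map_add]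
        exact congrArg f (add_lie x₁ x₂ y)
      | tmul a u =>
        induction y with
        | zero =>
          refine (congrArg f (lie_zero (a ⊗ₜ[ℂ] u))).trans ?_
          rw [map_zero, lie_zero (f _)]
        | add y₁ y₂ h₁ h₂ =>
          rw [map_add, lie_add _ (f y₁), ← h₁, ← h₂, ← map_add]
          exact congrArg f (lie_add (a ⊗ₜ[ℂ] u) y₁ y₂)
        | tmul a' u' =>
          rw [hft, hft, smul_lie, lie_smul, smul_smul, ← map_mul, ← hft]
          exact congrArg f (ExtendScalars.bracket_tmul ..) }

theorem evPoints_tmul (χ : P → A →ₐ[ℂ] ℂ) (a : A) (x : g) :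
    evPoints χ (a ⊗ₜ[ℂ] x) = fun p => χ p a • x :=
  funext fun p => by
    change TensorProduct.lid ℂ g (TensorProduct.map (χ p).toLinearMap LinearMap.id (a ⊗ₜ x)) = _
    simp

theorem evPoints_constIncl (χ : P → A →ₐ[ℂ] ℂ) (x : g) :
    evPoints χ (constIncl A g x) = fun _ => x := by
  refine (evPoints_tmul χ 1 x).trans ?_
  simp

end EvPoints

attribute [local instance] LieRing.ofAssociativeRing

variable {g : Type*} [LieRing g] [LieAlgebra ℂ g] [FiniteDimensional ℂ g]
  [LieAlgebra.IsSimple ℂ g] {H : LieSubalgebra ℂ g} [H.IsCartanSubalgebra]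
  (b : (LieAlgebra.IsKilling.rootSystem H).Base) (r : b.support → ℕ)
  {A : Type*} [CommRing A] [Algebra ℂ A]

/-- The number n is the height of μ, and the only element of Q⁺ of height zero is 0. -/
theorem Qplus_apply_grading {s : H} (hs : ∀ j, simpleRoot b j s = 1) {μ : Module.Dual ℂ H}
    (hμ : μ ∈ Qplus b) : ∃ n : ℕ, μ s = n ∧ (n = 0 → μ = 0) := by
  induction hμ using AddSubmonoid.closure_induction with
  | mem x hx =>
    obtain ⟨j, rfl⟩ := hx
    exact ⟨1, by simp [hs], by simp⟩
  | zero => exact ⟨0, by simp, fun _ => rfl⟩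
  | add x y _ _ hx hy =>
    obtain ⟨m, hm, hm'⟩ := hx
    obtain ⟨n, hn, hn'⟩ := hy
    refine ⟨m + n, by simp [hm, hn], fun h => ?_⟩
    rw [hm' (by omega), hn' (by omega), add_zero]


section LieHomEnd

variable {L V : Type*} [LieRing L] [LieAlgebra ℂ L] [AddCommGroup V] [Module ℂ V]
  (ρ : L →ₗ⁅ℂ⁆ Module.End ℂ V)

theorem lieHom_commutator (x y : L) : ρ x * ρ y - ρ y * ρ x = ρ ⁅x, y⁆ :=
  (LieHom.map_lie ρ x y).symm

theorem lieHom_apply_apply (x y : L) (m : V) : ρ x (ρ y m) = ρ ⁅x, y⁆ m + ρ y (ρ x m) := by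
  rw [← lieHom_commutator, LinearMap.sub_apply, Module.End.mul_apply, Module.End.mul_apply,
    sub_add_cancel]

end LieHomEnd

/-- The weight `(t_p) ↦ ∑_p ω_{i(p)}(t_p)` of the Cartan subalgebra `H^{r_λ}` of `g^{r_λ}`. -/
def tupleWeight : Module.Dual ℂ (Pos r → H) :=
  ∑ p, fundamentalWeight b p.1 ∘ₗ LinearMap.proj p

theorem tupleWeight_apply (t : Pos r → H) :
    tupleWeight b r t = ∑ p, fundamentalWeight b p.1 (t p) := by
  simp [tupleWeight, LinearMap.sum_apply]

theorem tupleWeight_const (h : H) : tupleWeight b r (fun _ => h) = domWeight b r h := by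
  rw [tupleWeight_apply, Fintype.sum_sigma]
  simp [domWeight, LinearMap.sum_apply]

open Classical in
theorem tupleWeight_single (j : b.support × Pos r) :
    tupleWeight b r (Pi.single j.2 (simpleCoroot b j.1)) =
      ((if j.1 = j.2.1 then 1 else 0 : ℕ) : ℂ) := by
  rw [tupleWeight_apply, Finset.sum_eq_single j.2]
  · rw [Pi.single_eq_same, fundamentalWeight_coroot]; split_ifs <;> simp
  · intro q _ hq
    rw [Pi.single_eq_of_ne hq, map_zero]
  · simp

theorem apply_mapU_subIncl_eq {V : Type*} [AddCommGroup V] [Module ℂ V]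
    (φ : U (A ⊗[ℂ] g) →ₐ[ℂ] Module.End ℂ V) (χ : U (A ⊗[ℂ] H) →ₐ[ℂ] ℂ) {v : V}
    (h : ∀ a h, φ (UniversalEnvelopingAlgebra.ι ℂ (subIncl A H (a ⊗ₜ h))) v =
      χ (UniversalEnvelopingAlgebra.ι ℂ (a ⊗ₜ h)) • v) (x : U (A ⊗[ℂ] H)) :
    φ (mapU (subIncl A H) x) v = χ x • v := by
  have hx : x ∈ Algebra.adjoin ℂ (Set.range (UniversalEnvelopingAlgebra.ι ℂ :
    A ⊗[ℂ] H → U (A ⊗[ℂ] H))) := adjoin_range_ι (A ⊗[ℂ] H) ▸ trivial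
  induction hx using Algebra.adjoin_induction with
  | mem x hx =>
    obtain ⟨y, rfl⟩ := hx
    have hm : ∀ y, mapU (subIncl A H) (UniversalEnvelopingAlgebra.ι ℂ y) =
      UniversalEnvelopingAlgebra.ι ℂ (subIncl A H y) :=
      UniversalEnvelopingAlgebra.lift_ι_apply ℂ _
    rw [hm]
    induction y with
    | zero => simp
    | add y z hy hz =>
      rw [map_add, map_add, map_add, LinearMap.add_apply, hy, hz, map_add, map_add, add_smul]
    | tmul a y => exact h a y
  | algebraMap k =>
    rw [AlgHom.commutes, AlgHom.commutes, AlgHom.commutes]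
    rfl
  | add x y _ _ hx hy =>
    rw [map_add, map_add, LinearMap.add_apply, hx, hy, map_add, add_smul]
  | mul x y _ _ hx hy =>
    rw [map_mul, map_mul, Module.End.mul_apply, hy, map_smul, hx, map_mul, smul_smul, mul_comm]

variable [Algebra.FiniteType ℂ A]

-- The module V pulls back along evaluation at S to an A ⊗ g-module in which v satisfies the
-- relations of w_λ. An annihilator of w_λ therefore kills v, while U(A ⊗ H) acts on v by the
-- character ev_S ∘ σ.
open Classical in
theorem evTuple_symHom_eq_zero_of_rep {e f : b.support → g}
    (hf : ∀ i, f i ∈ rootSpace H (-(simpleRoot b i : H → ℂ)))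
    (R : ChevalleyRel (simpleRoot b) (simpleCoroot b) e f H.toSubmodule.subtype)
    {s : H} (hs : ∀ j, simpleRoot b j s = 1) {V : Type*} [AddCommGroup V] [Module ℂ V]
    (ρ : (Pos r → g) →ₗ⁅ℂ⁆ Module.End ℂ V) {v : V} (hv0 : v ≠ 0)
    (hve : ∀ i p, ρ (Pi.single p (e i)) v = 0)
    (hvt : ∀ t : Pos r → H, ρ (fun p => (t p : g)) v = tupleWeight b r t • v)
    (hvf : ∀ i p, ∃ n, (ρ (Pi.single p (f i)) ^ n) v = 0)
    (hV : ∀ m : V, m ≠ 0 → ∃ w : List (b.support × Pos r), ∀ (t : Pos r → H) (k : ℂ),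
      ρ (fun p => (t p : g)) m = k • m →
        k = tupleWeight b r t - (w.map fun j => simpleRoot b j.1 (t j.2)).sum)
    {u : U (A ⊗[ℂ] H)} (hu : u ∈ annIdeal b r A) (S : Pos r → MaximalSpectrum A) :
    evTuple r S (symHom b r u) = 0 := by
  let φ : U (A ⊗[ℂ] g) →ₐ[ℂ] Module.End ℂ V := UniversalEnvelopingAlgebra.lift ℂ
    (ρ.comp (evPoints fun p => evMax (S p)))
  have hφ : ∀ x, φ (UniversalEnvelopingAlgebra.ι ℂ x) = ρ (evPoints (fun p => evMax (S p)) x) :=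
    fun x => UniversalEnvelopingAlgebra.lift_ι_apply ℂ _ x
  have hφc : ∀ x : g, φ (UniversalEnvelopingAlgebra.ι ℂ (constIncl A g x)) = ρ fun _ => x :=
    fun x => by rw [hφ, evPoints_constIncl]
  have h1 : ∀ α : H.root, (LieAlgebra.IsKilling.rootSystem H).root α ∈ Qplus b →
      ∀ x ∈ LieAlgebra.rootSpace H α.1,
        φ (UniversalEnvelopingAlgebra.ι ℂ (constIncl A g x)) v = 0 := by
    intro α hα x hx
    rw [hφc]
    -- Otherwise a nonzero vector would have height above the highest weight by the height n > 0 of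
    -- α, while all weights of V lie at or below it.
    by_contra hne
    obtain ⟨w, hw⟩ := hV _ hne
    obtain ⟨n, hn, hn'⟩ := Qplus_apply_grading b hs hα
    have h := hw (fun _ => s) (tupleWeight b r (fun _ => s) + n) (by
      have hbr : (⁅(fun _ => (s : g) : Pos r → g), (fun _ => x : Pos r → g)⁆ : Pos r → g) = (n : ℂ) • (fun _ => x : Pos r → g) := by
        funext p
        rw [← hn]
        exact lie_of_mem_rootSpace hx s
      rw [lieHom_apply_apply, hbr, hvt, map_smul, LinearMap.smul_apply, map_smul, add_smul, add_comm])
    simp only [hs, List.map_const', List.sum_replicate, nsmul_eq_mul, mul_one] at h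
    have h2 : ((n + w.length : ℕ) : ℂ) = 0 := by
      push_cast
      linear_combination h
    have h3 : n + w.length = 0 := by exact_mod_cast h2
    exact (LieAlgebra.IsKilling.rootSystem H).ne_zero α (hn' (by omega))
  have h2 : ∀ h : H, φ (UniversalEnvelopingAlgebra.ι ℂ (constIncl A g h)) v =
      domWeight b r h • v := fun h => by
    rw [hφc, ← tupleWeight_const]
    exact hvt fun _ => h
  have hc0 : ∀ i, (f i) ≠ 0 := by
    intro i hi
    have h := R.lie_e_f i
    rw [hi, lie_zero] at h
    have h' : simpleCoroot b i = 0 := Subtype.ext h.symm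
    have h2 := simpleRoot_coroot_self b i
    rw [h', map_zero] at h2
    exact two_ne_zero h2.symm
  have h3 : ∀ i, ∀ x ∈ LieAlgebra.rootSpace H (-(simpleRoot b i : H → ℂ)),
      (φ (UniversalEnvelopingAlgebra.ι ℂ (constIncl A g x)) ^ (r i + 1)) v = 0 := by
    intro i x hx
    obtain ⟨k, rfl⟩ := exists_smul_of_mem_rootSpace_neg b hf hc0 i hx
    have hk : (fun _ => k • f i : Pos r → g) = k • fun _ => f i := rfl
    rw [hφc, hk, map_smul, smul_pow, LinearMap.smul_apply]
    have hsum : ∀ x : g, (fun _ => x : Pos r → g) = ∑ p, Pi.single p x := fun x =>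
      (Finset.univ_sum_single (fun _ : Pos r => x)).symm
    -- The diagonal f_i is a sum of commuting operators, each nilpotent on v, so some power kills v.
    -- The diagonal sl₂, where v has weight r_i, sharpens the exponent to r_i + 1.
    have key : (ρ fun _ => f i) ^ (r i + 1) • v = 0 := by
      refine pow_smul_eq_zero_of_sl2 (x := ρ fun _ => e i) (h := ρ fun _ => (simpleCoroot b i : g))
        ?_ ?_ ?_ ?_ ?_
      · rw [lieHom_commutator]
        exact congrArg ρ (funext fun p => R.lie_e_f i)
      · rw [lieHom_commutator]
        have : (⁅(fun _ => (simpleCoroot b i : g) : Pos r → g), fun _ => f i⁆ : Pos r → g) =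
            -((2 : ℕ) • fun _ => f i) := by
          funext p
          have := R.lie_h_f (simpleCoroot b i) i
          rw [simpleRoot_coroot_self] at this
          refine Eq.trans this ?_
          rw [ofNat_smul_eq_nsmul ℂ 2]
          rfl
        rw [this, map_neg, map_nsmul]
      · change (ρ fun _ => e i) v = 0
        rw [hsum, map_sum, LinearMap.sum_apply]
        exact Finset.sum_eq_zero fun p _ => hve i p
      · have := h2 (simpleCoroot b i)
        rw [hφc, domWeight_coroot, Nat.cast_smul_eq_nsmul] at this
        exact this
      · rw [hsum, map_sum]
        refine exists_sum_pow_apply_eq_zero _ _ (fun p q => ?_) fun p => hvf i p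
        rw [commute_iff_lie_eq, ← LieHom.map_lie, pi_lie_single]
        by_cases hpq : q = p
        · subst hpq; rw [Pi.single_eq_same, lie_self, Pi.single_zero, map_zero]
        · rw [Pi.single_eq_of_ne hpq, zero_lie, Pi.single_zero, map_zero]
    have key' : ((ρ fun _ => f i) ^ (r i + 1)) v = 0 := key
    rw [key', smul_zero]
  have h4 : ∀ μ : Module.Dual ℂ H, domWeight b r - μ ∉ Qplus b → ∀ m : V,
      (∀ h : H, φ (UniversalEnvelopingAlgebra.ι ℂ (constIncl A g h)) m = μ h • m) → m = 0 := by
    intro μ hμ m hm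
    by_contra hne
    obtain ⟨w, hw⟩ := hV m hne
    refine hμ ?_
    have : domWeight b r - μ = (w.map fun j => simpleRoot b j.1).sum := by
      ext h
      have h1 := hw (fun _ => h) (μ h) (by rw [← hm h, hφc])
      rw [tupleWeight_const] at h1
      rw [LinearMap.sub_apply, h1, sub_sub_cancel]
      clear hw h1
      induction w with
      | nil => simp
      | cons j w ih =>
        rw [List.map_cons, List.sum_cons, List.map_cons, List.sum_cons, ih, LinearMap.add_apply]
    rw [this]
    refine AddSubmonoid.list_sum_mem _ fun x hx => ?_
    obtain ⟨j, _, rfl⟩ := List.mem_map.1 hx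
    exact AddSubmonoid.subset_closure ⟨j.1, rfl⟩
  obtain ⟨F, hF, hFu⟩ := exists_weyl_lift b r φ v h1 h2 h3 h4
  -- On v, a ⊗ h acts by the sum over the positions p of ev_{S_p}(a) ω_{i(p)}(h), which is ev_S of
  -- σ(a ⊗ h).
  have hchar := fun x => apply_mapU_subIncl_eq φ ((evTuple r S).comp (symHom b r)) (v := v)
    (fun a h => by
      rw [hφ, AlgHom.comp_apply, symHom_ι, symLin_tmul, map_sum]
      have : evPoints (fun p => evMax (S p)) (subIncl A H (a ⊗ₜ[ℂ] h)) =
          fun p => ((evMax (S p) a • h : H) : g) :=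
        evPoints_tmul _ a (h : g)
      rw [this, hvt, tupleWeight_apply]
      congr 1
      refine Finset.sum_congr rfl fun p _ => ?_
      rw [map_smul, map_smul, evTuple_single, smul_eq_mul, smul_eq_mul, mul_comm]) x
  have h0 : φ (mapU (subIncl A H) u) v = 0 := by
    rw [← hF, ← hFu]
    exact (congrArg F hu).trans (map_zero F)
  rw [hchar, AlgHom.comp_apply] at h0
  exact (smul_eq_zero.1 h0).resolve_right hv0



/-- The characters of `U(A ⊗ H)` given by tuples of points kill the annihilator of the generator
of the global Weyl module. -/
theorem evTuple_symHom_eq_zero {u : U (A ⊗[ℂ] H)} (hu : u ∈ annIdeal b r A)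
    (S : Pos r → MaximalSpectrum A) : evTuple r S (symHom b r u) = 0 := by
  classical
  obtain ⟨e, f, he, hf, R, hspan⟩ := exists_chevalley b
  obtain ⟨s, hs⟩ := exists_grading b
  -- The highest weight is ω_{i(p)} at position p, so every coroot value is 0 or 1. The grading
  -- element of the product is the constant family s.
  obtain ⟨V, ρ, v, hv0, hve, hvt, hvf, hV⟩ := WordModule.exists_highestWeight (tupleWeight b r)
    (R.pi (P := Pos r)) (s := fun _ => s) (fun j => hs j.1)
    (fun x y hxy => funext fun p => Subtype.ext (congrFun hxy p)) (lieSpan_pi hspan)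
    (fun j => by
      change simpleRoot b j.1 ((Pi.single j.2 (simpleCoroot b j.1) : Pos r → H) j.2) = 2
      rw [Pi.single_eq_same, simpleRoot_coroot_self]) _ (tupleWeight_single b r)
  exact evTuple_symHom_eq_zero_of_rep b r hf R hs ρ hv0 (fun i p => hve (i, p)) hvt
    (fun i p => ⟨_, hvf (i, p)⟩) hV hu S

end GlobalWeyl
end

/-! ### Symmetric tensors and separation by functionals -/

open scoped TensorProduct

noncomputable section

namespace GlobalWeyl

section SymmetricSums

variable {A : Type*} [CommRing A] [Algebra ℂ A] {T : Type*} [CommRing T] [Algebra ℂ T]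
  {P : Type*} [Fintype P] (s : P → A →ₐ[ℂ] T)

-- A Newton type recursion: the position of a_0 is first chosen freely, then the choices that
-- collide with the position of some other factor are subtracted; a collision merges the two factors
-- into a_0 a_k. It expresses symmetrised products through the sums ∑_p s_p(c).
open Classical in
theorem sum_embedding_prod_succ (m : ℕ) (a : Fin (m + 1) → A) :
    ∑ e : Fin (m + 1) ↪ P, ∏ j, s (e j) (a j) =
      (∑ p, s p (a 0)) * (∑ e : Fin m ↪ P, ∏ j, s (e j) (a j.succ)) -
      ∑ k, ∑ e : Fin m ↪ P, ∏ j, s (e j) (Function.update (fun j => a j.succ) k (a 0 * a k.succ) j)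
      := by
  have hk : ∀ (e : Fin m ↪ P) (k : Fin m),
      ∏ j, s (e j) (Function.update (fun j => a j.succ) k (a 0 * a k.succ) j) =
        s (e k) (a 0) * ∏ j, s (e j) (a j.succ) := by
    intro e k
    rw [← Finset.mul_prod_erase _ _ (Finset.mem_univ k),
      ← Finset.mul_prod_erase (a := k) _ (fun j => s (e j) (a j.succ)) (Finset.mem_univ k),
      Function.update_self, map_mul, mul_assoc]
    refine congrArg _ (congrArg _ (Finset.prod_congr rfl fun j hj => ?_))
    rw [Function.update_of_ne (Finset.ne_of_mem_erase hj)]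
  rw [← (Equiv.embeddingFinSucc m P).symm.sum_comp, Fintype.sum_sigma, Finset.sum_comm,
    Finset.mul_sum, ← Finset.sum_sub_distrib]
  refine Finset.sum_congr rfl fun e _ => ?_
  have h1 : ∀ p : {p // p ∉ Set.range e},
      ∏ j, s ((Equiv.embeddingFinSucc m P).symm ⟨e, p⟩ j) (a j) =
        s p (a 0) * ∏ j, s (e j) (a j.succ) := by
    intro p
    rw [Fin.prod_univ_succ]
    simp [Equiv.coe_embeddingFinSucc_symm]
  rw [Finset.sum_congr rfl fun p _ => h1 p, Finset.sum_congr rfl fun k _ => hk e k,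
    ← Finset.sum_mul, ← Finset.sum_mul, ← sub_mul]
  congr 1
  rw [eq_sub_iff_add_eq, ← Fintype.sum_subtype_add_sum_subtype (fun p => p ∈ Set.range e), add_comm]
  congr 1
  convert Fintype.sum_equiv (Equiv.ofInjective e e.injective) (fun i => s (e i) (a 0))
    (fun p => s p (a 0)) fun i => rfl

open Classical in
theorem sum_embedding_prod_mem (m : ℕ) (a : Fin m → A) :
    ∑ e : Fin m ↪ P, ∏ j, s (e j) (a j) ∈
      Algebra.adjoin ℂ (Set.range fun c => ∑ p, s p c) := by
  induction m with
  | zero =>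
    refine sum_mem fun e _ => ?_
    rw [Fin.prod_univ_zero]
    exact one_mem _
  | succ m ih =>
    rw [sum_embedding_prod_succ]
    exact sub_mem (mul_mem (Algebra.subset_adjoin ⟨_, rfl⟩) (ih _)) (sum_mem fun k _ => ih _)

theorem sum_perm_prod_mem (n : ℕ) (s : Fin n → A →ₐ[ℂ] T) (a : Fin n → A) :
    ∑ σ : Equiv.Perm (Fin n), ∏ j, s (σ j) (a j) ∈
      Algebra.adjoin ℂ (Set.range fun c => ∑ p, s p c) := by
  classical
  convert sum_embedding_prod_mem s n a using 1
  refine Fintype.sum_equiv (Equiv.embeddingEquivOfFinite (Fin n)).symm _ _ fun σ => rfl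

end SymmetricSums

section TensorPowers

variable {P : Type*} [DecidableEq P] {A : Type*} [CommRing A] [Algebra ℂ A]

/-- The inclusion `A → A^{⊗ P}` at the position `p`. -/
abbrev posHom (p : P) : A →ₐ[ℂ] PiTensorProduct ℂ (fun _ : P => A) :=
  PiTensorProduct.singleAlgHom (R := ℂ) (A := fun _ : P => A) p

variable [Fintype P]

theorem prod_singleAlgHom (a : P → A) :
    ∏ p, posHom (P := P) (A := A) p (a p) =
      PiTensorProduct.tprod ℂ a := by
  have h : ∀ p, posHom (P := P) (A := A) p (a p) =
    PiTensorProduct.tprod ℂ (Pi.mulSingle p (a p)) := fun p => rfl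
  rw [Finset.prod_congr rfl fun p _ => h p, ← PiTensorProduct.tprod_prod]
  exact congrArg _ (Finset.univ_prod_mulSingle a)

/-- A symmetric multilinear map vanishes if its kernel contains `1` and is stable under
multiplication by the elements `∑ 1 ⊗ ⋯ ⊗ c ⊗ ⋯ ⊗ 1`. -/
theorem multilinear_eq_zero_of_symm {n : ℕ} {M : Type*} [AddCommGroup M] [Module ℂ M]
    (L : MultilinearMap ℂ (fun _ : Fin n => A) M)
    (hsymm : ∀ (σ : Equiv.Perm (Fin n)) a, L (a ∘ σ) = L a) (h1 : L 1 = 0)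
    (hmul : ∀ c t, PiTensorProduct.lift L t = 0 → PiTensorProduct.lift L
      ((∑ p, posHom (P := Fin n) (A := A) p c) * t) = 0) :
    L = 0 := by
  have key : ∀ x ∈ Algebra.adjoin ℂ (Set.range fun c => ∑ p,
      posHom (P := Fin n) (A := A) p c),
      ∀ t, PiTensorProduct.lift L t = 0 → PiTensorProduct.lift L (x * t) = 0 := by
    intro x hx
    induction hx using Algebra.adjoin_induction with
    | mem x hx =>
      obtain ⟨c, rfl⟩ := hx
      exact hmul c
    | algebraMap k =>
      intro t ht
      rw [Algebra.algebraMap_eq_smul_one, smul_one_mul, map_smul, ht, smul_zero]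
    | add x y _ _ hx hy =>
      intro t ht
      rw [add_mul, map_add, hx t ht, hy t ht, add_zero]
    | mul x y _ _ hx hy =>
      intro t ht
      rw [mul_assoc]
      exact hx _ (hy t ht)
  ext a
  -- The symmetrisation of a_1 ⊗ ⋯ ⊗ a_n lies in the algebra generated by these sums, so L kills it.
  -- By symmetry its image is n! L(a).
  have h := key _ (sum_perm_prod_mem n
    (fun p => posHom (P := Fin n) (A := A) p) a) 1
    ((PiTensorProduct.lift.tprod _).trans h1)
  have h2 : ∀ σ : Equiv.Perm (Fin n), PiTensorProduct.lift L (∏ j,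
      posHom (P := Fin n) (A := A) (σ j) (a j)) = L a := by
    intro σ
    rw [← hsymm σ.symm a, ← PiTensorProduct.lift.tprod, ← prod_singleAlgHom]
    congr 1
    rw [← Equiv.prod_comp σ (fun p => posHom p ((a ∘ σ.symm) p))]
    refine Finset.prod_congr rfl fun j _ => ?_
    rw [Function.comp_apply, Equiv.symm_apply_apply]
  rw [mul_one, map_sum, Finset.sum_congr rfl fun σ _ => h2 σ, Finset.sum_const,
    ← Nat.cast_smul_eq_nsmul ℂ] at h
  refine (smul_eq_zero.1 h).resolve_left ?_
  simp [Fintype.card_perm, Nat.factorial_ne_zero]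

theorem adjoin_single_eq_top {G : Set A} (hG : Algebra.adjoin ℂ G = ⊤) :
    Algebra.adjoin ℂ (⋃ p : P, posHom (P := P) (A := A) p '' G)
      = ⊤ := by
  rw [eq_top_iff]
  intro t _
  have hs : ∀ p a, posHom (P := P) (A := A) p a ∈
      Algebra.adjoin ℂ (⋃ p : P,
        posHom (P := P) (A := A) p '' G) := by
    intro p a
    have ha : a ∈ Algebra.adjoin ℂ G := hG ▸ trivial
    have h2 := Subalgebra.mem_map.2 ⟨a, ha, (rfl : posHom (P := P) (A := A) p a = _)⟩
    rw [AlgHom.map_adjoin] at h2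
    exact Algebra.adjoin_mono (Set.subset_iUnion_of_subset p subset_rfl) h2
  induction t using PiTensorProduct.induction_on with
  | smul_tprod k a =>
    rw [← prod_singleAlgHom]
    exact Subalgebra.smul_mem _ (prod_mem fun p _ => hs p _) k
  | add x y hx hy => exact add_mem (hx trivial) (hy trivial)

theorem finiteType_piTensorProduct [Algebra.FiniteType ℂ A] :
    Algebra.FiniteType ℂ (PiTensorProduct ℂ (fun _ : P => A)) := by
  obtain ⟨G, hG⟩ := Algebra.FiniteType.out (R := ℂ) (A := A)
  exact ⟨Subalgebra.fg_def.2 ⟨_, Set.finite_iUnion fun p => G.finite_toSet.image _,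
    adjoin_single_eq_top hG⟩⟩

end TensorPowers

section Separation

variable {P : Type*} [Fintype P] {A : Type*} [CommRing A] [Algebra ℂ A]

/-- Products of functionals on the factors separate the points of a tensor power. -/
theorem eq_zero_of_forall_dual {t : PiTensorProduct ℂ (fun _ : P => A)}
    (h : ∀ ψ : P → Module.Dual ℂ A, PiTensorProduct.lift
      ((MultilinearMap.mkPiAlgebra ℂ P ℂ).compLinearMap ψ) t = 0) : t = 0 := by
  let B := Module.Free.chooseBasis ℂ A
  refine (Basis.piTensorProduct fun _ : P => B).ext_elem fun k => ?_
  have h1 : (Basis.piTensorProduct fun _ : P => B).coord k = PiTensorProduct.lift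
      ((MultilinearMap.mkPiAlgebra ℂ P ℂ).compLinearMap fun p => B.coord (k p)) := by
    ext a
    simp [Basis.piTensorProduct_repr_tprod_apply]
  have h2 := h fun p => B.coord (k p)
  rw [← h1] at h2
  rw [map_zero]
  exact h2

/-- Functionals from E are replaced by arbitrary ones one position at a time; product functionals
separate points by a basis argument. -/
theorem eq_zero_of_forall_separating {E : Set (Module.Dual ℂ A)}
    (hE : ∀ a : A, (∀ χ ∈ E, χ a = 0) → a = 0) {t : PiTensorProduct ℂ (fun _ : P => A)}
    (h : ∀ ψ : P → Module.Dual ℂ A, (∀ p, ψ p ∈ E) → PiTensorProduct.lift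
      ((MultilinearMap.mkPiAlgebra ℂ P ℂ).compLinearMap ψ) t = 0) : t = 0 := by
  classical
  have key : ∀ s : Finset P, ∀ ψ : P → Module.Dual ℂ A, (∀ p ∉ s, ψ p ∈ E) → PiTensorProduct.lift
      ((MultilinearMap.mkPiAlgebra ℂ P ℂ).compLinearMap ψ) t = 0 := by
    intro s
    induction s using Finset.induction_on with
    | empty => exact fun ψ hψ => h ψ fun p => hψ p (Finset.notMem_empty p)
    | insert p s _ ih =>
      intro ψ hψ
      -- Contraction of every factor except the one at p. Its value on t lies in A, where E
      -- separates points.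
      let c : PiTensorProduct ℂ (fun _ : P => A) →ₗ[ℂ] A := PiTensorProduct.lift
        ((MultilinearMap.mkPiAlgebra ℂ P A).compLinearMap (Function.update
          (fun q => Algebra.linearMap ℂ A ∘ₗ ψ q) p LinearMap.id))
      have hc : ∀ χ : Module.Dual ℂ A, χ ∘ₗ c = PiTensorProduct.lift
          ((MultilinearMap.mkPiAlgebra ℂ P ℂ).compLinearMap (Function.update ψ p χ)) := by
        intro χ
        ext a
        simp only [c, LinearMap.compMultilinearMap_apply, LinearMap.comp_apply,
          PiTensorProduct.lift.tprod, MultilinearMap.compLinearMap_apply,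
          MultilinearMap.mkPiAlgebra_apply]
        rw [← Finset.mul_prod_erase _ _ (Finset.mem_univ p),
          ← Finset.mul_prod_erase (a := p) _ (fun q => (Function.update ψ p χ q) (a q))
          (Finset.mem_univ p), Function.update_self, Function.update_self]
        have e1 : ∏ q ∈ Finset.univ.erase p, (Function.update
            (fun q => Algebra.linearMap ℂ A ∘ₗ ψ q) p LinearMap.id q) (a q) =
            algebraMap ℂ A (∏ q ∈ Finset.univ.erase p, (Function.update ψ p χ q) (a q)) := by
          rw [map_prod]
          refine Finset.prod_congr rfl fun q hq => ?_
          rw [Function.update_of_ne (Finset.ne_of_mem_erase hq),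
            Function.update_of_ne (Finset.ne_of_mem_erase hq)]
          rfl
        rw [e1, LinearMap.id_apply, mul_comm, ← Algebra.smul_def, map_smul, smul_eq_mul, mul_comm]
      have h0 : c t = 0 := hE _ fun χ hχ => by
        rw [← LinearMap.comp_apply, hc]
        refine ih _ fun q hq => ?_
        by_cases hqp : q = p
        · subst hqp; rwa [Function.update_self]
        · rw [Function.update_of_ne hqp]
          exact hψ q (by simp [hqp, hq])
      have h1 := hc (ψ p)
      rw [Function.update_eq_self] at h1
      rw [← h1, LinearMap.comp_apply, h0, map_zero]
  exact eq_zero_of_forall_dual fun ψ => key Finset.univ ψ fun p hp => absurd (Finset.mem_univ p) hp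

end Separation

end GlobalWeyl
end

/-! ### Generators and maximal ideals of the invariant ring -/

open scoped TensorProduct

noncomputable section

namespace GlobalWeyl

section Characters

theorem algHom_eq_of_ker_le {B : Type*} [CommRing B] [Algebra ℂ B] {χ ψ : B →ₐ[ℂ] ℂ}
    (h : RingHom.ker χ ≤ RingHom.ker ψ) : χ = ψ := by
  ext a
  have h1 : a - algebraMap ℂ B (χ a) ∈ RingHom.ker χ := by
    rw [RingHom.mem_ker, map_sub, AlgHom.commutes]
    exact sub_self _
  have h2 := h h1
  rw [RingHom.mem_ker, map_sub, AlgHom.commutes, sub_eq_zero] at h2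
  exact h2.symm

theorem evMax_ker {B : Type*} [CommRing B] [Algebra ℂ B] [Algebra.FiniteType ℂ B]
    (S : MaximalSpectrum B) : RingHom.ker (evMax S) = S.asIdeal := by
  have hle : S.asIdeal ≤ RingHom.ker (evMax S) := by
    intro a ha
    rw [RingHom.mem_ker]
    simp only [evMax, AlgHom.comp_apply, Ideal.Quotient.mkₐ_eq_mk]
    rw [Ideal.Quotient.eq_zero_iff_mem.2 ha, map_zero]
  exact (S.isMaximal.eq_of_le (RingHom.ker_ne_top _) hle).symm

theorem exists_algHom_ker_eq {B : Type*} [CommRing B] [Algebra ℂ B] [Algebra.FiniteType ℂ B]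
    (Q : Ideal B) [Q.IsMaximal] : ∃ χ : B →ₐ[ℂ] ℂ, RingHom.ker χ = Q :=
  ⟨evMax ⟨Q, ‹_›⟩, evMax_ker _⟩

end Characters

section YoungPerm

variable {I : Type*} (r : I → ℕ) {A : Type*} [CommRing A] [Algebra ℂ A]

theorem permAlgHom_tprod (σ : YoungGroup r) (a : Pos r → A) :
    permAlgHom r A σ (PiTensorProduct.tprod ℂ a) =
      PiTensorProduct.tprod ℂ (a ∘ (posPerm r σ).symm) :=
  PiTensorProduct.reindex_tprod (posPerm r σ) a

theorem single_eq_posHom [DecidableEq (Pos r)] (p : Pos r) :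
    single r p = posHom (P := Pos r) (A := A) p := by
  unfold single
  congr
  exact Subsingleton.elim _ _

theorem permAlgHom_single (σ : YoungGroup r) (p : Pos r) (a : A) :
    permAlgHom r A σ (single r p a) = single r (posPerm r σ p) a := by
  classical
  rw [single_eq_posHom, single_eq_posHom]
  refine (permAlgHom_tprod r σ _).trans (congrArg (PiTensorProduct.tprod ℂ) (funext fun q => ?_))
  change (Pi.mulSingle p a : Pos r → A) ((posPerm r σ).symm q) =
    (Pi.mulSingle (posPerm r σ p) a : Pos r → A) q
  simp only [Pi.mulSingle_apply, Equiv.symm_apply_eq]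

theorem symElt_mem (i : I) (a : A) : symElt r i a ∈ InvAlg r A := by
  intro σ
  rw [symElt_eq, map_sum, Finset.sum_congr rfl fun k _ => permAlgHom_single r σ _ a]
  exact Equiv.sum_comp (σ i) fun k => single r (⟨i, k⟩ : Pos r) a

end YoungPerm

section Young

variable {I : Type*} [Fintype I] (r : I → ℕ) {A : Type*} [CommRing A] [Algebra ℂ A]

theorem prod_single (a : Pos r → A) :
    ∏ p, single r p (a p) = PiTensorProduct.tprod ℂ a := by
  classical
  simp only [single_eq_posHom]
  exact prod_singleAlgHom a

/-- On a pure tensor the sum over the Young group factors into one symmetrised product for each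
block. -/
theorem sum_permAlgHom_mem [DecidableEq I] (t : TensorPow r A) : ∑ σ : YoungGroup r, permAlgHom r A σ t ∈
    Algebra.adjoin ℂ (Set.range fun x : I × A => symElt r x.1 x.2) := by
  induction t using PiTensorProduct.induction_on with
  | smul_tprod k a =>
    simp only [map_smul]
    rw [← Finset.smul_sum]
    refine Subalgebra.smul_mem _ ?_ k
    have h : ∀ σ : YoungGroup r, permAlgHom r A σ (PiTensorProduct.tprod ℂ a) =
        ∏ i, ∏ k, single r (⟨i, σ i k⟩ : Pos r) (a ⟨i, k⟩) := by
      intro σ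
      rw [← prod_single, map_prod, Fintype.prod_sigma]
      refine Finset.prod_congr rfl fun i _ => Finset.prod_congr rfl fun k _ => ?_
      exact permAlgHom_single r σ ⟨i, k⟩ _
    rw [Finset.sum_congr rfl fun σ _ => h σ, ← Fintype.piFinset_univ,
      ← Finset.prod_univ_sum (fun _ => Finset.univ) fun i (τ : Equiv.Perm (Fin (r i))) =>
        ∏ k, single r (⟨i, τ k⟩ : Pos r) (a ⟨i, k⟩)]
    refine prod_mem fun i _ => ?_
    refine Algebra.adjoin_mono ?_ (sum_perm_prod_mem (r i) (fun k => single r (⟨i, k⟩ : Pos r))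
      fun k => a ⟨i, k⟩)
    rintro _ ⟨c, rfl⟩
    exact ⟨(i, c), symElt_eq r i c⟩
  | add x y hx hy =>
    simp only [map_add, Finset.sum_add_distrib]
    exact add_mem hx hy

/-- The invariant ring is generated by the elements `sym^i_λ(a)`. -/
theorem invAlg_eq_adjoin :
    InvAlg r A = Algebra.adjoin ℂ (Set.range fun x : I × A => symElt r x.1 x.2) := by
  classical
  refine le_antisymm (fun t ht => ?_) (Algebra.adjoin_le ?_)
  -- Averaging: on an invariant t the sum over the group is the group order times t, and the order
  -- is invertible.
  · have h := sum_permAlgHom_mem r t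
    rw [Finset.sum_congr rfl fun σ _ => ht σ, Finset.sum_const, ← Nat.cast_smul_eq_nsmul ℂ] at h
    have hne : ((Finset.univ : Finset (YoungGroup r)).card : ℂ) ≠ 0 := by
      rw [Finset.card_univ]
      exact_mod_cast Fintype.card_ne_zero
    have h2 := Subalgebra.smul_mem _ h ((Finset.univ : Finset (YoungGroup r)).card : ℂ)⁻¹
    rwa [inv_smul_smul₀ hne] at h2
  · rintro _ ⟨⟨i, a⟩, rfl⟩
    exact symElt_mem r i a

/-- The action of the Young subgroup on the tensor power. -/
@[reducible] def youngAction : MulSemiringAction (YoungGroup r) (TensorPow r A) where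
  smul σ t := permAlgHom r A σ t
  one_smul t := by
    have h : (permAlgHom r A 1).toLinearMap = LinearMap.id := by
      ext a
      exact permAlgHom_tprod r 1 a
    exact LinearMap.congr_fun h t
  mul_smul σ τ t := by
    have h : (permAlgHom r A (σ * τ)).toLinearMap =
        (permAlgHom r A σ).toLinearMap ∘ₗ (permAlgHom r A τ).toLinearMap := by
      ext a
      have h1 := permAlgHom_tprod r τ a
      simp only [LinearMap.compMultilinearMap_apply, LinearMap.comp_apply, AlgHom.toLinearMap_apply,
        permAlgHom_tprod]
      rfl
    exact LinearMap.congr_fun h t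
  smul_zero σ := map_zero _
  smul_add σ := map_add _
  smul_one σ := map_one _
  smul_mul σ := map_mul _

attribute [local instance] youngAction

instance young_isInvariant :
    Algebra.IsInvariant (InvAlg r A) (TensorPow r A) (YoungGroup r) where
  isInvariant t ht := ⟨⟨t, ht⟩, rfl⟩

instance young_smulCommClass : SMulCommClass (YoungGroup r) (InvAlg r A) (TensorPow r A) where
  smul_comm σ x t := by
    change permAlgHom r A σ ((x : TensorPow r A) * t) = (x : TensorPow r A) * permAlgHom r A σ t
    rw [map_mul, x.2 σ]

variable [Algebra.FiniteType ℂ A]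

theorem exists_evTuple_eq (χ : TensorPow r A →ₐ[ℂ] ℂ) :
    ∃ S : Pos r → MaximalSpectrum A, evTuple r S = χ := by
  classical
  let S : Pos r → MaximalSpectrum A := fun p => ⟨RingHom.ker (χ.comp (single r p)),
    RingHom.ker_isMaximal_of_surjective _ fun c => ⟨algebraMap ℂ A c, AlgHom.commutes _ c⟩⟩
  refine ⟨S, PiTensorProduct.algHom_ext fun p => AlgHom.ext fun a => ?_⟩
  have h : evMax (S p) = χ.comp (single r p) := algHom_eq_of_ker_le (evMax_ker (S p)).le
  rw [← posHom, ← single_eq_posHom, AlgHom.comp_apply, evTuple_single, h]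

theorem evTuple_injective {S T : Pos r → MaximalSpectrum A}
    (h : evTuple r S = evTuple r T) : S = T := by
  funext p
  refine MaximalSpectrum.ext ?_
  rw [← evMax_ker, ← evMax_ker]
  congr 1
  ext a
  rw [← evTuple_single r S p, ← evTuple_single r T p, h]

theorem evTuple_comp_permAlgHom (S : Pos r → MaximalSpectrum A) (σ : YoungGroup r) :
    (evTuple r S).comp (permAlgHom r A σ) = evTuple r (S ∘ posPerm r σ) := by
  refine AlgHom.toLinearMap_injective (PiTensorProduct.ext (MultilinearMap.ext fun a => ?_))
  change evTuple r S (permAlgHom r A σ (PiTensorProduct.tprod ℂ a)) =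
    evTuple r (S ∘ posPerm r σ) (PiTensorProduct.tprod ℂ a)
  rw [permAlgHom_tprod, evTuple_tprod, evTuple_tprod, ← Equiv.prod_comp (posPerm r σ)]
  refine Finset.prod_congr rfl fun p _ => ?_
  rw [Function.comp_apply, Function.comp_apply, Equiv.symm_apply_apply]

/-- The tensor power is integral over the invariants of a finite group, so a maximal ideal lies over
M. By the Nullstellensatz it is the kernel of a character, and such a character is determined by its
restrictions to the factors. -/
theorem orbitPoint_surjective : Function.Surjective
    (orbitPoint r : (Pos r → MaximalSpectrum A) → MaximalSpectrum (InvAlg r A)) := by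
  classical
  intro M
  have := Algebra.IsInvariant.isIntegral (InvAlg r A) (TensorPow r A) (YoungGroup r)
  have := M.isMaximal
  obtain ⟨Q, hQ, hQM⟩ := Ideal.exists_ideal_over_maximal_of_isIntegral (S := TensorPow r A)
    M.asIdeal (by
      rw [(RingHom.injective_iff_ker_eq_bot _).1 Subtype.val_injective]
      exact bot_le)
  have : Algebra.FiniteType ℂ (TensorPow r A) := finiteType_piTensorProduct
  obtain ⟨χ, hχ⟩ := exists_algHom_ker_eq Q
  obtain ⟨S, rfl⟩ := exists_evTuple_eq r χ
  refine ⟨S, MaximalSpectrum.ext ?_⟩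
  rw [← hQM, ← hχ]
  rfl

/-- A finite group acts transitively on the primes over a given prime of its ring of invariants. -/
theorem orbitPoint_eq_iff (S T : Pos r → MaximalSpectrum A) :
    orbitPoint r S = orbitPoint r T ↔ ∃ σ : YoungGroup r, T = S ∘ posPerm r σ := by
  constructor
  · intro h
    have hp : ∀ S : Pos r → MaximalSpectrum A, (RingHom.ker (evTuple r S)).IsPrime :=
      fun S => RingHom.ker_isPrime _
    have := hp S
    have := hp T
    obtain ⟨σ, hσ⟩ := Algebra.IsInvariant.exists_smul_of_under_eq (InvAlg r A) (TensorPow r A)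
      (YoungGroup r) (RingHom.ker (evTuple r S)) (RingHom.ker (evTuple r T))
      (congrArg MaximalSpectrum.asIdeal h)
    refine ⟨σ⁻¹, evTuple_injective r ?_⟩
    rw [← evTuple_comp_permAlgHom]
    refine (algHom_eq_of_ker_le ?_).symm
    rw [hσ]
    intro x hx
    exact Ideal.mem_pointwise_smul_iff_inv_smul_mem.2 hx
  · rintro ⟨σ, rfl⟩
    refine MaximalSpectrum.ext ?_
    change RingHom.ker ((evTuple r S).comp (InvAlg r A).val) =
      RingHom.ker ((evTuple r (S ∘ posPerm r σ)).comp (InvAlg r A).val)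
    rw [← evTuple_comp_permAlgHom]
    ext x
    simp only [RingHom.mem_ker, AlgHom.comp_apply, Subalgebra.coe_val]
    rw [x.2 σ]

/-- If the Jacobson radical of `A` vanishes, the characters given by tuples of points separate the
elements of the tensor power. -/
theorem eq_zero_of_forall_evTuple (hA : Ring.jacobson A = ⊥) {t : TensorPow r A}
    (h : ∀ S : Pos r → MaximalSpectrum A, evTuple r S t = 0) : t = 0 := by
  refine eq_zero_of_forall_separating
    (E := Set.range fun S : MaximalSpectrum A => (evMax S).toLinearMap) (fun a ha => ?_)
    fun ψ hψ => ?_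
  · have : a ∈ Ring.jacobson A := by
      rw [Ring.jacobson_eq_sInf_isMaximal, Ideal.mem_sInf]
      intro Q hQ
      have := ha _ ⟨⟨Q, hQ⟩, rfl⟩
      exact (evMax_ker ⟨Q, hQ⟩).le this
    rwa [hA] at this
  · choose S hS using hψ
    have : ψ = fun p => (evMax (S p)).toLinearMap := funext fun p => (hS p).symm
    rw [this]
    exact h S

end Young

end GlobalWeyl
end

/-! ### The current algebra of sl₂ -/

open scoped TensorProduct

noncomputable section

namespace GlobalWeyl

theorem posHom_mul_tprod {P : Type*} [DecidableEq P] [Fintype P] {A : Type*} [CommRing A]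
    [Algebra ℂ A] (p : P) (c : A) (a : P → A) :
    posHom p c * PiTensorProduct.tprod ℂ a =
      PiTensorProduct.tprod ℂ (Function.update a p (c * a p)) := by
  have h : posHom (P := P) p c = PiTensorProduct.tprod ℂ (Pi.mulSingle p c) := rfl
  rw [h, PiTensorProduct.tprod_mul_tprod]
  congr 1
  funext q
  by_cases hq : q = p
  · subst hq; simp
  · simp [hq]

/-- Operators `x a`, `y a`, `h a` satisfying the relations of the current algebra `A ⊗ sl₂`. The
commuting operators `y a` are given by elements of a commutative algebra. -/
structure CurrentSl2 {A R S : Type*} [CommRing A] [Algebra ℂ A] [Ring R] [Algebra ℂ R]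
    [CommRing S] [Algebra ℂ S] (ι : S →ₐ[ℂ] R) (x : A →ₗ[ℂ] R) (y : A →ₗ[ℂ] S) (h : A →ₗ[ℂ] R) :
    Prop where
  xx : ∀ a b, x a * x b = x b * x a
  xy : ∀ a b, x a * ι (y b) = ι (y b) * x a + h (a * b)
  hx : ∀ a b, h a * x b = x b * h a + 2 • x (a * b)
  hy : ∀ a b, h a * ι (y b) = ι (y b) * h a - 2 • ι (y (a * b))

namespace CurrentSl2

variable {A R S : Type*} [CommRing A] [Algebra ℂ A] [Ring R] [Algebra ℂ R]
  [CommRing S] [Algebra ℂ S] {ι : S →ₐ[ℂ] R} {x : A →ₗ[ℂ] R} {y : A →ₗ[ℂ] S} {h : A →ₗ[ℂ] R}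

/-- The factor k makes the truncated exponent k - 1 harmless at k = 0. -/
theorem nsmul_pow_mul_x (C : CurrentSl2 ι x y h) (c : A) (k : ℕ) :
    k • (x 1 ^ (k - 1) * x c) * x 1 = k • (x 1 ^ k * x c) := by
  cases k with
  | zero => simp
  | succ k =>
    rw [Nat.add_sub_cancel, smul_mul_assoc, mul_assoc, C.xx c 1, ← mul_assoc, ← pow_succ]

theorem h_mul_x_pow (C : CurrentSl2 ι x y h) (c : A) (k : ℕ) :
    h c * x 1 ^ k = x 1 ^ k * h c + 2 • (k • (x 1 ^ (k - 1) * x c)) := by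
  induction k with
  | zero => simp
  | succ k ih =>
    rw [pow_succ, ← mul_assoc, ih, add_mul, mul_assoc, C.hx, mul_one, smul_mul_assoc,
      C.nsmul_pow_mul_x, Nat.add_sub_cancel, mul_add, mul_smul_comm, ← mul_assoc, succ_nsmul]
    module

theorem x_pow_mul_y (C : CurrentSl2 ι x y h) (c : A) (k : ℕ) :
    x 1 ^ (k + 1) * ι (y c) = ι (y c) * x 1 ^ (k + 1) +
      (k + 1) • (x 1 ^ k * h c + k • (x 1 ^ (k - 1) * x c)) := by
  induction k with
  | zero => simp [C.xy]
  | succ k ih =>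
    rw [pow_succ, mul_assoc, C.xy, one_mul, mul_add, ← mul_assoc, ih, add_mul, smul_mul_assoc,
      add_mul, C.nsmul_pow_mul_x, mul_assoc _ (h c), C.hx, mul_one, mul_add, ← mul_assoc (x 1 ^ k),
      ← pow_succ, mul_assoc _ _ (x 1), ← pow_succ, mul_smul_comm, Nat.add_sub_cancel]
    module

/-- The multilinear map `(a_j) ↦ ∏ y a_j`. -/
def yProd (y : A →ₗ[ℂ] S) (m : ℕ) : MultilinearMap ℂ (fun _ : Fin m => A) S :=
  (MultilinearMap.mkPiAlgebra ℂ (Fin m) S).compLinearMap fun _ => y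

theorem yProd_apply (m : ℕ) (a : Fin m → A) : yProd y m a = ∏ j, y (a j) := by
  simp [yProd]

theorem h_mul_prod (C : CurrentSl2 ι x y h) (c : A) {m : ℕ} (a : Fin m → A)
    (s : Finset (Fin m)) : h c * ι (∏ j ∈ s, y (a j)) = ι (∏ j ∈ s, y (a j)) * h c -
      2 • ∑ k ∈ s, ι (∏ j ∈ s, y (Function.update a k (c * a k) j)) := by
  induction s using Finset.induction_on with
  | empty => simp
  | insert k s hk ih =>
    have h1 : ∏ j ∈ s, y (Function.update a k (c * a k) j) = ∏ j ∈ s, y (a j) :=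
      Finset.prod_congr rfl fun j hj => by
        rw [Function.update_of_ne (ne_of_mem_of_not_mem hj hk)]
    have h2 : ∀ l ∈ s, ι (∏ j ∈ insert k s, y (Function.update a l (c * a l) j)) =
        ι (y (a k)) * ι (∏ j ∈ s, y (Function.update a l (c * a l) j)) := by
      intro l hl
      rw [Finset.prod_insert hk, Function.update_of_ne (ne_of_mem_of_not_mem hl hk).symm, map_mul]
    rw [Finset.sum_insert hk, Finset.sum_congr rfl h2, ← Finset.mul_sum, Finset.prod_insert hk,
      Finset.prod_insert hk, Function.update_self, h1, map_mul, map_mul, ← mul_assoc, C.hy,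
      sub_mul, mul_assoc, ih, mul_sub, ← mul_assoc, smul_mul_assoc, mul_smul_comm]
    module

/-- The commutator with h(c) corresponds on the tensor power to -2 times multiplication by ∑ 1 ⊗ ⋯ ⊗
c ⊗ ⋯ ⊗ 1. This links the current algebra to symmetric tensors. -/
theorem h_mul_lift_yProd (C : CurrentSl2 ι x y h) (c : A) (m : ℕ)
    (t : PiTensorProduct ℂ fun _ : Fin m => A) :
    h c * ι (PiTensorProduct.lift (yProd y m) t) = ι (PiTensorProduct.lift (yProd y m) t) * h c -
      2 • ι (PiTensorProduct.lift (yProd y m) ((∑ p, posHom p c) * t)) := by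
  induction t using PiTensorProduct.induction_on with
  | smul_tprod k a =>
    rw [mul_smul_comm, map_smul, map_smul, map_smul, map_smul, mul_smul_comm, smul_mul_assoc,
      PiTensorProduct.lift.tprod, yProd_apply, C.h_mul_prod, Finset.sum_mul, map_sum, map_sum,
      smul_sub, smul_comm k (2 : ℕ)]
    congr 4
    funext p
    rw [posHom_mul_tprod, PiTensorProduct.lift.tprod, yProd_apply]
  | add t u ht hu =>
    rw [map_add, map_add, mul_add, ht, hu, mul_add, map_add, map_add, add_mul]
    module

section Straightening

variable {V : Type*} [AddCommGroup V] [Module ℂ V] [Module R V] [IsScalarTower ℂ R V]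

/-- The operators killing `F w`. -/
def killer (F : Subalgebra ℂ R) (w : V) : Submodule ℂ R where
  carrier := {z | ∀ q ∈ F, z • q • w = 0}
  zero_mem' q _ := zero_smul _ _
  add_mem' {z z'} hz hz' q hq := by rw [add_smul, hz q hq, hz' q hq, add_zero]
  smul_mem' k z hz q hq := by rw [smul_assoc, hz q hq, smul_zero]

/-- The span of the operators `y a_1 ⋯ y a_m q` with `q ∈ F`. -/
def lowering (ι : S →ₐ[ℂ] R) (y : A →ₗ[ℂ] S) (F : Subalgebra ℂ R) : ℕ → Submodule ℂ R
  | 0 => F.toSubmodule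
  | m + 1 => LinearMap.range (ι.toLinearMap ∘ₗ y) * lowering ι y F m

variable {F : Subalgebra ℂ R} {w : V}

theorem mul_mem_killer (u : R) {z : R} (hz : z ∈ killer F w) : u * z ∈ killer F w := by
  intro q hq
  rw [mul_smul, hz q hq, smul_zero]

theorem y_mul_mem_lowering (b : A) {m : ℕ} {z : R} (hz : z ∈ lowering ι y F m) :
    ι (y b) * z ∈ lowering ι y F (m + 1) :=
  Submodule.mul_mem_mul ⟨b, rfl⟩ hz

theorem lowering_induction {m : ℕ} {N : Submodule ℂ R}
    (hN : ∀ b, ∀ z ∈ lowering ι y F m, ι (y b) * z ∈ N) {z : R}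
    (hz : z ∈ lowering ι y F (m + 1)) : z ∈ N := by
  refine (Submodule.mul_le.2 ?_ : LinearMap.range (ι.toLinearMap ∘ₗ y) * lowering ι y F m ≤ N) hz
  rintro _ ⟨b, rfl⟩ z hz
  exact hN b z hz

theorem h_mul_mem_lowering (C : CurrentSl2 ι x y h) (hF : ∀ c, h c ∈ F) (c : A) {m : ℕ} {z : R}
    (hz : z ∈ lowering ι y F m) : h c * z ∈ lowering ι y F m := by
  induction m generalizing z with
  | zero => exact F.mul_mem (hF c) hz
  | succ m ih =>
    refine lowering_induction (N := (lowering ι y F (m + 1)).comap (LinearMap.mulLeft ℂ (h c)))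
      (fun b z hz => ?_) hz
    change h c * (ι (y b) * z) ∈ lowering ι y F (m + 1)
    rw [← mul_assoc, C.hy, sub_mul, smul_mul_assoc, mul_assoc]
    exact sub_mem (y_mul_mem_lowering b (ih hz)) (nsmul_mem (y_mul_mem_lowering _ hz) 2)

/-- Moving x(a) to the right past y(b) leaves an h, which is absorbed into F after passing the
remaining lowering operators. If x(a) passes all of them, the result kills F w. -/
theorem x_mul_mem (C : CurrentSl2 ι x y h) (hF : ∀ c, h c ∈ F)
    (hx : ∀ a, ∀ q ∈ F, x a • q • w = 0) (a : A) {m : ℕ} {z : R}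
    (hz : z ∈ lowering ι y F (m + 1)) : x a * z ∈ lowering ι y F m ⊔ killer F w := by
  induction m generalizing z with
  | zero =>
    refine lowering_induction (N := (lowering ι y F 0 ⊔ killer F w).comap
      (LinearMap.mulLeft ℂ (x a))) (fun b z hz => ?_) hz
    change x a * (ι (y b) * z) ∈ lowering ι y F 0 ⊔ killer F w
    rw [← mul_assoc, C.xy, add_mul, mul_assoc, add_comm]
    refine Submodule.add_mem_sup (F.mul_mem (hF _) hz) (mul_mem_killer _ fun q hq => ?_)
    rw [mul_smul, ← mul_smul z]
    exact hx a _ (F.mul_mem hz hq)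
  | succ m ih =>
    refine lowering_induction (N := (lowering ι y F (m + 1) ⊔ killer F w).comap
      (LinearMap.mulLeft ℂ (x a))) (fun b z hz => ?_) hz
    change x a * (ι (y b) * z) ∈ lowering ι y F (m + 1) ⊔ killer F w
    rw [← mul_assoc, C.xy, add_mul, mul_assoc]
    refine add_mem ?_ (Submodule.mem_sup_left (C.h_mul_mem_lowering hF _ hz))
    obtain ⟨z1, hz1, z2, hz2, h12⟩ := Submodule.mem_sup.1 (ih hz)
    rw [← h12, mul_add]
    exact Submodule.add_mem_sup (y_mul_mem_lowering b hz1) (mul_mem_killer _ hz2)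

theorem x_pow_mul_mem (C : CurrentSl2 ι x y h) (hF : ∀ c, h c ∈ F)
    (hx : ∀ a, ∀ q ∈ F, x a • q • w = 0) {m : ℕ} {z : R}
    (hz : z ∈ lowering ι y F m) : x 1 ^ m * z ∈ lowering ι y F 0 ⊔ killer F w := by
  induction m generalizing z with
  | zero => rw [pow_zero, one_mul]; exact Submodule.mem_sup_left hz
  | succ m ih =>
    obtain ⟨z1, hz1, z2, hz2, h12⟩ := Submodule.mem_sup.1 (C.x_mul_mem hF hx 1 hz)
    rw [pow_succ, mul_assoc, ← h12, mul_add]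
    exact add_mem (ih hz1) (Submodule.mem_sup_right (mul_mem_killer _ hz2))

theorem yProd_mem_lowering (m : ℕ) (a : Fin m → A) : ι (yProd y m a) ∈ lowering ι y F m := by
  induction m with
  | zero => rw [yProd_apply, Fin.prod_univ_zero, map_one]; exact F.one_mem
  | succ m ih =>
    rw [yProd_apply, Fin.prod_univ_succ, map_mul]
    refine y_mul_mem_lowering _ ?_
    rw [← yProd_apply m fun j => a j.succ]
    exact ih _

/-- The m raising operators cancel the m lowering operators and leave an element p of F. The same p
serves for all q, which later allows an h(c) to be moved across the whole expression. -/
theorem exists_x_pow_yProd (C : CurrentSl2 ι x y h) (hF : ∀ c, h c ∈ F)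
    (hx : ∀ a, ∀ q ∈ F, x a • q • w = 0) {m : ℕ} (a : Fin m → A) :
    ∃ p ∈ F, ∀ q ∈ F, x 1 ^ m • ι (yProd y m a) • q • w = p • q • w := by
  obtain ⟨p, hp, z, hz, h12⟩ := Submodule.mem_sup.1
    (C.x_pow_mul_mem hF hx (yProd_mem_lowering m a))
  refine ⟨p, hp, fun q hq => ?_⟩
  rw [← mul_smul, ← h12, add_smul, hz q hq, add_zero]

/-- Lowering operators of degree `n + 1` kill the vectors of weight `n`. -/
theorem yProd_smul_eq_zero (C : CurrentSl2 ι x y h) (hF : ∀ c, h c ∈ F) {n : ℕ}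
    (hy : ∀ q ∈ F, ι (y 1) ^ (n + 1) • q • w = 0) (a : Fin (n + 1) → A) {q : R} (hq : q ∈ F) :
    ι (yProd y (n + 1) a) • q • w = 0 := by
  -- Recording the action on q w for all q in F at once makes the kernel stable: h(c) sends q w to
  -- another vector of this form.
  let act : S →ₗ[ℂ] F → V := LinearMap.pi fun q =>
    (LinearMap.toSpanSingleton R V ((q : R) • w)).restrictScalars ℂ ∘ₗ ι.toLinearMap
  have act_apply : ∀ s q, act s q = ι s • (q : R) • w := fun s q => rfl
  have hlift : ∀ t, PiTensorProduct.lift (act.compMultilinearMap (yProd y (n + 1))) t =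
      act (PiTensorProduct.lift (yProd y (n + 1)) t) := fun t => by
    have h1 : PiTensorProduct.lift (act.compMultilinearMap (yProd y (n + 1))) =
        act ∘ₗ PiTensorProduct.lift (yProd y (n + 1)) := by
      ext a
      simp
    rw [h1, LinearMap.comp_apply]
  have key : act.compMultilinearMap (yProd y (n + 1)) = 0 := by
    refine multilinear_eq_zero_of_symm _ (fun σ a => ?_) ?_ fun c t ht => ?_
    · rw [LinearMap.compMultilinearMap_apply, LinearMap.compMultilinearMap_apply, yProd_apply,
        yProd_apply]
      exact congrArg act (Equiv.prod_comp σ fun j => y (a j))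
    · funext q
      rw [LinearMap.compMultilinearMap_apply, act_apply, yProd_apply]
      simpa using hy q q.2
    · rw [hlift] at ht ⊢
      funext q
      have h1 := congrFun ht q
      have h2 := congrFun ht ⟨_, F.mul_mem (hF c) q.2⟩
      rw [act_apply] at h1 h2 ⊢
      -- The terms with h(c) on the left and with h(c) q on the right both vanish, which leaves -2
      -- times the term for (∑ 1 ⊗ ⋯ ⊗ c ⊗ ⋯ ⊗ 1) t.
      have h3 := congrArg (fun z : R => z • (q : R) • w) (C.h_mul_lift_yProd c _ t)
      simp only [mul_smul, sub_smul] at h3 h2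
      rw [h1, h2, Pi.zero_apply, Pi.zero_apply, smul_zero, zero_sub, zero_eq_neg, smul_assoc,
        ← Nat.cast_smul_eq_nsmul ℂ] at h3
      exact (smul_eq_zero.1 h3).resolve_left (by norm_num)
  exact congrFun (congrFun (congrArg DFunLike.coe key) a) ⟨q, hq⟩

/-- Write T = y(a_1) ⋯ y(a_n), let Z be the sum of the products with one a_k replaced by c a_k, and
B = n x(1)^(n-1) x(c). Commuting h(c) past x(1)^n and T and comparing gives B T w = x(1)^n Z w.
Since n + 1 lowering operators kill w, expanding x(1)^(n+1) y(c) T w = 0 gives x(1)^n h(c) T w = -B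
T w, hence h(c) x(1)^n T w = B T w. -/
theorem h_smul_x_pow_yProd (C : CurrentSl2 ι x y h) (hF : ∀ c, h c ∈ F)
    (hcomm : ∀ p ∈ F, ∀ q ∈ F, p * q = q * p) (hx : ∀ a, ∀ q ∈ F, x a • q • w = 0) {n : ℕ}
    (hy : ∀ q ∈ F, ι (y 1) ^ (n + 1) • q • w = 0) (c : A) (a : Fin n → A) :
    h c • x 1 ^ n • ι (yProd y n a) • w =
      ∑ k, x 1 ^ n • ι (yProd y n (Function.update a k (c * a k))) • w := by
  obtain ⟨p, hp, hpq⟩ := C.exists_x_pow_yProd hF hx a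
  have hp1 := hpq 1 F.one_mem
  rw [one_smul] at hp1
  set T := ι (yProd y n a) with hT
  set Z := ∑ k, ι (yProd y n (Function.update a k (c * a k))) with hZ
  have e1 : h c * T = T * h c - 2 • Z := by
    rw [hT, hZ, yProd_apply, C.h_mul_prod]
    simp only [yProd_apply]
  -- Both sides equal p h(c) w, with the same p in the commutative algebra F.
  have e2 : x 1 ^ n • T • h c • w = h c • x 1 ^ n • T • w := by
    have := hpq _ (hF c)
    rw [this, hp1, ← mul_smul, ← mul_smul, hcomm _ hp _ (hF c)]
  set B := n • (x 1 ^ (n - 1) * x c) with hB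
  have e3 : h c • x 1 ^ n • T • w = x 1 ^ n • h c • T • w + 2 • B • T • w := by
    rw [← mul_smul (h c), C.h_mul_x_pow, add_smul, mul_smul, smul_assoc 2]
  have e4 : x 1 ^ n • h c • T • w = h c • x 1 ^ n • T • w - 2 • x 1 ^ n • Z • w := by
    rw [← mul_smul (h c) T, e1, sub_smul, smul_sub, mul_smul, e2, smul_assoc 2,
      smul_comm _ 2]
  have e5 : x 1 ^ (n + 1) • T • w = 0 := by
    rw [pow_succ', mul_smul, hp1, hx 1 p hp]
  have e6 : x 1 ^ (n + 1) • ι (y c) • T • w = 0 := by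
    have h1 := C.yProd_smul_eq_zero hF hy (Fin.cons c a) F.one_mem
    rw [one_smul, yProd_apply, Fin.prod_univ_succ, map_mul, mul_smul] at h1
    simp only [Fin.cons_zero, Fin.cons_succ] at h1
    rw [← yProd_apply, ← hT] at h1
    rw [h1, smul_zero]
  have e7 : x 1 ^ n • h c • T • w + B • T • w = 0 := by
    rw [← mul_smul _ (ι (y c)), C.x_pow_mul_y, add_smul, mul_smul, e5, smul_zero, zero_add,
      smul_assoc, ← Nat.cast_smul_eq_nsmul ℂ, add_smul, mul_smul] at e6
    exact (smul_eq_zero.1 e6).resolve_left (by exact_mod_cast Nat.succ_ne_zero n)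
  rw [← Finset.smul_sum, ← Finset.sum_smul, ← hZ]
  have e8 : h c • x 1 ^ n • T • w = B • T • w := by
    rw [e3, two_nsmul, ← add_assoc, e7, zero_add]
  have e9 : (2 : ℕ) • (B • T • w) = (2 : ℕ) • (x 1 ^ n • Z • w) := by
    rw [eq_sub_iff_add_eq, e3, add_left_cancel_iff] at e4
    exact e4.symm
  rw [e8]
  rw [← sub_eq_zero, ← smul_sub, ← Nat.cast_smul_eq_nsmul ℂ] at e9
  exact sub_eq_zero.1 ((smul_eq_zero.1 e9).resolve_left (by norm_num))

theorem h_eq_commutator (C : CurrentSl2 ι x y h) : x 1 * ι (y 1) - ι (y 1) * x 1 = h 1 := by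
  rw [C.xy, mul_one, add_sub_cancel_left]

theorem commutator_h_y (C : CurrentSl2 ι x y h) :
    h 1 * ι (y 1) - ι (y 1) * h 1 = -(2 • ι (y 1)) := by
  rw [C.hy, mul_one, sub_sub_cancel_left]

/-- The elements `x ^ n y a_1 ⋯ y a_n w` as a multilinear map to `F w`. -/
theorem exists_multilinear (C : CurrentSl2 ι x y h) (hF : ∀ c, h c ∈ F)
    (hcomm : ∀ p ∈ F, ∀ q ∈ F, p * q = q * p) (hx : ∀ a, ∀ q ∈ F, x a • q • w = 0) {n : ℕ}
    (hn : h 1 • w = n • w) (hy : ∀ q ∈ F, ι (y 1) ^ (n + 1) • q • w = 0) :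
    ∃ Θ : MultilinearMap ℂ (fun _ : Fin n => A) V, (∀ a, ∃ p ∈ F, Θ a = p • w) ∧
      (∀ c a, h c • Θ a = ∑ k, Θ (Function.update a k (c * a k))) ∧
      ∃ k : ℂ, k ≠ 0 ∧ Θ 1 = k • w := by
  let act : S →ₗ[ℂ] V := ((LinearMap.toSpanSingleton R V w).restrictScalars ℂ) ∘ₗ
    LinearMap.mulLeft ℂ (x 1 ^ n) ∘ₗ ι.toLinearMap
  have hΘ : ∀ a, act.compMultilinearMap (yProd y n) a = x 1 ^ n • ι (yProd y n a) • w := fun a => by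
    rw [← mul_smul]; rfl
  refine ⟨act.compMultilinearMap (yProd y n), fun a => ?_, fun c a => ?_, ?_⟩
  · obtain ⟨p, hp, hpq⟩ := C.exists_x_pow_yProd hF hx a
    have hp1 := hpq 1 F.one_mem
    rw [one_smul] at hp1
    exact ⟨p, hp, (hΘ a).trans hp1⟩
  · simp only [hΘ]
    exact C.h_smul_x_pow_yProd hF hcomm hx hy c a
  · have h1 := hx 1 1 F.one_mem
    rw [one_smul] at h1
    obtain ⟨k, hk, hkw⟩ := exists_pow_smul_pow_smul_of_sl2 C.h_eq_commutator C.commutator_h_y h1 hn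
    refine ⟨k, hk, ?_⟩
    rw [hΘ, yProd_apply, ← hkw]
    simp

end Straightening

end CurrentSl2

end GlobalWeyl
end

/-! ### Relations satisfied by the generator of the Weyl module -/

open scoped TensorProduct

noncomputable section

namespace GlobalWeyl

attribute [local instance] LieRing.ofAssociativeRing

open LieAlgebra

section Enveloping

theorem mapU_ι {L L' : Type*} [LieRing L] [LieAlgebra ℂ L] [LieRing L'] [LieAlgebra ℂ L']
    (f : L →ₗ⁅ℂ⁆ L') (x : L) :
    mapU f (UniversalEnvelopingAlgebra.ι ℂ x) = UniversalEnvelopingAlgebra.ι ℂ (f x) :=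
  UniversalEnvelopingAlgebra.lift_ι_apply ℂ _ x

theorem ι_tmul_mul_ι_tmul {g : Type*} [LieRing g] [LieAlgebra ℂ g] {A : Type*} [CommRing A]
    [Algebra ℂ A] (a b : A) (x y : g) :
    (UniversalEnvelopingAlgebra.ι ℂ (a ⊗ₜ[ℂ] x) * UniversalEnvelopingAlgebra.ι ℂ (b ⊗ₜ[ℂ] y) :
      U (A ⊗[ℂ] g)) =
    UniversalEnvelopingAlgebra.ι ℂ (b ⊗ₜ[ℂ] y) * UniversalEnvelopingAlgebra.ι ℂ (a ⊗ₜ[ℂ] x) +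
      UniversalEnvelopingAlgebra.ι ℂ ((a * b) ⊗ₜ[ℂ] ⁅x, y⁆) := by
  have h1 := LieHom.map_lie (UniversalEnvelopingAlgebra.ι ℂ) (a ⊗ₜ[ℂ] x) (b ⊗ₜ[ℂ] y)
  rw [LieRing.of_associative_ring_bracket] at h1
  have h2 := congrArg (UniversalEnvelopingAlgebra.ι ℂ)
    (ExtendScalars.bracket_tmul .. : ⁅a ⊗ₜ[ℂ] x, b ⊗ₜ[ℂ] y⁆ = (a * b) ⊗ₜ[ℂ] ⁅x, y⁆)
  rw [← sub_eq_iff_eq_add', ← h1]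
  exact h2

end Enveloping

variable {g : Type*} [LieRing g] [LieAlgebra ℂ g] [FiniteDimensional ℂ g]
  [LieAlgebra.IsSimple ℂ g] {H : LieSubalgebra ℂ g} [H.IsCartanSubalgebra]
  (b : (LieAlgebra.IsKilling.rootSystem H).Base) (r : b.support → ℕ)
  (A : Type*) [CommRing A] [Algebra ℂ A]

/-- The generator of `P_A(V(λ))`. -/
def inducedGen : InducedModule g A (SimpleModule b r) :=
  Submodule.Quotient.mk ((1 : U (A ⊗[ℂ] g)) ⊗ₜ[ℂ] (Submodule.Quotient.mk 1 : SimpleModule b r))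

theorem mapU_smul_inducedGen (y : U g) : mapU (constIncl A g) y • inducedGen b r A =
    Submodule.Quotient.mk ((1 : U (A ⊗[ℂ] g)) ⊗ₜ[ℂ] (Submodule.Quotient.mk y : SimpleModule b r)) := by
  refine (Submodule.Quotient.eq _).2 (Submodule.subset_span ⟨1, y, Submodule.Quotient.mk 1, ?_⟩)
  have h1 : (y • Submodule.Quotient.mk 1 : SimpleModule b r) = Submodule.Quotient.mk y := by
    rw [← Submodule.Quotient.mk_smul, smul_eq_mul, mul_one]
  beta_reduce
  rw [h1, TensorProduct.smul_tmul', smul_eq_mul, mul_one, one_mul]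

theorem mapU_smul_inducedGen_eq_zero {y : U g} (hy : y ∈ simpleRel b r) :
    mapU (constIncl A g) y • inducedGen b r A = 0 := by
  rw [mapU_smul_inducedGen, (Submodule.Quotient.mk_eq_zero (simpleRel b r)).2 hy,
    TensorProduct.tmul_zero, Submodule.Quotient.mk_zero]

theorem constIncl_smul_inducedGen (h : H) :
    (UniversalEnvelopingAlgebra.ι ℂ (constIncl A g h) : U (A ⊗[ℂ] g)) • inducedGen b r A =
      domWeight b r h • inducedGen b r A := by
  have h1 := mapU_smul_inducedGen_eq_zero b r A
    (Submodule.subset_span (Or.inl (Or.inr ⟨h, rfl⟩)))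
  rw [map_sub, mapU_ι, AlgHom.commutes, sub_smul, sub_eq_zero, algebraMap_smul] at h1
  exact h1

theorem pow_smul_inducedGen {i : b.support} {x : g}
    (hx : x ∈ rootSpace H (-(simpleRoot b i : H → ℂ))) :
    (UniversalEnvelopingAlgebra.ι ℂ (constIncl A g x) ^ (r i + 1) : U (A ⊗[ℂ] g)) •
      inducedGen b r A = 0 := by
  have h1 := mapU_smul_inducedGen_eq_zero b r A
    (Submodule.subset_span (Or.inr ⟨i, x, hx, rfl⟩))
  rwa [map_pow, mapU_ι] at h1

theorem neg_simpleRoot_notMem_Qplus (i : b.support) : -simpleRoot b i ∉ Qplus b := by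
  intro h
  obtain ⟨s, hs⟩ := exists_grading b
  obtain ⟨n, hn, -⟩ := Qplus_apply_grading b hs h
  rw [LinearMap.neg_apply, hs] at hn
  have : ((n + 1 : ℕ) : ℂ) = 0 := by push_cast; rw [← hn]; ring
  exact Nat.succ_ne_zero n (by exact_mod_cast this)

/-- Before truncation the vector has weight λ + α_i, which is not ≤ λ, so the truncation kills it.
-/
theorem smul_weylGen_eq_zero {i : b.support} (a : A) {x : g}
    (hx : x ∈ rootSpace H (simpleRoot b i)) :
    (UniversalEnvelopingAlgebra.ι ℂ (a ⊗ₜ[ℂ] x) : U (A ⊗[ℂ] g)) • weylGen b r A = 0 := by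
  have h1 : (UniversalEnvelopingAlgebra.ι ℂ (a ⊗ₜ[ℂ] x) : U (A ⊗[ℂ] g)) • inducedGen b r A ∈
      truncation b A (domWeight b r) (InducedModule g A (SimpleModule b r)) := by
    refine Submodule.subset_span ⟨domWeight b r + simpleRoot b i, ?_, fun h => ?_⟩
    · rw [sub_add_cancel_left]
      exact neg_simpleRoot_notMem_Qplus b i
    · have h2 := ι_tmul_mul_ι_tmul (1 : A) a (h : g) x
      rw [lie_of_mem_rootSpace hx, one_mul, TensorProduct.tmul_smul, map_smul] at h2
      have h3 : (UniversalEnvelopingAlgebra.ι ℂ (constIncl A g h) : U (A ⊗[ℂ] g)) =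
        UniversalEnvelopingAlgebra.ι ℂ ((1 : A) ⊗ₜ[ℂ] (h : g)) := rfl
      rw [← mul_smul, h3, h2, add_smul, mul_smul, ← h3, constIncl_smul_inducedGen, smul_assoc,
        LinearMap.add_apply, add_smul, smul_algebra_smul_comm]
  exact (Submodule.Quotient.mk_eq_zero _).2 h1

theorem constIncl_smul_weylGen (h : H) :
    (UniversalEnvelopingAlgebra.ι ℂ (constIncl A g h) : U (A ⊗[ℂ] g)) • weylGen b r A =
      domWeight b r h • weylGen b r A :=
  congrArg (Submodule.Quotient.mk (p := truncation b A (domWeight b r)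
    (InducedModule g A (SimpleModule b r)))) (constIncl_smul_inducedGen b r A h)

theorem pow_smul_weylGen {i : b.support} {x : g}
    (hx : x ∈ rootSpace H (-(simpleRoot b i : H → ℂ))) :
    (UniversalEnvelopingAlgebra.ι ℂ (constIncl A g x) ^ (r i + 1) : U (A ⊗[ℂ] g)) •
      weylGen b r A = 0 :=
  congrArg (Submodule.Quotient.mk (p := truncation b A (domWeight b r)
    (InducedModule g A (SimpleModule b r)))) (pow_smul_inducedGen b r A hx)

variable {A}

/-- A property of the vectors of an `A ⊗ g`-module that is preserved by sums, scalars and the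
elements of `A ⊗ H` is preserved by `U(A ⊗ H)`. -/
theorem mapU_subIncl_induction {V : Type*} [AddCommGroup V] [Module ℂ V]
    [Module (U (A ⊗[ℂ] g)) V] [IsScalarTower ℂ (U (A ⊗[ℂ] g)) V] (N : Submodule ℂ V)
    (hN : ∀ (a : A) (h : H), ∀ m ∈ N,
      (UniversalEnvelopingAlgebra.ι ℂ (a ⊗ₜ[ℂ] (h : g)) : U (A ⊗[ℂ] g)) • m ∈ N)
    (u : U (A ⊗[ℂ] H)) {m : V} (hm : m ∈ N) : mapU (subIncl A H) u • m ∈ N := by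
  have hu : u ∈ Algebra.adjoin ℂ (Set.range (UniversalEnvelopingAlgebra.ι ℂ :
    A ⊗[ℂ] H → U (A ⊗[ℂ] H))) := adjoin_range_ι (A ⊗[ℂ] H) ▸ trivial
  induction hu using Algebra.adjoin_induction generalizing m with
  | mem u hu =>
    obtain ⟨y, rfl⟩ := hu
    rw [mapU_ι]
    induction y with
    | zero => rw [map_zero, map_zero, zero_smul]; exact zero_mem N
    | add y z hy hz => rw [map_add, map_add, add_smul]; exact add_mem hy hz
    | tmul a h => exact hN a h m hm
  | algebraMap k =>
    rw [AlgHom.commutes, algebraMap_smul]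
    exact N.smul_mem k hm
  | add u v _ _ hu hv => rw [map_add, add_smul]; exact add_mem (hu hm) (hv hm)
  | mul u v _ _ hu hv => rw [map_mul, mul_smul]; exact hu (hv hm)

theorem smul_mapU_weylGen_eq_zero {i : b.support} {x : g} (hx : x ∈ rootSpace H (simpleRoot b i))
    (u : U (A ⊗[ℂ] H)) (a : A) : (UniversalEnvelopingAlgebra.ι ℂ (a ⊗ₜ[ℂ] x) : U (A ⊗[ℂ] g)) •
      mapU (subIncl A H) u • weylGen b r A = 0 := by
  let N : Submodule ℂ (WeylModule b r A) :=
    { carrier := {m | ∀ a : A, (UniversalEnvelopingAlgebra.ι ℂ (a ⊗ₜ[ℂ] x) : U (A ⊗[ℂ] g)) • m = 0}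
      zero_mem' := fun a => smul_zero _
      add_mem' := fun {m m'} hm hm' a => by rw [smul_add, hm a, hm' a, add_zero]
      smul_mem' := fun k m hm a => by rw [smul_algebra_smul_comm, hm a, smul_zero] }
  refine mapU_subIncl_induction N (fun c h m hm a => ?_) u (m := weylGen b r A)
    (fun a => smul_weylGen_eq_zero b r A a hx) a
  have h2 := ι_tmul_mul_ι_tmul c a (h : g) x
  rw [lie_of_mem_rootSpace hx, TensorProduct.tmul_smul, map_smul, ← sub_eq_iff_eq_add] at h2
  rw [← mul_smul, ← h2, sub_smul, mul_smul, hm a, smul_zero, smul_assoc, hm, smul_zero, sub_zero]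

/-- Nilpotency of y(1) survives the action of A ⊗ H: commuting y(1)^(k+1) past c ⊗ h leaves a
multiple of y(c) y(1)^k, so the exponent grows by at most one. The sharp exponent is recovered later
from sl₂ theory. -/
theorem exists_pow_smul_mapU_weylGen {i : b.support} {x : g}
    (hx : x ∈ rootSpace H (-(simpleRoot b i : H → ℂ))) (u : U (A ⊗[ℂ] H)) :
    ∃ n, (UniversalEnvelopingAlgebra.ι ℂ ((1 : A) ⊗ₜ[ℂ] x) ^ n : U (A ⊗[ℂ] g)) •
      mapU (subIncl A H) u • weylGen b r A = 0 := by
  set y : A → U (A ⊗[ℂ] g) := fun a => UniversalEnvelopingAlgebra.ι ℂ (a ⊗ₜ[ℂ] x) with hy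
  have hle : ∀ {m : WeylModule b r A} {k n : ℕ}, k ≤ n → y 1 ^ k • m = 0 → y 1 ^ n • m = 0 := by
    intro m k n hkn hk
    obtain ⟨d, rfl⟩ := Nat.exists_eq_add_of_le' hkn
    rw [pow_add, mul_smul, hk, smul_zero]
  let N : Submodule ℂ (WeylModule b r A) :=
    { carrier := {m | ∃ n, y 1 ^ n • m = 0}
      zero_mem' := ⟨0, smul_zero _⟩
      add_mem' := by
        rintro m m' ⟨k, hk⟩ ⟨l, hl⟩
        exact ⟨max k l, by rw [smul_add, hle (le_max_left k l) hk, hle (le_max_right k l) hl,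
          add_zero]⟩
      smul_mem' := by
        rintro k m ⟨n, hn⟩
        exact ⟨n, by rw [smul_algebra_smul_comm, hn, smul_zero]⟩ }
  refine mapU_subIncl_induction N (fun c h m hm => ?_) u (m := weylGen b r A)
    ⟨r i + 1, pow_smul_weylGen b r A hx⟩
  obtain ⟨n, hn⟩ := hm
  set z : U (A ⊗[ℂ] g) := UniversalEnvelopingAlgebra.ι ℂ (c ⊗ₜ[ℂ] (h : g)) with hz
  have hyy : ∀ a, y a * y 1 = y 1 * y a := by
    intro a
    have := ι_tmul_mul_ι_tmul a 1 x x
    rwa [lie_self, TensorProduct.tmul_zero, map_zero, add_zero] at this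
  have hzy : y 1 * z = z * y 1 + simpleRoot b i h • y c := by
    have h2 := ι_tmul_mul_ι_tmul c 1 (h : g) x
    rw [lie_of_mem_rootSpace hx, TensorProduct.tmul_smul, map_smul, mul_one, Pi.neg_apply,
      neg_smul, ← sub_eq_add_neg, eq_sub_iff_add_eq] at h2
    exact h2.symm
  have key : ∀ k : ℕ, y 1 ^ (k + 1) * z = z * y 1 ^ (k + 1) +
      ((k + 1 : ℕ) : ℂ) • simpleRoot b i h • (y c * y 1 ^ k) := by
    intro k
    induction k with
    | zero => simp [hzy]
    | succ k ih =>
      rw [pow_succ', mul_assoc, ih, mul_add, ← mul_assoc, hzy, add_mul, mul_assoc z, ← pow_succ',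
        mul_smul_comm, mul_smul_comm, ← mul_assoc, ← hyy, mul_assoc, ← pow_succ', smul_mul_assoc]
      push_cast
      module
  refine ⟨n + 1, ?_⟩
  rw [← mul_smul, key, add_smul, mul_smul, hle (Nat.le_succ n) hn, smul_zero, smul_assoc,
    smul_assoc, mul_smul, hn, smul_zero, smul_zero, smul_zero, add_zero]

end GlobalWeyl
end

/-! ### The map P and the lower bound for the annihilator -/

open scoped TensorProduct

noncomputable section

namespace GlobalWeyl

attribute [local instance] LieRing.ofAssociativeRing

open LieAlgebra

/-- Realising the operators y(a) in a commutative algebra makes their products over finite index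
sets available and visibly symmetric. -/
theorem exists_comm_factor.{u, v} {A : Type u} {R : Type v} [CommRing A] [Algebra ℂ A] [Ring R] [Algebra ℂ R]
    (y : A →ₗ[ℂ] R) (hy : ∀ a b, y a * y b = y b * y a) :
    ∃ (S : Type v) (_ : CommRing S) (_ : Algebra ℂ S) (ι : S →ₐ[ℂ] R) (y' : A →ₗ[ℂ] S),
      ∀ a, ι (y' a) = y a := by
  let S := Algebra.adjoin ℂ (Set.range y)
  have hS : IsMulCommutative S := Algebra.isMulCommutative_adjoin ℂ (by
    rintro _ ⟨a, rfl⟩ _ ⟨b, rfl⟩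
    exact hy a b)
  let inst : CommRing S := { (inferInstance : Ring S) with mul_comm := hS.is_comm.comm }
  exact ⟨S, inst, Subalgebra.algebra S, S.val,
    y.codRestrict (Subalgebra.toSubmodule S) fun a => Algebra.subset_adjoin ⟨a, rfl⟩,
    fun a => rfl⟩

section Blocks

variable {I : Type*} [Fintype I] (r : I → ℕ) {A B : Type*} [CommRing A] [Algebra ℂ A]
  [CommRing B] [Algebra ℂ B]

/-- P is the product of the block maps. As B is commutative, η_i(c) can be applied to the i-th
factor alone, where it acts as multiplication by sym^i(c). -/
theorem exists_lift_of_blocks (η : I → A → B)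
    (p : ∀ i, MultilinearMap ℂ (fun _ : Fin (r i) => A) B)
    (hp : ∀ i c a, η i c * p i a = ∑ k, p i (Function.update a k (c * a k))) {k : I → ℂ}
    (hk : ∀ i, k i ≠ 0) (hp1 : ∀ i, p i 1 = algebraMap ℂ B (k i)) :
    ∃ P : TensorPow r A →ₗ[ℂ] B, (∀ i c t, η i c * P t = P (symElt r i c * t)) ∧
      ∃ k : ℂ, k ≠ 0 ∧ P 1 = algebraMap ℂ B k := by
  classical
  let Q : MultilinearMap ℂ (fun _ : Pos r => A) (B) :=
    (MultilinearMap.mkPiAlgebra ℂ I (B)).compMultilinearMap p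
  have hQ : ∀ a, Q a = ∏ i, p i fun k => a ⟨i, k⟩ := fun a =>
    MultilinearMap.mkPiAlgebra_apply (R := ℂ) (A := B) _
  refine ⟨PiTensorProduct.lift Q, fun i c t => ?_, ∏ i, k i,
    Finset.prod_ne_zero_iff.2 fun i _ => hk i, ?_⟩
  · induction t using PiTensorProduct.induction_on with
    | smul_tprod z a =>
      rw [mul_smul_comm, map_smul, map_smul, mul_smul_comm, PiTensorProduct.lift.tprod, symElt_eq,
        Finset.sum_mul, map_sum, hQ, ← Finset.mul_prod_erase _ _ (Finset.mem_univ i), ← mul_assoc,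
        hp, Finset.sum_mul]
      refine congrArg _ (Finset.sum_congr rfl fun l _ => ?_)
      rw [single_eq_posHom, posHom_mul_tprod, PiTensorProduct.lift.tprod, hQ,
        ← Finset.mul_prod_erase _ _ (Finset.mem_univ i)]
      congr 1
      · congr 1
        funext m
        by_cases hm : m = l
        · subst hm; simp
        · rw [Function.update_of_ne hm, Function.update_of_ne (by simpa using hm)]
      · refine Finset.prod_congr rfl fun j hj => congrArg _ (funext fun m => ?_)
        rw [Function.update_of_ne]
        intro h
        exact Finset.ne_of_mem_erase hj (congrArg Sigma.fst h)
    | add t u ht hu => rw [map_add, mul_add, ht, hu, mul_add, map_add]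
  · refine (PiTensorProduct.lift.tprod _).trans ((hQ _).trans ?_)
    rw [map_prod]
    exact Finset.prod_congr rfl fun i _ => hp1 i

end Blocks

variable {g : Type*} [LieRing g] [LieAlgebra ℂ g] [FiniteDimensional ℂ g]
  [LieAlgebra.IsSimple ℂ g] {H : LieSubalgebra ℂ g} [H.IsCartanSubalgebra]
  (b : (LieAlgebra.IsKilling.rootSystem H).Base) (r : b.support → ℕ)
  {A : Type*} [CommRing A] [Algebra ℂ A]

/-- The linear map `a ↦ a ⊗ x` from `A` to `U(A ⊗ g)`. -/
def curLin {g : Type*} [LieRing g] [LieAlgebra ℂ g] (x : g) : A →ₗ[ℂ] U (A ⊗[ℂ] g) :=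
  (UniversalEnvelopingAlgebra.ι ℂ : A ⊗[ℂ] g →ₗ⁅ℂ⁆ U (A ⊗[ℂ] g)).toLinearMap ∘ₗ
    (TensorProduct.mk ℂ A g).flip x

theorem curLin_apply {g : Type*} [LieRing g] [LieAlgebra ℂ g] (x : g) (a : A) :
    curLin x a = (UniversalEnvelopingAlgebra.ι ℂ (a ⊗ₜ[ℂ] x) : U (A ⊗[ℂ] g)) := rfl

theorem curLin_mul {g : Type*} [LieRing g] [LieAlgebra ℂ g] (x y : g) (a c : A) :
    curLin x a * curLin y c = curLin y c * curLin x a + curLin ⁅x, y⁆ (a * c) :=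
  ι_tmul_mul_ι_tmul a c x y

/-- The sl₂ computation is applied to the triple of α_i, with F the image of U(A ⊗ H). -/
theorem exists_block_multilinear (i : b.support) :
    ∃ Θ : MultilinearMap ℂ (fun _ : Fin (r i) => A) (WeylModule b r A),
      (∀ a, ∃ u, Θ a = mapU (subIncl A H) u • weylGen b r A) ∧
      (∀ c a, curLin (simpleCoroot b i : g) c • Θ a =
        ∑ k, Θ (Function.update a k (c * a k))) ∧
      ∃ k : ℂ, k ≠ 0 ∧ Θ 1 = k • weylGen b r A := by
  obtain ⟨e, f, he, hf, R, -⟩ := exists_chevalley b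
  obtain ⟨S, _, _, ι, y, hy⟩ := exists_comm_factor (curLin (A := A) (f i)) fun a c => by
    rw [curLin_mul, lie_self, mul_comm a c]
    simp [curLin_apply]
  have C : CurrentSl2 ι (curLin (A := A) (e i)) y (curLin (simpleCoroot b i : g)) := by
    refine ⟨fun a c => ?_, fun a c => ?_, fun a c => ?_, fun a c => ?_⟩
    · rw [curLin_mul, lie_self]
      simp [curLin_apply]
    · rw [hy, curLin_mul, R.lie_e_f]
      rfl
    · have := R.lie_h_e (simpleCoroot b i) i
      rw [simpleRoot_coroot_self] at this
      rw [curLin_mul, ← ofNat_smul_eq_nsmul ℂ 2]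
      refine congrArg _ ((congrArg (fun z => curLin z (a * c)) this).trans ?_)
      rw [curLin_apply, TensorProduct.tmul_smul, map_smul, curLin_apply]
    · have := R.lie_h_f (simpleCoroot b i) i
      rw [simpleRoot_coroot_self] at this
      rw [hy, hy, curLin_mul, ← ofNat_smul_eq_nsmul ℂ 2, sub_eq_add_neg]
      refine congrArg _ ((congrArg (fun z => curLin z (a * c)) this).trans ?_)
      rw [curLin_apply, TensorProduct.tmul_neg, TensorProduct.tmul_smul, map_neg, map_smul,
        curLin_apply]
  let F : Subalgebra ℂ (U (A ⊗[ℂ] g)) := (mapU (subIncl A H)).range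
  have hF : ∀ c, curLin (simpleCoroot b i : g) c ∈ F := fun c =>
    ⟨UniversalEnvelopingAlgebra.ι ℂ (c ⊗ₜ[ℂ] simpleCoroot b i), mapU_ι (subIncl A H) _⟩
  have hcomm : ∀ p ∈ F, ∀ q ∈ F, p * q = q * p := by
    rintro _ ⟨u, rfl⟩ _ ⟨v, rfl⟩
    exact ((map_mul (mapU (subIncl A H)) u v).symm.trans
      (congrArg _ (mul_comm u v))).trans (map_mul (mapU (subIncl A H)) v u)
  have hx : ∀ a : A, ∀ q ∈ F, curLin (e i) a • q • weylGen b r A = 0 := by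
    rintro a _ ⟨u, rfl⟩
    exact smul_mapU_weylGen_eq_zero b r (he i) u a
  have hn : curLin (simpleCoroot b i : g) (1 : A) • weylGen b r A = r i • weylGen b r A := by
    refine (constIncl_smul_weylGen b r A (simpleCoroot b i)).trans ?_
    rw [domWeight_coroot, Nat.cast_smul_eq_nsmul]
  -- Each q w_λ is again a highest weight vector of weight r_i for the constant sl₂, so nilpotency
  -- of unspecified order yields the exponent r_i + 1.
  have hyF : ∀ q ∈ F, ι (y 1) ^ (r i + 1) • q • weylGen b r A = 0 := by
    intro q hq
    have h1 : curLin (simpleCoroot b i : g) (1 : A) • q • weylGen b r A =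
        r i • q • weylGen b r A := by
      rw [← mul_smul, hcomm _ (hF 1) _ hq, mul_smul, hn, smul_comm]
    refine pow_smul_eq_zero_of_sl2 C.h_eq_commutator C.commutator_h_y (hx 1 q hq) h1 ?_
    obtain ⟨u, rfl⟩ := hq
    rw [hy]
    exact exists_pow_smul_mapU_weylGen b r (hf i) u
  obtain ⟨Θ, h1, h2, h3⟩ := C.exists_multilinear hF hcomm hx hn hyF
  refine ⟨Θ, fun a => ?_, h2, h3⟩
  obtain ⟨_, ⟨u, rfl⟩, hu⟩ := h1 a
  exact ⟨u, hu⟩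

/-- The injection `𝐀_λ → W_A(λ)`, `[u] ↦ u w_λ`. -/
theorem exists_genMap : ∃ κ : BoldA b r A →ₗ[ℂ] WeylModule b r A, Function.Injective κ ∧
    ∀ u, κ (Ideal.Quotient.mk (annIdeal b r A) u) = mapU (subIncl A H) u • weylGen b r A := by
  let _ : Module (U (A ⊗[ℂ] H)) (WeylModule b r A) :=
    Module.compHom _ (mapU (subIncl A H)).toRingHom
  have hU : ∀ (u : U (A ⊗[ℂ] H)) (m : WeylModule b r A), u • m = mapU (subIncl A H) u • m :=
    fun _ _ => rfl
  let κ : BoldA b r A →ₗ[U (A ⊗[ℂ] H)] WeylModule b r A := Submodule.liftQ (annIdeal b r A)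
    (LinearMap.toSpanSingleton _ _ (weylGen b r A)) fun u hu => hu
  have hκ : ∀ u, κ (Ideal.Quotient.mk (annIdeal b r A) u) =
    mapU (subIncl A H) u • weylGen b r A := fun u => rfl
  refine ⟨{ toFun := κ, map_add' := map_add κ, map_smul' := fun k z => ?_ }, ?_, hκ⟩
  · obtain ⟨u, rfl⟩ := Ideal.Quotient.mk_surjective z
    have h1 : k • Ideal.Quotient.mk (annIdeal b r A) u =
      Ideal.Quotient.mk (annIdeal b r A) (k • u) := rfl
    rw [h1, hκ, hκ, map_smul, smul_assoc, RingHom.id_apply]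
  · intro z z' h
    obtain ⟨u, rfl⟩ := Ideal.Quotient.mk_surjective z
    obtain ⟨v, rfl⟩ := Ideal.Quotient.mk_surjective z'
    have h1 : mapU (subIncl A H) u • weylGen b r A = mapU (subIncl A H) v • weylGen b r A := h
    refine Ideal.Quotient.eq.2 ?_
    change mapU (subIncl A H) (u - v) • weylGen b r A = 0
    rw [map_sub, sub_smul, h1, sub_self]

/-- The block map takes values in U(A ⊗ H) w_λ, which the injection κ identifies with 𝐀_λ; there the
blocks can be multiplied. -/
theorem exists_block_multilinear_boldA (i : b.support) :
    ∃ p : MultilinearMap ℂ (fun _ : Fin (r i) => A) (BoldA b r A),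
      (∀ c a, boldClass b r c (simpleCoroot b i) * p a =
        ∑ k, p (Function.update a k (c * a k))) ∧
      ∃ k : ℂ, k ≠ 0 ∧ p 1 = algebraMap ℂ _ k := by
  obtain ⟨Θ, h1, h2, k, hk, h3⟩ := exists_block_multilinear b r (A := A) i
  obtain ⟨κ, hκ, hκu⟩ := exists_genMap b r (A := A)
  choose u hu using h1
  have hκp : ∀ a, Θ a ∈ LinearMap.range κ := fun a =>
    ⟨Ideal.Quotient.mk _ (u a), by rw [hκu, hu]⟩
  let p : MultilinearMap ℂ (fun _ : Fin (r i) => A) (BoldA b r A) :=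
    (LinearEquiv.ofInjective κ hκ).symm.toLinearMap.compMultilinearMap (Θ.codRestrict _ hκp)
  have hp : ∀ a, κ (p a) = Θ a := fun a =>
    congrArg Subtype.val ((LinearEquiv.ofInjective κ hκ).apply_symm_apply ⟨Θ a, hκp a⟩)
  refine ⟨p, fun c a => hκ ?_, k, hk, hκ ?_⟩
  · rw [map_sum]
    simp only [hp]
    rw [← h2, ← hp]
    obtain ⟨v, hv⟩ := Ideal.Quotient.mk_surjective (p a)
    rw [← hv, boldClass, ← map_mul, hκu, hκu, map_mul, mul_smul, mapU_ι]
    rfl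
  · have h4 : algebraMap ℂ (BoldA b r A) k =
      Ideal.Quotient.mk (annIdeal b r A) (algebraMap ℂ _ k) := rfl
    rw [hp, h3, h4, hκu, AlgHom.commutes, algebraMap_smul]

theorem exists_lift_boldA : ∃ P : TensorPow r A →ₗ[ℂ] BoldA b r A,
    (∀ i c t, boldClass b r c (simpleCoroot b i) * P t = P (symElt r i c * t)) ∧
      ∃ k : ℂ, k ≠ 0 ∧ P 1 = algebraMap ℂ _ k := by
  choose p hp k hk hp1 using exists_block_multilinear_boldA b r (A := A)
  exact exists_lift_of_blocks r _ p hp hk hp1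

theorem mul_apply_eq_of_coroot {B T : Type*} [CommRing B] [Algebra ℂ B] [CommRing T] [Algebra ℂ T]
    (χ : U (A ⊗[ℂ] H) →ₐ[ℂ] B) (σ : U (A ⊗[ℂ] H) →ₐ[ℂ] T) (P : T →ₗ[ℂ] B)
    (hP : ∀ i (a : A) t, χ (UniversalEnvelopingAlgebra.ι ℂ (a ⊗ₜ[ℂ] simpleCoroot b i)) * P t =
      P (σ (UniversalEnvelopingAlgebra.ι ℂ (a ⊗ₜ[ℂ] simpleCoroot b i)) * t))
    (u : U (A ⊗[ℂ] H)) (t : T) : χ u * P t = P (σ u * t) := by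
  have hu : u ∈ Algebra.adjoin ℂ (Set.range (UniversalEnvelopingAlgebra.ι ℂ :
    A ⊗[ℂ] H → U (A ⊗[ℂ] H))) := adjoin_range_ι (A ⊗[ℂ] H) ▸ trivial
  induction hu using Algebra.adjoin_induction generalizing t with
  | mem u hu =>
    obtain ⟨y, rfl⟩ := hu
    induction y with
    | zero => simp
    | add y z hy hz => rw [map_add, map_add, map_add, add_mul, hy, hz, add_mul, map_add]
    | tmul a h =>
      have hh : h ∈ Submodule.span ℂ (Set.range (simpleCoroot b)) := span_coroot b ▸ trivial
      induction hh using Submodule.span_induction with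
      | mem h hh =>
        obtain ⟨i, rfl⟩ := hh
        exact hP i a t
      | zero => simp
      | add h h' _ _ hh hh' =>
        rw [TensorProduct.tmul_add, map_add, map_add, map_add, add_mul, hh, hh', add_mul, map_add]
      | smul z h _ hh =>
        rw [TensorProduct.tmul_smul, map_smul, map_smul, map_smul, smul_mul_assoc, smul_mul_assoc,
          hh, map_smul]
  | algebraMap k =>
    rw [AlgHom.commutes, AlgHom.commutes, ← Algebra.smul_def, ← Algebra.smul_def, map_smul]
  | add u v _ _ hu hv => rw [map_add, map_add, add_mul, hu, hv, add_mul, map_add]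
  | mul u v _ _ hu hv => rw [map_mul χ, map_mul σ, mul_assoc, hv, hu, mul_assoc]

/-- An element of `U(A ⊗ H)` with image zero in `A^{⊗ r_λ}` annihilates the generator of the
global Weyl module. -/
theorem mem_annIdeal_of_symHom_eq_zero {u : U (A ⊗[ℂ] H)} (hu : symHom b r u = 0) :
    u ∈ annIdeal b r A := by
  obtain ⟨P, hP, k, hk, hP1⟩ := exists_lift_boldA b r (A := A)
  -- At t = 1 the intertwining relation says that the class of u times a nonzero scalar is P(σ(u)).
  have h1 := mul_apply_eq_of_coroot b (Ideal.Quotient.mkₐ ℂ (annIdeal b r A)) (symHom b r) P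
    (fun i a t => by rw [symHom_coroot]; exact hP i a t) u 1
  rw [hu, zero_mul, map_zero, hP1, mul_comm, ← Algebra.smul_def, smul_eq_zero] at h1
  exact Ideal.Quotient.eq_zero_iff_mem.1 (h1.resolve_left hk)

end GlobalWeyl
end

/-! ### The surjection from the invariants and the comparison of spectra -/

open scoped TensorProduct

noncomputable section

namespace GlobalWeyl

attribute [local instance] LieRing.ofAssociativeRing

variable {g : Type*} [LieRing g] [LieAlgebra ℂ g] [FiniteDimensional ℂ g]
  [LieAlgebra.IsSimple ℂ g] {H : LieSubalgebra ℂ g} [H.IsCartanSubalgebra]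
  (b : (LieAlgebra.IsKilling.rootSystem H).Base) (r : b.support → ℕ)
  {A : Type*} [CommRing A] [Algebra ℂ A]

theorem symLin_mem (y : A ⊗[ℂ] H) : symLin b r y ∈ InvAlg r A := by
  induction y with
  | zero => rw [map_zero]; exact zero_mem _
  | add y z hy hz => rw [map_add]; exact add_mem hy hz
  | tmul a h =>
    rw [symLin_tmul, Fintype.sum_sigma]
    refine sum_mem fun i _ => ?_
    change ∑ k, fundamentalWeight b i h • single r (⟨i, k⟩ : Pos r) a ∈ InvAlg r A
    rw [← Finset.smul_sum, ← symElt_eq]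
    exact Subalgebra.smul_mem _ (symElt_mem r i a) _

theorem range_symHom : (symHom b r (A := A)).range = InvAlg r A := by
  refine le_antisymm ?_ ?_
  · rw [← Algebra.map_top, ← adjoin_range_ι (A ⊗[ℂ] H), AlgHom.map_adjoin]
    refine Algebra.adjoin_le ?_
    rintro _ ⟨_, ⟨y, rfl⟩, rfl⟩
    have h := symLin_mem b r y
    rw [← symHom_ι] at h
    exact h
  · rw [invAlg_eq_adjoin]
    refine Algebra.adjoin_le ?_
    rintro _ ⟨⟨i, a⟩, rfl⟩
    exact ⟨_, symHom_coroot b r a i⟩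

/-- The invariant ring surjects onto `𝐀_λ`, and the kernel lies in the kernel of each character
given by a tuple of points. -/
theorem exists_proj [Algebra.FiniteType ℂ A] : ∃ q : InvAlg r A →ₐ[ℂ] BoldA b r A,
    Function.Surjective q ∧
    (∀ i a, q ⟨symElt r i a, symElt_mem r i a⟩ = boldClass b r a (simpleCoroot b i)) ∧
    ∀ (S : Pos r → MaximalSpectrum A) x, q x = 0 → evTuple r S x = 0 := by
  let ψ : U (A ⊗[ℂ] H) →ₐ[ℂ] InvAlg r A := (symHom b r).codRestrict (InvAlg r A) fun u =>
    (range_symHom b r).le ⟨u, rfl⟩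
  have hψ : Function.Surjective ψ := fun x => by
    obtain ⟨u, hu⟩ := (range_symHom b r).ge x.2
    exact ⟨u, Subtype.ext hu⟩
  let q : InvAlg r A →ₐ[ℂ] BoldA b r A := ψ.liftOfSurjective hψ
    (Ideal.Quotient.mkₐ ℂ (annIdeal b r A)) fun u hu =>
      Ideal.Quotient.eq_zero_iff_mem.2 (mem_annIdeal_of_symHom_eq_zero b r
        (congrArg Subtype.val ((RingHom.mem_ker).1 hu)))
  have hq : ∀ u, q (ψ u) = Ideal.Quotient.mk (annIdeal b r A) u := fun u =>
    AlgHom.liftOfSurjective_apply ..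
  refine ⟨q, fun z => ?_, fun i a => ?_, fun S x hx => ?_⟩
  · obtain ⟨u, rfl⟩ := Ideal.Quotient.mk_surjective z
    exact ⟨ψ u, hq u⟩
  · have h1 : ψ (UniversalEnvelopingAlgebra.ι ℂ (a ⊗ₜ[ℂ] simpleCoroot b i)) =
      ⟨symElt r i a, symElt_mem r i a⟩ := Subtype.ext (symHom_coroot b r a i)
    rw [← h1, hq]
    rfl
  · obtain ⟨u, rfl⟩ := hψ x
    rw [hq] at hx
    exact evTuple_symHom_eq_zero b r (Ideal.Quotient.eq_zero_iff_mem.1 hx) S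

section Bijection

variable {I : Type*} [Fintype I] (r : I → ℕ) {A : Type*} [CommRing A] [Algebra ℂ A]
  [Algebra.FiniteType ℂ A] {B : Type*} [CommRing B] [Algebra ℂ B]

theorem evTuple_symElt (S : Pos r → MaximalSpectrum A) (i : I) (a : A) :
    evTuple r S (symElt r i a) = ∑ k : Fin (r i), evMax (S ⟨i, k⟩) a := by
  rw [symElt_eq, map_sum]
  exact Finset.sum_congr rfl fun k _ => evTuple_single r S _ a

theorem orbitPoint_eq_of_symElt_mem (S T : Pos r → MaximalSpectrum A)
    (h : ∀ i a, (⟨symElt r i a, symElt_mem r i a⟩ : InvAlg r A) -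
      algebraMap ℂ (InvAlg r A) (∑ k : Fin (r i), evMax (S ⟨i, k⟩) a) ∈
        (orbitPoint r T).asIdeal) : orbitPoint r T = orbitPoint r S := by
  have key : (evTuple r T).comp (InvAlg r A).val = (evTuple r S).comp (InvAlg r A).val := by
    ext x
    change evTuple r T x = evTuple r S x
    have hx : (x : TensorPow r A) ∈
        Algebra.adjoin ℂ (Set.range fun x : I × A => symElt r x.1 x.2) := by
      rw [← invAlg_eq_adjoin]
      exact x.2
    refine (AlgHom.eqOn_adjoin_iff.2 ?_ : Set.EqOn _ _ _) hx
    rintro _ ⟨⟨i, a⟩, rfl⟩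
    have h1 : evTuple r T (symElt r i a - algebraMap ℂ (TensorPow r A)
      (∑ k : Fin (r i), evMax (S ⟨i, k⟩) a)) = 0 := h i a
    rw [map_sub, AlgHom.commutes, sub_eq_zero] at h1
    rw [h1, evTuple_symElt]
    rfl
  exact MaximalSpectrum.ext (congrArg (fun f : InvAlg r A →ₐ[ℂ] ℂ => RingHom.ker f) key)

/-- The bijection is inverse to contraction along q, which reaches every maximal ideal because each
of them contains ker q. It is unique because the sym^i_λ(a) generate the invariants, so the
congruences determine the character. -/
theorem existsUnique_maximalSpectrum_equiv (q : InvAlg r A →ₐ[ℂ] B) (hq : Function.Surjective q)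
    (hker : ∀ (S : Pos r → MaximalSpectrum A) x, q x = 0 → evTuple r S x = 0) :
    ∃! e : MaximalSpectrum (InvAlg r A) ≃ MaximalSpectrum B,
      ∀ (S : Pos r → MaximalSpectrum A) (i : I) (a : A),
        q ⟨symElt r i a, symElt_mem r i a⟩ -
            algebraMap ℂ B (∑ k : Fin (r i), evMax (S ⟨i, k⟩) a) ∈
          (e (orbitPoint r S)).asIdeal := by
  let c : MaximalSpectrum B → MaximalSpectrum (InvAlg r A) := fun N =>
    ⟨N.asIdeal.comap q, have := N.isMaximal; Ideal.comap_isMaximal_of_surjective q hq⟩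
  have hc : Function.Bijective c := by
    refine ⟨fun N N' h => MaximalSpectrum.ext ?_, fun M => ?_⟩
    · exact Ideal.comap_injective_of_surjective q hq (congrArg MaximalSpectrum.asIdeal h)
    · obtain ⟨S, rfl⟩ := orbitPoint_surjective r M
      have hle : RingHom.ker q ≤ (orbitPoint r S).asIdeal := fun x hx => hker S x hx
      have hcm : ((orbitPoint r S).asIdeal.map q).comap q = (orbitPoint r S).asIdeal := by
        rw [Ideal.comap_map_of_surjective q hq, sup_eq_left]
        exact hle
      have hmax : ((orbitPoint r S).asIdeal.map q).IsMaximal := by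
        have := (orbitPoint r S).isMaximal
        refine (Ideal.map_eq_top_or_isMaximal_of_surjective q hq this).resolve_left fun h => ?_
        rw [h, Ideal.comap_top] at hcm
        exact this.ne_top hcm.symm
      exact ⟨⟨_, hmax⟩, MaximalSpectrum.ext hcm⟩
  have hmem : ∀ (N : MaximalSpectrum B) (S : Pos r → MaximalSpectrum A) (i : I) (a : A),
      q ⟨symElt r i a, symElt_mem r i a⟩ -
          algebraMap ℂ B (∑ k : Fin (r i), evMax (S ⟨i, k⟩) a) ∈ N.asIdeal ↔
      (⟨symElt r i a, symElt_mem r i a⟩ : InvAlg r A) -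
        algebraMap ℂ (InvAlg r A) (∑ k : Fin (r i), evMax (S ⟨i, k⟩) a) ∈ (c N).asIdeal := by
    intro N S i a
    change _ ↔ q _ ∈ N.asIdeal
    rw [map_sub, AlgHom.commutes]
  refine ⟨(Equiv.ofBijective c hc).symm, fun S i a => ?_, fun e he => ?_⟩
  · refine (hmem _ S i a).2 ?_
    have h1 : c ((Equiv.ofBijective c hc).symm (orbitPoint r S)) = orbitPoint r S :=
      (Equiv.ofBijective c hc).apply_symm_apply _
    rw [h1]
    change evTuple r S (symElt r i a - algebraMap ℂ (TensorPow r A) _) = 0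
    rw [map_sub, AlgHom.commutes, evTuple_symElt]
    exact sub_self _
  · refine Equiv.ext fun M => ?_
    obtain ⟨S, rfl⟩ := orbitPoint_surjective r M
    rw [Equiv.eq_symm_apply]
    obtain ⟨T, hT⟩ := orbitPoint_surjective r (c (e (orbitPoint r S)))
    refine hT.symm.trans (orbitPoint_eq_of_symElt_mem r S T fun i a => ?_)
    rw [hT]
    exact (hmem _ S i a).1 (he S i a)

end Bijection

end GlobalWeyl
end

theorem mainTheorem6 {g : Type*} [LieRing g] [LieAlgebra ℂ g] [FiniteDimensional ℂ g]
    [LieAlgebra.IsSimple ℂ g] (H : LieSubalgebra ℂ g) [H.IsCartanSubalgebra]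
    (b : (LieAlgebra.IsKilling.rootSystem H).Base) (r : b.support → ℕ)
    (A : Type*) [CommRing A] [Algebra ℂ A] [Algebra.FiniteType ℂ A] :
    -- the maximal ideals of the ring of invariants are the orbits of tuples of maximal ideals
    (Function.Surjective
        (GlobalWeyl.orbitPoint r : (GlobalWeyl.Pos r → MaximalSpectrum A) → _) ∧
      ∀ S T : GlobalWeyl.Pos r → MaximalSpectrum A,
        GlobalWeyl.orbitPoint r S = GlobalWeyl.orbitPoint r T ↔
          ∃ σ : GlobalWeyl.YoungGroup r, T = S ∘ GlobalWeyl.posPerm r σ) ∧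
    -- the canonical bijection
    (∃! e : MaximalSpectrum (GlobalWeyl.InvAlg r A) ≃ MaximalSpectrum (GlobalWeyl.BoldA b r A),
      ∀ (S : GlobalWeyl.Pos r → MaximalSpectrum A) (i : b.support) (a : A),
        GlobalWeyl.boldClass b r a (GlobalWeyl.simpleCoroot b i) -
            algebraMap ℂ (GlobalWeyl.BoldA b r A)
              (∑ k : Fin (r i), GlobalWeyl.evMax (S ⟨i, k⟩) a) ∈
          (e (GlobalWeyl.orbitPoint r S)).asIdeal) ∧
    -- the isomorphism when the Jacobson radical vanishes
    (Ring.jacobson A = ⊥ →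
      ∃ τ : GlobalWeyl.BoldA b r A ≃ₐ[ℂ] GlobalWeyl.InvAlg r A,
        ∀ (i : b.support) (a : A),
          (τ (GlobalWeyl.boldClass b r a (GlobalWeyl.simpleCoroot b i)) :
              GlobalWeyl.TensorPow r A) = GlobalWeyl.symElt r i a) := by
  obtain ⟨q, hq, hqs, hker⟩ := GlobalWeyl.exists_proj b r (A := A)
  refine ⟨⟨GlobalWeyl.orbitPoint_surjective r, GlobalWeyl.orbitPoint_eq_iff r⟩, ?_, fun hA => ?_⟩
  · simp only [← hqs]
    exact GlobalWeyl.existsUnique_maximalSpectrum_equiv r q hq hker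
  -- An element of ker q is killed by every ev_S, and these characters separate points when the
  -- Jacobson radical is zero.
  · have hinj : Function.Injective q := (injective_iff_map_eq_zero q).2 fun x hx =>
      Subtype.ext (GlobalWeyl.eq_zero_of_forall_evTuple r hA fun S => hker S x hx)
    refine ⟨(AlgEquiv.ofBijective q ⟨hinj, hq⟩).symm, fun i a => ?_⟩
    rw [← hqs]
    exact congrArg Subtype.val ((AlgEquiv.ofBijective q ⟨hinj, hq⟩).symm_apply_apply
      ⟨GlobalWeyl.symElt r i a, GlobalWeyl.symElt_mem r i a⟩)
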